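/- Let $K=\mathbb Q(q,t)$. Let $\operatorname{Sym}=K[p_1,p_2,\dots]$ be the ring of symmetric functions in an alphabet $X$ ($p_n$ are the power sums), and put $V_k=\operatorname{Sym}\otimes K[y_1,\dots,y_k]$, $V_*=\bigoplus_{k\ge 0}V_k$. For $F\in V_k$, $F[X\pm(q-1)y]$ denotes the result of replacing each $p_n$ by $p_n\pm(q^n-1)y^n$. **The algebra.** Let $\mathbb A_{q,t}$ be the $K$-linear path algebra of the quiver with vertex set $\mathbb Z_{\ge0}$, arrows $d_+,d_+^*:k\to k+1$, arrows $d_-:k+1\to k$, and loops $T_1,\dots,T_{k-1}:k\to k$ (paths are composed from right to left, and $e_k$ is the idempotent of the vertex $k$), subject to the following relations, where $k$ always denotes the vertex at which the paths start. 1. (Dyck path algebra with parameter $q$ for $T_i,d_-,d_+$.) $(T_i-1)(T_i+q)=0$; $T_iT_{i+1}T_i=T_{i+1}T_iT_{i+1}$; $T_iT_j=T_jT_i$ for $|i-j|>1$; $d_-^2T_{k-1}=d_-^2$ for $k\ge2$; $T_id_-=d_-T_i$ for $1\le i\le k-2$; $T_1d_+^2=d_+^2$; $d_+T_i=T_{i+1}d_+$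 for $1\le i\le k-1$; $d_-(d_+d_--d_-d_+)T_{k-1}=q(d_+d_--d_-d_+)d_-$ for $k\ge2$; $T_1(d_+d_--d_-d_+)d_+=q\,d_+(d_+d_--d_-d_+)$ for $k\ge1$. 2. The same relations with $(q,T_i,d_-,d_+)$ replaced by $(q^{-1},T_i^{-1},d_-,d_+^*)$. 3. $d_+z_i=z_{i+1}d_+$ and $d_+^*y_i=y_{i+1}d_+^*$ for $1\le i\le k$, and $z_1d_+=-tq^{k+1}y_1d_+^*$ for $k\ge0$, where the loops $y_i,z_i$ ($1\le i\le k$) at the vertex $k\geq 1$ are defined by $$y_1=\frac{1}{q^{k-1}(q-1)}(d_+d_--d_-d_+)T_{k-1}\cdots T_1,\qquad y_{i+1}=qT_i^{-1}y_iT_i^{-1},$$ $$z_1=\frac{q^k}{1-q}(d_+^*d_--d_-d_+^*)T_{k-1}^{-1}\cdots T_1^{-1},\qquad z_{i+1}=q^{-1}T_iz_iT_i.$$ **The operators.** On $V_*$ let $e_k$ act as the projection to $V_k$, and for $F\in V_k$ put $$T_iF=\frac{(q-1)y_iF+(y_{i+1}-qy_i)\,\operatorname{swap}_{y_i\leftrightarrow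 y_{i+1}}F}{y_{i+1}-y_i}\quad(1\le i\le k-1),$$ $$d_-F=F[X-(q-1)y_k;y_1,\dots,y_k]\,\exp\Big(-\sum_{n\ge1}\frac{p_n y_k^{-n}}{n}\Big)\Big|_{y_k^0}\quad(k\ge1),$$ $$d_+F=-T_1T_2\cdots T_k\big(y_{k+1}F[X+(q-1)y_{k+1};y_1,\dots,y_k]\big),\qquad d_+^*F=\gamma\big(F[X+(q-1)y_{k+1};y_1,\dots,y_k]\big),$$ where $\gamma$ is the $\operatorname{Sym}$-algebra endomorphism of $V_{k+1}$ with $y_i\mapsto y_{i+1}$ for $i\le k$ and $y_{k+1}\mapsto ty_1$. **Theorem.** These operators define an action of $\mathbb A_{q,t}$ on $V_*$. The kernel of the natural homomorphism of left $\mathbb A_{q,t}$-modules $\mathbb A_{q,t}e_0\to V_*$, $a\mapsto a\cdot 1$ (with $1\in V_0$), is the $\mathbb A_{q,t}$-submodule $$I=\big\langle (d_-d_+^*-1)\,d_+^{*k}e_0,\ (d_++q^ky_1d_+^*)\,d_+^{*k}e_0\ \big|\ k\ge0\big\rangle,$$ and the induced map $\mathbb A_{q,t}e_0/I\to V_*$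 is an isomorphism of $\mathbb A_{q,t}$-modules. -/

import Mathlib

namespace DoubleDyck

noncomputable section

/-! ### The base field and the spaces `V_k` -/

/-- The base field `ℚ(q,t)`. -/
abbrev K : Type := FractionRing (MvPolynomial (Fin 2) ℚ)

/-- The element `q` of `ℚ(q,t)`. -/
def q : K := algebraMap (MvPolynomial (Fin 2) ℚ) K (MvPolynomial.X 0)

/-- The element `t` of `ℚ(q,t)`. -/
def t : K := algebraMap (MvPolynomial (Fin 2) ℚ) K (MvPolynomial.X 1)

/-- `V_k = Sym[X] ⊗ ℚ(q,t)[y_1, …, y_k]`, where `Sym[X]` is the polynomial ring in the power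
sums `p_1, p_2, …`.  The variable `Sum.inl n` is `p_n`, the variable `Sum.inr i` is `y_{i+1}`
(the index set `Fin k` starts at `0`). -/
abbrev V (k : ℕ) : Type := MvPolynomial (ℕ+ ⊕ Fin k) K

/-- The power sum `p_n[X]`. -/
def p {k : ℕ} (n : ℕ+) : V k := MvPolynomial.X (Sum.inl n)

/-- The variables `y`; `y i` stands for `y_{i+1}`, as `Fin k` starts at `0`. -/
def y {k : ℕ} (i : Fin k) : V k := MvPolynomial.X (Sum.inr i)

/-- The algebra homomorphism `V_k → R` with `p_n ↦ f n` and `y_{i+1} ↦ g i`. -/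
def substHom {k : ℕ} {R : Type*} [CommRing R] [Algebra K R] (f : ℕ+ → R) (g : Fin k → R) :
    V k →ₐ[K] R :=
  MvPolynomial.aeval (Sum.elim f g)

/-- The operator interchanging two of the variables `y`. -/
def swapY {k : ℕ} (a b : Fin k) : V k →ₐ[K] V k :=
  substHom p (fun i => y (Equiv.swap a b i))

/-! ### The operators `T_i` -/

/-- The numerator `(q-1) y_a F + (y_b - q y_a) swap F`. -/
def heckeNum {k : ℕ} (a b : Fin k) : V k →ₗ[K] V k :=
  LinearMap.mulLeft K ((q - 1) • y a) +
    (LinearMap.mulLeft K (y b - q • y a)).comp (swapY a b).toLinearMap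

theorem heckeNum_apply {k : ℕ} (a b : Fin k) (F : V k) :
    heckeNum a b F = (q - 1) • y a * F + (y b - q • y a) * swapY a b F := rfl

theorem dvd_sub_swapY {k : ℕ} (a b : Fin k) (F : V k) : (y b - y a) ∣ (F - swapY a b F) := by
  have hba : Ideal.Quotient.mkₐ K (Ideal.span {(y b - y a : V k)}) (y b) =
      Ideal.Quotient.mkₐ K (Ideal.span {(y b - y a : V k)}) (y a) := by
    simp only [Ideal.Quotient.mkₐ_eq_mk]
    exact Ideal.Quotient.eq.2 (Ideal.mem_span_singleton_self _)
  have h : (Ideal.Quotient.mkₐ K (Ideal.span {(y b - y a : V k)})) =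
      (Ideal.Quotient.mkₐ K (Ideal.span {(y b - y a : V k)})).comp (swapY a b) := by
    apply MvPolynomial.algHom_ext
    rintro (n | i)
    · simp [swapY, substHom, p]
    · have : swapY a b (MvPolynomial.X (Sum.inr i)) = y (Equiv.swap a b i) := by
        simp [swapY, substHom]
      rw [AlgHom.comp_apply, this]
      change Ideal.Quotient.mkₐ K _ (y i) = _
      by_cases hia : i = a
      · subst hia
        rw [Equiv.swap_apply_left, hba]
      · by_cases hib : i = b
        · subst hib
          rw [Equiv.swap_apply_right, hba]
        · rw [Equiv.swap_apply_of_ne_of_ne hia hib]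
  have h2 := DFunLike.congr_fun h F
  rw [AlgHom.comp_apply] at h2
  simp only [Ideal.Quotient.mkₐ_eq_mk] at h2
  exact Ideal.mem_span_singleton.1 (Ideal.Quotient.eq.1 h2)

theorem dvd_heckeNum {k : ℕ} (a b : Fin k) (F : V k) : (y b - y a) ∣ heckeNum a b F := by
  obtain ⟨G, hG⟩ := dvd_sub_swapY a b F
  refine ⟨swapY a b F + (q - 1) • y a * G, ?_⟩
  rw [heckeNum_apply, mul_add, mul_left_comm, ← hG]
  simp only [MvPolynomial.smul_eq_C_mul, map_sub, map_one]
  ring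

theorem y_sub_y_ne_zero {k : ℕ} {a b : Fin k} (h : a ≠ b) : (y b - y a : V k) ≠ 0 := by
  intro h0
  have := MvPolynomial.X_injective (R := K) (sub_eq_zero.1 h0)
  exact h (Sum.inr_injective this).symm

/-- The operator `F ↦ ((q-1) y_a F + (y_b - q y_a) swap F) / (y_b - y_a)` (exact division). -/
def hecke {k : ℕ} (a b : Fin k) (h : a ≠ b) : V k →ₗ[K] V k where
  toFun F := (dvd_heckeNum a b F).choose
  map_add' F G := by
    apply mul_left_cancel₀ (y_sub_y_ne_zero h)
    rw [mul_add, ← (dvd_heckeNum a b (F + G)).choose_spec,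
      ← (dvd_heckeNum a b F).choose_spec, ← (dvd_heckeNum a b G).choose_spec, map_add]
  map_smul' c F := by
    apply mul_left_cancel₀ (y_sub_y_ne_zero h)
    rw [RingHom.id_apply, mul_smul_comm, ← (dvd_heckeNum a b (c • F)).choose_spec,
      ← (dvd_heckeNum a b F).choose_spec, map_smul]

theorem hecke_spec {k : ℕ} (a b : Fin k) (h : a ≠ b) (F : V k) :
    (y b - y a) * hecke a b h F = (q - 1) • y a * F + (y b - q • y a) * swapY a b F :=
  (dvd_heckeNum a b F).choose_spec.symm

/-- `T_i : V_k → V_k` for `1 ≤ i ≤ k - 1` (and `0` for other values of `i`, never used). -/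
def opT (k i : ℕ) : V k →ₗ[K] V k :=
  if h : 1 ≤ i ∧ i < k then
    hecke ⟨i - 1, by omega⟩ ⟨i, h.2⟩ (by intro e; have := congrArg Fin.val e; simp at this; omega)
  else 0

/-- `opTUp k j = T_1 T_2 ⋯ T_j` on `V_k`. -/
def opTUp (k : ℕ) : ℕ → (V k →ₗ[K] V k)
  | 0 => LinearMap.id
  | j + 1 => (opTUp k j).comp (opT k (j + 1))

/-! ### The operators `d_+`, `d_+^*`, `d_-` -/

/-- `F ↦ F[X + (q-1) y_{k+1}; y_1, …, y_k]`, from `V_k` to `V_{k+1}`. -/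
def addAlphabet (k : ℕ) : V k →ₐ[K] V (k + 1) :=
  substHom (fun n => p n + (q ^ (n : ℕ) - 1) • y (Fin.last k) ^ (n : ℕ)) (fun i => y i.castSucc)

/-- `d_+ F = - T_1 ⋯ T_k (y_{k+1} F[X + (q-1) y_{k+1}; y_1, …, y_k])`. -/
def opDPlus (k : ℕ) : V k →ₗ[K] V (k + 1) :=
  -((opTUp (k + 1) k).comp
    ((LinearMap.mulLeft K (y (Fin.last k))).comp (addAlphabet k).toLinearMap))

/-- `γ : y_i ↦ y_{i+1}` for `i ≤ k` and `y_{k+1} ↦ t y_1`, on `V_{k+1}`. -/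
def gam (k : ℕ) : V (k + 1) →ₐ[K] V (k + 1) :=
  substHom p (Fin.lastCases (t • y 0) (fun i : Fin k => y i.succ))

/-- `d_+^* F = γ(F[X + (q-1) y_{k+1}; y_1, …, y_k])`. -/
def opDPlusStar (k : ℕ) : V k →ₗ[K] V (k + 1) :=
  ((gam k).comp (addAlphabet k)).toLinearMap

/-- `pExp[-w X] = exp(- ∑_{n ≥ 1} p_n w^n / n)` as a power series in `w`. -/
def pExpNeg (k : ℕ) : PowerSeries (V k) :=
  (PowerSeries.exp ℚ).subst
    (PowerSeries.mk fun n : ℕ => if h : 0 < n then -((n : K)⁻¹ • (p ⟨n, h⟩ : V k)) else 0)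

/-- `F ↦ F[X - (q-1) y_{k+1}; y_1, …, y_k, y_{k+1}]`, written as a polynomial in
`y_{k+1} = Polynomial.X` with coefficients in `V_k`. -/
def subAlphabet (k : ℕ) : V (k + 1) →ₐ[K] Polynomial (V k) :=
  substHom
    (fun n => Polynomial.C (p n) - (q ^ (n : ℕ) - 1) • (Polynomial.X : Polynomial (V k)) ^ (n : ℕ))
    (Fin.lastCases Polynomial.X (fun i : Fin k => Polynomial.C (y i)))

/-- The coefficient of `Y^0` in `P(Y) · pExp[-Y⁻¹ X]`, for a polynomial `P`: the sum over `j` of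
the coefficient of `Y^j` in `P` times the coefficient of `Y^{-j}` in `pExp[-Y⁻¹ X]`. -/
def constTerm (k : ℕ) : Polynomial (V k) →ₗ[V k] V k :=
  Polynomial.lsum fun j => LinearMap.mulRight (V k) (PowerSeries.coeff j (pExpNeg k))

/-- `d_- F = F[X - (q-1) y_{k+1}; y_1, …, y_{k+1}] pExp[-y_{k+1}⁻¹ X] |_{y_{k+1}^0}`,
from `V_{k+1}` to `V_k`. -/
def opDMinus (k : ℕ) : V (k + 1) →ₗ[K] V k :=
  ((constTerm k).restrictScalars K).comp (subAlphabet k).toLinearMap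

/-- `V_* = ⨁_{k ≥ 0} V_k`. -/
abbrev VStar : Type := DirectSum ℕ V

/-- A linear map `V_k → V_l`, extended by zero to an operator on `V_*`. -/
def extendOp {k l : ℕ} (f : V k →ₗ[K] V l) : Module.End K VStar :=
  (DirectSum.lof K ℕ V l).comp (f.comp (DirectSum.component K ℕ V k))

/-- The element `1 ∈ V_0 ⊆ V_*`. -/
def vac : VStar := DirectSum.lof K ℕ V 0 1

/-! ### The algebra -/

/-- The trivial paths and the arrows of the quiver with vertex set `ℕ`. -/
inductive Gen : Type
  /-- the idempotent (trivial path) at the vertex `k` -/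
  | e (k : ℕ) : Gen
  /-- the arrow `d_+` from `k` to `k + 1` -/
  | dPlus (k : ℕ) : Gen
  /-- the arrow `d_+^*` from `k` to `k + 1` -/
  | dPlusStar (k : ℕ) : Gen
  /-- the arrow `d_-` from `k + 1` to `k` -/
  | dMinus (k : ℕ) : Gen
  /-- the loop `T_i` at `k`, `1 ≤ i ≤ k - 1` -/
  | T (k i : ℕ) (h : 1 ≤ i ∧ i < k) : Gen

/-- The operator on `V_*` attached to each generator. -/
def op : Gen → Module.End K VStar
  | .e k => extendOp (LinearMap.id : V k →ₗ[K] V k)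
  | .dPlus k => extendOp (opDPlus k)
  | .dPlusStar k => extendOp (opDPlusStar k)
  | .dMinus k => extendOp (opDMinus k)
  | .T k i _ => extendOp (opT k i)

section Relations

variable {A : Type} [Ring A] [Algebra K A]

/-- The element `d_+ d_- - d_- d_+` at the vertex `k ≥ 1`, where `dp k` is the arrow `d_+` from
`k` to `k + 1` and `dm k` the arrow `d_-` from `k + 1` to `k`. Products are composed right to
left. -/
def comm (dm dp : ℕ → A) (k : ℕ) : A := dp (k - 1) * dm (k - 1) - dm k * dp k

/-- `tDown e T k j = T_j ⋯ T_2 T_1` at the vertex `k`. -/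
def tDown (e : ℕ → A) (T : ℕ → ℕ → A) (k : ℕ) : ℕ → A
  | 0 => e k
  | j + 1 => T k (j + 1) * tDown e T k j

/-- The loops `y_i` at the vertex `k`, `1 ≤ i ≤ k`:
`y_1 = (d_+ d_- - d_- d_+) T_{k-1} ⋯ T_1 / (Q^{k-1} (Q-1))`, `y_{i+1} = Q T_i⁻¹ y_i T_i⁻¹`.
Here `Tinv` stands for the inverses of `T`. -/
def yLoop (Q : K) (e : ℕ → A) (T Tinv : ℕ → ℕ → A) (dm dp : ℕ → A) (k : ℕ) : ℕ → A
  | 0 => 0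
  | 1 => (Q ^ (k - 1) * (Q - 1))⁻¹ • (comm dm dp k * tDown e T k (k - 1))
  | i + 2 => Q • (Tinv k (i + 1) * yLoop Q e T Tinv dm dp k (i + 1) * Tinv k (i + 1))

/-- The defining relations of the Dyck path algebra `𝔸_Q` between `T_i`, `d_-`, `d_+`. -/
inductive DyckRel (Q : K) (e : ℕ → A) (T : ℕ → ℕ → A) (dm dp : ℕ → A) : A → A → Prop
  | quad (k i : ℕ) (h1 : 1 ≤ i) (h2 : i < k) :
      DyckRel Q e T dm dp ((T k i - e k) * (T k i + Q • e k)) 0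
  | braid (k i : ℕ) (h1 : 1 ≤ i) (h2 : i + 1 < k) :
      DyckRel Q e T dm dp (T k i * T k (i + 1) * T k i) (T k (i + 1) * T k i * T k (i + 1))
  | far (k i j : ℕ) (h1 : 1 ≤ i) (h2 : i + 1 < j) (h3 : j < k) :
      DyckRel Q e T dm dp (T k i * T k j) (T k j * T k i)
  | dm_dm_T (k : ℕ) :
      DyckRel Q e T dm dp (dm k * dm (k + 1) * T (k + 2) (k + 1)) (dm k * dm (k + 1))
  | T_dm (k i : ℕ) (h1 : 1 ≤ i) (h2 : i < k) :
      DyckRel Q e T dm dp (T k i * dm k) (dm k * T (k + 1) i)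
  | T_dp_dp (k : ℕ) :
      DyckRel Q e T dm dp (T (k + 2) 1 * dp (k + 1) * dp k) (dp (k + 1) * dp k)
  | dp_T (k i : ℕ) (h1 : 1 ≤ i) (h2 : i < k) :
      DyckRel Q e T dm dp (dp k * T k i) (T (k + 1) (i + 1) * dp k)
  | dm_comm (k : ℕ) (h : 2 ≤ k) :
      DyckRel Q e T dm dp (dm (k - 1) * comm dm dp k * T k (k - 1))
        (Q • (comm dm dp (k - 1) * dm (k - 1)))
  | comm_dp (k : ℕ) (h : 1 ≤ k) :
      DyckRel Q e T dm dp (T (k + 1) 1 * comm dm dp (k + 1) * dp k)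
        (Q • (dp k * comm dm dp k))

end Relations

/-- The free unital associative algebra on the trivial paths and arrows. -/
abbrev Free : Type := FreeAlgebra K Gen

namespace Free

/-- The trivial path at `k`. -/
def e (k : ℕ) : Free := FreeAlgebra.ι K (Gen.e k)

/-- The arrow `d_+` from `k` to `k + 1`. -/
def dp (k : ℕ) : Free := FreeAlgebra.ι K (Gen.dPlus k)

/-- The arrow `d_+^*` from `k` to `k + 1`. -/
def ds (k : ℕ) : Free := FreeAlgebra.ι K (Gen.dPlusStar k)

/-- The arrow `d_-` from `k + 1` to `k`. -/
def dm (k : ℕ) : Free := FreeAlgebra.ι K (Gen.dMinus k)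

/-- The loop `T_i` at `k` for `1 ≤ i ≤ k - 1` (and `0` for other `i`, never used). -/
def T (k i : ℕ) : Free := if h : 1 ≤ i ∧ i < k then FreeAlgebra.ι K (Gen.T k i h) else 0

/-- The inverse loop: `(T_i - 1)(T_i + q) = 0` means `T_i⁻¹ = q⁻¹ (T_i + (q - 1))`. -/
def Tinv (k i : ℕ) : Free := q⁻¹ • (T k i + (q - 1) • e k)

/-- The loop `y_i` at `k`, built from `T_i`, `d_-`, `d_+` with parameter `q`. -/
def yl (k i : ℕ) : Free := yLoop q e T Tinv dm dp k i

/-- The loop `z_i` at `k`: the loop `y_i` built from `T_i⁻¹`, `d_-`, `d_+^*` with parameter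
`q⁻¹`. -/
def zl (k i : ℕ) : Free := yLoop q⁻¹ e Tinv T dm ds k i

end Free

open Free in
/-- The defining relations of `𝔸_{q,t}`. -/
inductive QuiverRel : Free → Free → Prop
  -- composition of paths with trivial paths
  | e_e (k : ℕ) : QuiverRel (e k * e k) (e k)
  | e_e_ne (k l : ℕ) (h : k ≠ l) : QuiverRel (e k * e l) 0
  | e_dp (k : ℕ) : QuiverRel (e (k + 1) * dp k) (dp k)
  | dp_e (k : ℕ) : QuiverRel (dp k * e k) (dp k)
  | e_ds (k : ℕ) : QuiverRel (e (k + 1) * ds k) (ds k)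
  | ds_e (k : ℕ) : QuiverRel (ds k * e k) (ds k)
  | e_dm (k : ℕ) : QuiverRel (e k * dm k) (dm k)
  | dm_e (k : ℕ) : QuiverRel (dm k * e (k + 1)) (dm k)
  | e_T (k i : ℕ) (h1 : 1 ≤ i) (h2 : i < k) : QuiverRel (e k * T k i) (T k i)
  | T_e (k i : ℕ) (h1 : 1 ≤ i) (h2 : i < k) : QuiverRel (T k i * e k) (T k i)
  -- relations of `𝔸_q` for `T_i`, `d_-`, `d_+`
  | dyck {a b : Free} (h : DyckRel q e T dm dp a b) : QuiverRel a b
  -- relations of `𝔸_{q⁻¹}` for `T_i⁻¹`, `d_-`, `d_+^*`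
  | dyckStar {a b : Free} (h : DyckRel q⁻¹ e Tinv dm ds a b) : QuiverRel a b
  -- intertwining relations
  | dp_z (k i : ℕ) (h1 : 1 ≤ i) (h2 : i ≤ k) : QuiverRel (dp k * zl k i) (zl (k + 1) (i + 1) * dp k)
  | ds_y (k i : ℕ) (h1 : 1 ≤ i) (h2 : i ≤ k) : QuiverRel (ds k * yl k i) (yl (k + 1) (i + 1) * ds k)
  | z_dp (k : ℕ) : QuiverRel (zl (k + 1) 1 * dp k) (-(t * q ^ (k + 1)) • (yl (k + 1) 1 * ds k))

/-- The double Dyck path algebra `𝔸_{q,t}` with an identity adjoined. Since the quiver has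
infinitely many vertices, the path algebra itself (`pathAlgebra` below) has only the local units
`e_k`; none of the relations involves the adjoined identity, so this ring is
`ℚ(q,t) · 1 ⊕ 𝔸_{q,t}`. Left submodules of `𝔸_{q,t} e_0`, and homomorphisms out of it to modules
in which `e_0, e_1, …` act as the projections of a direct sum decomposition, are the same over
both. -/
def Aqt : Type := RingQuot QuiverRel

instance : Ring Aqt := inferInstanceAs (Ring (RingQuot QuiverRel))

instance : Algebra K Aqt := inferInstanceAs (Algebra K (RingQuot QuiverRel))

/-- The quotient map from the free algebra. -/
def toAqt : Free →ₐ[K] Aqt := RingQuot.mkAlgHom K QuiverRel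

theorem toAqt_surjective : Function.Surjective toAqt := RingQuot.mkAlgHom_surjective K QuiverRel

theorem toAqt_rel {a b : Free} (h : QuiverRel a b) : toAqt a = toAqt b := RingQuot.mkAlgHom_rel K h

/-- The image of a generator in the algebra. -/
def gen (g : Gen) : Aqt := toAqt (FreeAlgebra.ι K g)

/-- The (non-unital) algebra `𝔸_{q,t}`: the span of all paths. -/
def pathAlgebra : NonUnitalSubalgebra K Aqt := NonUnitalAlgebra.adjoin K (Set.range gen)

/-- The left module `𝔸_{q,t} e_0`. -/
def Ae0 : Submodule Aqt Aqt := Submodule.span Aqt {gen (Gen.e 0)}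

theorem mul_mem_pathAlgebra (b a : Aqt) (ha : a ∈ pathAlgebra) : b * a ∈ pathAlgebra := by
  obtain ⟨f, rfl⟩ := toAqt_surjective b
  induction f using FreeAlgebra.induction generalizing a with
  | grade0 c =>
    rw [AlgHom.commutes, ← Algebra.smul_def]
    exact SMulMemClass.smul_mem c ha
  | grade1 g =>
    exact pathAlgebra.mul_mem (NonUnitalAlgebra.subset_adjoin K (Set.mem_range_self g)) ha
  | mul f g hf hg =>
    rw [map_mul, mul_assoc]
    exact hf _ (hg _ ha)
  | add f g hf hg =>
    rw [map_add, add_mul]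
    exact pathAlgebra.add_mem (hf _ ha) (hg _ ha)

theorem gen_e_mul_self (k : ℕ) : gen (Gen.e k) * gen (Gen.e k) = gen (Gen.e k) := by
  rw [gen, ← map_mul]
  exact toAqt_rel (QuiverRel.e_e k)

/-- `Ae0` consists of the products `a e_0` with `a` in the path algebra. -/
theorem mem_Ae0_iff (x : Aqt) : x ∈ Ae0 ↔ ∃ a ∈ pathAlgebra, a * gen (Gen.e 0) = x := by
  constructor
  · intro hx
    obtain ⟨b, rfl⟩ := Submodule.mem_span_singleton.1 hx
    refine ⟨b * gen (Gen.e 0), mul_mem_pathAlgebra _ _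
      (NonUnitalAlgebra.subset_adjoin K (Set.mem_range_self _)), ?_⟩
    rw [mul_assoc, gen_e_mul_self, smul_eq_mul]
  · rintro ⟨a, -, rfl⟩
    exact Submodule.mem_span_singleton.2 ⟨a, rfl⟩

/-- The elements `d_+^{*k} e_0` of `𝔸_{q,t} e_0`. -/
def dsPow : ℕ → Ae0
  | 0 => ⟨gen (Gen.e 0), Submodule.mem_span_singleton_self _⟩
  | k + 1 => gen (Gen.dPlusStar k) • dsPow k

/-- The submodule of `𝔸_{q,t} e_0` generated by `(d_- d_+^* - 1) d_+^{*k} e_0` and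
`(d_+ + q^k y_1 d_+^*) d_+^{*k} e_0` for `k ≥ 0`. -/
def I : Submodule Aqt Ae0 :=
  Submodule.span Aqt
    (Set.range (fun k : ℕ =>
        (gen (Gen.dMinus k) * gen (Gen.dPlusStar k) - 1) • dsPow k) ∪
      Set.range (fun k : ℕ =>
        (gen (Gen.dPlus k) +
          (q ^ k) • (toAqt (Free.yl (k + 1) 1) * gen (Gen.dPlusStar k))) •
            dsPow k))

/-! ### The module `V_*` and the natural map -/

/-- The space `V_*`, regarded as a left module through an action `ρ` of the algebra. -/
def ActionModule (_ρ : Aqt →ₐ[K] Module.End K VStar) : Type := VStar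

instance (ρ : Aqt →ₐ[K] Module.End K VStar) : AddCommGroup (ActionModule ρ) :=
  inferInstanceAs (AddCommGroup VStar)

instance (ρ : Aqt →ₐ[K] Module.End K VStar) : Module Aqt (ActionModule ρ) :=
  Module.compHom VStar ρ.toRingHom

/-- The natural homomorphism `𝔸_{q,t} e_0 → V_*`, `a ↦ a · 1` with `1 ∈ V_0`. -/
def naturalMap (ρ : Aqt →ₐ[K] Module.End K VStar) : Ae0 →ₗ[Aqt] ActionModule ρ :=
  (LinearMap.toSpanSingleton Aqt (ActionModule ρ) vac).comp Ae0.subtype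

theorem naturalMap_apply (ρ : Aqt →ₐ[K] Module.End K VStar) (a : Ae0) :
    naturalMap ρ a = ρ (a : Aqt) vac := rfl

end

end DoubleDyck

/-!
The theorem has two parts: the operators on `V_*` satisfy the relations of the algebra, and the
module `N = 𝔸_{q,t} e_0 / I` is no larger than `V_*`.

*Relations.* Let `a : V_k → V_{k+1}` be the homomorphism that adds the alphabet `(q-1) y_{k+1}`, and
let `E_n ∈ Sym` be the coefficient of `w^n` in `exp (-∑ p_n w^n / n)`, up to sign the `n`-th
elementary symmetric function (`pExpCoeff`). The operator `d_-` is determined by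
`d_-(a(F) G) = F d_-(G)` and `d_-(y_{k+1}^n) = E_n`, because `V_{k+1}` is spanned by the products
`a(F) y_{k+1}^n` (`induction_addAlphabet`), while `d_+^*` is a homomorphism of algebras. Every
relation thus becomes an identity between the `E_n`, and these follow from the rule
`f(E_{n+1}) - x f(E_n) = E_{n+1} - q x E_n` for a homomorphism `f` that adds the alphabet `(q-1) x`
(`map_pExpCoeff`, a comparison of linear differential equations). The relations involving `d_-²` or
the commutator of `d_-` with `d_+^*` rest on antisymmetry in the last two variables
(`opDMinus_opDMinus_swapY`, `commStarDefect_swapY`). The loop `y_i` acts as multiplication by the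
variable `y_i` (`opY_apply`). This gives `action`, and `I_le_ker` shows that `I` acts by zero on
`1 ∈ V_0`, so that there is an induced map `N → V_*`.

*The module.* An inverse `V_* → N` is constructed. In the algebra the loops `y_i` at a vertex
commute (`commute_Y`), and so do the elements `E_n = d_- y_{k+1}^{n-1} S` with
`S = -(T_1 ⋯ T_k)⁻¹ d_+`, which act on `V_k` as multiplication by the symmetric functions `E_n`
(`commute_E`, `commute_E_Y`, `action_ringE`). As `V_k` is a polynomial ring, and the power sums are
polynomials in the `E_n` by Newton's identities, there is a homomorphism `ψ_k` from `V_k` to the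
algebra with `E_n ↦ E_n` and `y_i ↦ y_i`. With `v_k` the class of `d_+^{*k} e_0` in `N`, the map
`F ↦ ψ_k(F) v_k` followed by `N → V_*` is the identity (`quotientMap_symMap`), so it remains to see
that it is surjective. On the one hand, the sums of vectors `d_-^m F(y) v_{k+m}` form a submodule of
`N`: here the only delicate point is stability under `d_+^*`, which follows from the relations
expressing `(d_+^* d_- - d_- d_+^*) y_k` and `(d_+^* d_- - d_- d_+^*) d_-` through simpler words
(`comm_Y_last`, `gen_smul_wordSum_mem`). On the other hand, the vectors `ψ_k(F) v_k` are stable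
under `d_-`, by the commutation rule `dm_E` between `d_-` and the `E_n` (`dm_pow_smul`). Since `N` is
generated by `v_0`, the map is surjective.
-/

namespace DoubleDyck

noncomputable section

section

/-! ### Divided-difference operators -/

theorem q_ne_zero : q ≠ 0 := by
  rw [q, Ne, FaithfulSMul.algebraMap_eq_zero_iff]
  exact MvPolynomial.X_ne_zero 0

theorem q_sub_one_ne_zero : q - 1 ≠ 0 := by
  rw [q, ← map_one (algebraMap (MvPolynomial (Fin 2) ℚ) K), ← map_sub, Ne,
    FaithfulSMul.algebraMap_eq_zero_iff]
  intro h
  have := congrArg (MvPolynomial.eval fun _ => (0 : ℚ)) h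
  simp at this

theorem one_add_q_ne_zero : 1 + q ≠ 0 := by
  rw [q, ← map_one (algebraMap (MvPolynomial (Fin 2) ℚ) K), ← map_add, Ne,
    FaithfulSMul.algebraMap_eq_zero_iff]
  intro h
  have := congrArg (MvPolynomial.eval fun _ => (0 : ℚ)) h
  simp at this

variable {k l : ℕ}

@[simp] theorem substHom_p {R : Type*} [CommRing R] [Algebra K R] (f : ℕ+ → R) (g : Fin k → R)
    (n : ℕ+) : substHom f g (p n) = f n := by simp [substHom, p]

@[simp] theorem substHom_y {R : Type*} [CommRing R] [Algebra K R] (f : ℕ+ → R) (g : Fin k → R)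
    (i : Fin k) : substHom f g (y i) = g i := by simp [substHom, y]

/-- Algebra homomorphisms out of `V k` are determined by the images of the variables. -/
theorem algHom_ext_V {R : Type*} [CommRing R] [Algebra K R] {f g : V k →ₐ[K] R}
    (hp : ∀ n, f (p n) = g (p n)) (hy : ∀ i, f (y i) = g (y i)) : f = g := by
  apply MvPolynomial.algHom_ext
  rintro (n | i)
  exacts [hp n, hy i]

@[simp] theorem swapY_p (a b : Fin k) (n : ℕ+) : swapY a b (p n) = p n := by simp [swapY]

@[simp] theorem swapY_y (a b i : Fin k) : swapY a b (y i) = y (Equiv.swap a b i) := by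
  simp [swapY]

@[simp] theorem swapY_swapY (a b : Fin k) (F : V k) : swapY a b (swapY a b F) = F := by
  have : (swapY a b).comp (swapY a b) = AlgHom.id K (V k) :=
    algHom_ext_V (by simp) (by simp)
  exact DFunLike.congr_fun this F

theorem swapY_comp_swapY (a b c : Fin k) (hac : a ≠ c) (hbc : b ≠ c) (F : V k) :
    swapY a b (swapY b c (swapY a b F)) = swapY a c F := by
  have : (swapY a b).comp ((swapY b c).comp (swapY a b)) = swapY a c := by
    apply algHom_ext_V (by simp)
    intro i
    simp only [AlgHom.comp_apply, swapY_y]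
    congr 1
    have h := Equiv.swap_mul_swap_mul_swap hbc.symm hac.symm
    rw [Equiv.swap_comm b a, Equiv.swap_comm c b] at h
    exact DFunLike.congr_fun h i
  exact DFunLike.congr_fun this F

/-- `q` as an element of `V k`. -/
abbrev qV : V k := MvPolynomial.C q

theorem smul_q (F : V k) : q • F = qV * F := MvPolynomial.smul_eq_C_mul _ _

theorem smul_q_sub_one (F : V k) : (q - 1) • F = (qV - 1) * F := by
  rw [MvPolynomial.smul_eq_C_mul, map_sub, map_one]

section

variable {a b : Fin k} (h : a ≠ b)

theorem hecke_spec' (F : V k) :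
    (y b - y a) * hecke a b h F = (qV - 1) * y a * F + (y b - qV * y a) * swapY a b F := by
  rw [hecke_spec, smul_q_sub_one, smul_q]

/-- A solution of the defining equation of `hecke a b h F` is `hecke a b h F`. -/
theorem hecke_unique {F G : V k}
    (hG : (y b - y a) * G = (qV - 1) * y a * F + (y b - qV * y a) * swapY a b F) :
    hecke a b h F = G :=
  mul_left_cancel₀ (y_sub_y_ne_zero h) ((hecke_spec' h F).trans hG.symm)

theorem hecke_mul {G : V k} (hG : swapY a b G = G) (F : V k) :
    hecke a b h (G * F) = G * hecke a b h F := by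
  apply hecke_unique
  rw [map_mul, hG]
  linear_combination G * hecke_spec' h F

theorem hecke_of_swapY_eq {F : V k} (hF : swapY a b F = F) : hecke a b h F = F := by
  apply hecke_unique
  rw [hF]
  ring

/-- The invariants of `T` are the polynomials symmetric in the two variables. -/
theorem swapY_eq_of_hecke_eq {F : V k} (hF : hecke a b h F = F) : swapY a b F = F := by
  have h1 := hecke_spec' h F
  rw [hF] at h1
  have h2 : (y b - qV * y a : V k) ≠ 0 := by
    intro h0
    have := congrArg (MvPolynomial.eval (Sum.elim (fun _ => (0 : K))
      (fun i => if i = b then 1 else 0))) h0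
    simp [y, h] at this
  apply mul_left_cancel₀ h2
  linear_combination -h1

theorem swapY_hecke (F : V k) :
    (y a - y b) * swapY a b (hecke a b h F) =
      (qV - 1) * y b * swapY a b F + (y a - qV * y b) * F := by
  have := congrArg (swapY a b) (hecke_spec' h F)
  simpa only [map_mul, map_sub, map_add, swapY_y, Equiv.swap_apply_left, Equiv.swap_apply_right,
    swapY_swapY, MvPolynomial.algHom_C, map_one, MvPolynomial.algebraMap_eq] using this

/-- The quadratic relation `T² = (1 - q) T + q`. -/
theorem hecke_hecke (F : V k) :
    hecke a b h (hecke a b h F) = (1 - qV) * hecke a b h F + qV * F := by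
  apply hecke_unique
  apply mul_left_cancel₀ (y_sub_y_ne_zero h)
  linear_combination ((1 - qV) * (y b - y a) - (qV - 1) * y a) * hecke_spec' h F +
    (y b - qV * y a) * swapY_hecke h F

theorem hecke_y_right_mul (F : V k) :
    hecke a b h (y b * F) = y a * hecke a b h F + (qV - 1) * y a * F := by
  apply hecke_unique
  simp only [map_mul, swapY_y, Equiv.swap_apply_right]
  linear_combination y a * hecke_spec' h F

theorem hecke_y_left_mul (F : V k) :
    hecke a b h (y a * F) = y b * hecke a b h F - (qV - 1) * y a * F := by
  apply hecke_unique
  simp only [map_mul, swapY_y, Equiv.swap_apply_left]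
  linear_combination y b * hecke_spec' h F

/-- A linear map compatible with the two variables and with their exchange intertwines the
divided-difference operators. -/
theorem map_hecke {M : V k →ₗ[K] V l} {a' b' : Fin l} (h' : a' ≠ b')
    (ha : ∀ F, M (y a * F) = y a' * M F) (hb : ∀ F, M (y b * F) = y b' * M F)
    (hs : ∀ F, M (swapY a b F) = swapY a' b' (M F)) (F : V k) :
    M (hecke a b h F) = hecke a' b' h' (M F) := by
  symm
  apply hecke_unique
  have h1 := congrArg M (hecke_spec a b h F)
  simp only [sub_mul, smul_mul_assoc, map_sub, map_add, map_smul, ha, hb, hs] at h1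
  simp only [smul_q_sub_one, smul_q] at h1
  linear_combination h1

theorem algHom_hecke (f : V k →ₐ[K] V l) {a' b' : Fin l} (h' : a' ≠ b')
    (hp : ∀ n, swapY a' b' (f (p n)) = f (p n))
    (hy : ∀ i, swapY a' b' (f (y i)) = f (y (Equiv.swap a b i)))
    (ha : f (y a) = y a') (hb : f (y b) = y b') (F : V k) :
    f (hecke a b h F) = hecke a' b' h' (f F) := by
  have : f.comp (swapY a b) = (swapY a' b').comp f :=
    algHom_ext_V (by simp [hp]) (by simp [hy])
  exact map_hecke (M := f.toLinearMap) h h' (by simp [ha]) (by simp [hb])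
    (DFunLike.congr_fun this) F

theorem swapY_comm {a b c d : Fin k} (hac : a ≠ c) (had : a ≠ d) (hbc : b ≠ c) (hbd : b ≠ d)
    (F : V k) : swapY a b (swapY c d F) = swapY c d (swapY a b F) := by
  have : (swapY a b).comp (swapY c d) = (swapY c d).comp (swapY a b) := by
    apply algHom_ext_V (by simp)
    intro i
    simp only [AlgHom.comp_apply, swapY_y]
    congr 1
    have : Commute (Equiv.swap a b) (Equiv.swap c d) := by
      apply Equiv.Perm.Disjoint.commute
      intro i
      by_cases h1 : i = a
      · subst h1; right; exact Equiv.swap_apply_of_ne_of_ne hac had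
      · by_cases h2 : i = b
        · subst h2; right; exact Equiv.swap_apply_of_ne_of_ne hbc hbd
        · left; exact Equiv.swap_apply_of_ne_of_ne h1 h2
    exact DFunLike.congr_fun this.eq i
  exact DFunLike.congr_fun this F

theorem hecke_comm {c d : Fin k} (h' : c ≠ d) (hac : a ≠ c) (had : a ≠ d) (hbc : b ≠ c)
    (hbd : b ≠ d) (F : V k) :
    hecke a b h (hecke c d h' F) = hecke c d h' (hecke a b h F) := by
  refine map_hecke (M := hecke a b h) h' h' ?_ ?_ ?_ F
  · exact fun F => hecke_mul h
      (by rw [swapY_y, Equiv.swap_apply_of_ne_of_ne hac.symm hbc.symm]) F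
  · exact fun F => hecke_mul h
      (by rw [swapY_y, Equiv.swap_apply_of_ne_of_ne had.symm hbd.symm]) F
  · intro F
    symm
    apply map_hecke (M := (swapY c d).toLinearMap) h h
    · intro F
      simp [Equiv.swap_apply_of_ne_of_ne hac had]
    · intro F
      simp [Equiv.swap_apply_of_ne_of_ne hbc hbd]
    · exact fun F => swapY_comm hac.symm hbc.symm had.symm hbd.symm F

end

/-- The computation behind the braid relation: `f`, `f1`, `f2`, `f12`, … are the six images of one
element under the permutations of the three variables. -/
theorem braid_aux {L : Type*} [Field L] {r A B C f f1 f2 f12 f21 f121 u u1 u2 u12 v v1 w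
    m m1 m2 m21 n n2 o : L} (hAB : B - A ≠ 0) (hBC : C - B ≠ 0) (hAC : C - A ≠ 0)
    (hu : (B - A) * u = (r - 1) * A * f + (B - r * A) * f1)
    (hu1 : (A - B) * u1 = (r - 1) * B * f1 + (A - r * B) * f)
    (hu2 : (C - A) * u2 = (r - 1) * A * f2 + (C - r * A) * f21)
    (hu12 : (C - B) * u12 = (r - 1) * B * f12 + (C - r * B) * f121)
    (hv : (C - B) * v = (r - 1) * B * u + (C - r * B) * u2)
    (hv1 : (C - A) * v1 = (r - 1) * A * u1 + (C - r * A) * u12)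
    (hw : (B - A) * w = (r - 1) * A * v + (B - r * A) * v1)
    (hm : (C - B) * m = (r - 1) * B * f + (C - r * B) * f2)
    (hm2 : (B - C) * m2 = (r - 1) * C * f2 + (B - r * C) * f)
    (hm1 : (C - A) * m1 = (r - 1) * A * f1 + (C - r * A) * f12)
    (hm21 : (B - A) * m21 = (r - 1) * A * f21 + (B - r * A) * f121)
    (hn : (B - A) * n = (r - 1) * A * m + (B - r * A) * m1)
    (hn2 : (C - A) * n2 = (r - 1) * A * m2 + (C - r * A) * m21)
    (ho : (C - B) * o = (r - 1) * B * n + (C - r * B) * n2) : w = o := by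
  have hBA : A - B ≠ 0 := by rwa [← neg_sub, neg_ne_zero]
  have hCB : B - C ≠ 0 := by rwa [← neg_sub, neg_ne_zero]
  rw [mul_comm, ← eq_div_iff (by assumption)] at hu hu1 hu2 hu12 hv hv1 hw hm hm1 hm2 hm21 hn hn2 ho
  have e1 : A - B = -(B - A) := by ring
  have e2 : B - C = -(C - B) := by ring
  rw [e1] at hu1
  rw [e2] at hm2
  rw [hw, ho, hv, hv1, hn, hn2, hu, hu1, hu2, hu12, hm, hm1, hm2, hm21]
  field_simp
  ring

theorem hecke_braid {a b c : Fin k} (hab : a ≠ b) (hbc : b ≠ c) (hac : a ≠ c) (F : V k) :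
    hecke a b hab (hecke b c hbc (hecke a b hab F)) =
      hecke b c hbc (hecke a b hab (hecke b c hbc F)) := by
  apply IsFractionRing.injective (V k) (FractionRing (V k))
  have hne : ∀ {i j : Fin k}, i ≠ j →
      algebraMap (V k) (FractionRing (V k)) (y j) - algebraMap _ _ (y i) ≠ 0 := by
    intro i j hij
    rw [← map_sub, Ne, FaithfulSMul.algebraMap_eq_zero_iff]
    exact y_sub_y_ne_zero hij
  have e1 : swapY a b (swapY b c (swapY a b F)) = swapY a c F :=
    swapY_comp_swapY a b c hac hbc F
  have e2 : swapY b c (swapY a b (swapY b c F)) = swapY a c F := by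
    have := swapY_comp_swapY c b a hac.symm hab.symm F
    have h' : ∀ i j : Fin k, swapY i j = swapY j i := fun i j => by
      simp only [swapY, Equiv.swap_comm]
    rwa [h' c b, h' b a, h' c a] at this
  have spec := fun (i j : Fin k) (h : i ≠ j) (G : V k) =>
    congrArg (algebraMap (V k) (FractionRing (V k))) (hecke_spec' h G)
  have spec' := fun (i j : Fin k) (h : i ≠ j) (s : V k →ₐ[K] V k) (G : V k) =>
    congrArg (fun G => algebraMap (V k) (FractionRing (V k)) (s G)) (hecke_spec' h G)
  simp only [map_mul, map_sub, map_add, map_one] at spec spec'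
  have hq : ∀ s : V k →ₐ[K] V k, s (qV : V k) = qV := fun s => s.commutes q
  simp only [hq] at spec'
  have sab : Equiv.swap a b c = c := Equiv.swap_apply_of_ne_of_ne hac.symm hbc.symm
  have sbc : Equiv.swap b c a = a := Equiv.swap_apply_of_ne_of_ne hab hac
  have s1 := fun (i j : Fin k) (h : i ≠ j) G => spec' i j h (swapY a b) G
  have s2 := fun (i j : Fin k) (h : i ≠ j) G => spec' i j h (swapY b c) G
  have s12 := fun (i j : Fin k) (h : i ≠ j) G => spec' i j h ((swapY a b).comp (swapY b c)) G
  have s21 := fun (i j : Fin k) (h : i ≠ j) G => spec' i j h ((swapY b c).comp (swapY a b)) G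
  simp only [AlgHom.comp_apply, swapY_y] at s1 s2 s12 s21
  have u := spec a b hab F
  have u1 := s1 a b hab F
  have u2 := s2 a b hab F
  have u12 := s12 a b hab F
  have v := spec b c hbc (hecke a b hab F)
  have v1 := s1 b c hbc (hecke a b hab F)
  have w := spec a b hab (hecke b c hbc (hecke a b hab F))
  have m := spec b c hbc F
  have m2 := s2 b c hbc F
  have m1 := s1 b c hbc F
  have m21 := s21 b c hbc F
  have n := spec a b hab (hecke b c hbc F)
  have n2 := s2 a b hab (hecke b c hbc F)
  have o := spec b c hbc (hecke a b hab (hecke b c hbc F))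
  simp only [Equiv.swap_apply_left, Equiv.swap_apply_right, sab, sbc, swapY_swapY, e1, e2]
    at u u1 u2 u12 v v1 w m m2 m1 m21 n n2 o
  exact braid_aux (hne hab) (hne hbc) (hne hac) u u1 u2 u12 v v1 w m m2 m1 m21 n n2 o

end

section

/-! ### The coefficients of `pExp[-wX]` -/

/-- The coefficient of `w ^ n` in `pExp[-w X]`, which is `(-1) ^ n e_n[X]`. -/
def pExpCoeff (k n : ℕ) : V k := PowerSeries.coeff n (pExpNeg k)

/-- `∑_{n ≥ 0} p_{n+1} w ^ n`. -/
def pSeries (k : ℕ) : PowerSeries (V k) := PowerSeries.mk fun n => p n.succPNat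

/-- `pExp[-wX]` is a genuine exponential: its constant coefficient is `1`, and it solves the
differential equation whose coefficients are Newton's identities. -/
theorem pExpNeg_spec (k : ℕ) : PowerSeries.coeff 0 (pExpNeg k) = 1 ∧
    PowerSeries.derivative (V k) (pExpNeg k) = -pSeries k * pExpNeg k := by
  set g : PowerSeries (V k) :=
    PowerSeries.mk fun n : ℕ => if h : 0 < n then -((n : K)⁻¹ • (p ⟨n, h⟩ : V k)) else 0 with hg
  have hg0 : PowerSeries.constantCoeff g = 0 := by
    rw [← PowerSeries.coeff_zero_eq_constantCoeff_apply, hg, PowerSeries.coeff_mk]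
    simp
  have hs : PowerSeries.HasSubst g := PowerSeries.HasSubst.of_constantCoeff_zero' hg0
  have hexp : pExpNeg k = (PowerSeries.exp (V k)).subst g := by
    refine PowerSeries.ext fun n => ?_
    rw [pExpNeg, PowerSeries.coeff_subst' hs, PowerSeries.coeff_subst' hs]
    apply finsum_congr
    intro d
    simp [PowerSeries.coeff_exp, Algebra.smul_def]
  have hder : PowerSeries.derivative (V k) g = -pSeries k := by
    refine PowerSeries.ext fun n => ?_
    rw [PowerSeries.coeff_derivative, hg, PowerSeries.coeff_mk, dif_pos n.succ_pos, pSeries,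
      map_neg, PowerSeries.coeff_mk]
    have : ((n + 1 : ℕ) : K) ≠ 0 := by exact_mod_cast n.succ_ne_zero
    have h1 : ((n : V k) + 1) = MvPolynomial.C ((n + 1 : ℕ) : K) := by simp
    change -((((n + 1 : ℕ) : K)⁻¹) • (p n.succPNat : V k)) * _ = -p n.succPNat
    have h2 :
        (MvPolynomial.C ((n + 1 : ℕ) : K)⁻¹ * MvPolynomial.C ((n + 1 : ℕ) : K) : V k) = 1 := by
      rw [← map_mul, inv_mul_cancel₀ this, map_one]
    rw [MvPolynomial.smul_eq_C_mul, h1]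
    linear_combination -(p n.succPNat : V k) * h2
  constructor
  · rw [pExpNeg, PowerSeries.coeff_subst' hs, finsum_eq_single _ 0]
    · simp
    · intro d hd
      simp [hg0, hd]
  · rw [hexp, PowerSeries.derivative_subst hs, PowerSeries.derivative_exp, hder]
    ring

@[simp] theorem pExpCoeff_zero (k : ℕ) : pExpCoeff k 0 = 1 := (pExpNeg_spec k).1

/-- Newton's identities. -/
theorem newton (k n : ℕ) : (n + 1 : V k) * pExpCoeff k (n + 1) =
    -∑ ij ∈ Finset.HasAntidiagonal.antidiagonal n, p ij.1.succPNat * pExpCoeff k ij.2 := by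
  have := congrArg (PowerSeries.coeff n) (pExpNeg_spec k).2
  rw [PowerSeries.coeff_derivative, neg_mul (pSeries k), map_neg, PowerSeries.coeff_mul] at this
  rw [mul_comm]
  simpa only [pExpCoeff, pSeries, PowerSeries.coeff_mk] using this

section ODE

open PowerSeries

variable {R : Type*} [CommRing R]

/-- Uniqueness for the linear differential equation `(1 - c w) F' = M F`, `F(0) = 0`. -/
theorem eq_zero_of_derivative_eq [IsDomain R] [CharZero R] {c : R} {M F : PowerSeries R}
    (h0 : coeff 0 F = 0) (hF : (1 - C c * X) * derivative R F = M * F) : F = 0 := by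
  have key : ∀ n, ∀ m ≤ n, coeff m F = 0 := by
    intro n
    induction n with
    | zero => intro m hm; rwa [Nat.le_zero.1 hm]
    | succ n ih =>
      intro m hm
      rcases Nat.le_succ_iff.1 hm with hm | rfl
      · exact ih m hm
      have h1 := congrArg (coeff n) hF
      have h2 : coeff n (M * F) = 0 := by
        rw [coeff_mul]
        refine Finset.sum_eq_zero fun ij hij => ?_
        rw [ih ij.2 (Finset.HasAntidiagonal.antidiagonal.snd_le hij), mul_zero]
      have h3 : coeff n (X * derivative R F) = 0 := by
        rcases n with - | n
        · simp
        · rw [coeff_succ_X_mul, coeff_derivative, ih (n + 1) le_rfl, zero_mul]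
      rw [h2, sub_mul, one_mul, mul_assoc, map_sub, coeff_C_mul, h3, mul_zero, sub_zero,
        coeff_derivative] at h1
      exact (mul_eq_zero.1 h1).resolve_right (by exact_mod_cast n.succ_ne_zero)
  ext n
  exact key n n le_rfl

theorem one_sub_mul_mk_pow (c : R) : (1 - C c * X) * mk (fun n => c ^ (n + 1)) = C c := by
  ext n
  rw [sub_mul, one_mul, mul_assoc, map_sub, coeff_C_mul]
  rcases n with - | n
  · simp
  · rw [coeff_succ_X_mul, coeff_mk, coeff_mk, coeff_C, if_neg n.succ_ne_zero]
    ring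

end ODE

/-- A homomorphism that adds the alphabet `(q - 1) x` multiplies `pExp[-wX]` by
`(1 - q w x) / (1 - w x)`. -/
theorem map_pExpNeg {k l : ℕ} (f : V k →ₐ[K] V l) (x : V l)
    (hf : ∀ n : ℕ+, f (p n) = p n + (q ^ (n : ℕ) - 1) • x ^ (n : ℕ)) :
    (1 - PowerSeries.C x * PowerSeries.X) * PowerSeries.map f.toRingHom (pExpNeg k) =
      (1 - PowerSeries.C (qV * x) * PowerSeries.X) * pExpNeg l := by
  set P := pSeries l
  set H := pExpNeg l
  set G := PowerSeries.map f.toRingHom (pExpNeg k) with hG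
  set R1 : PowerSeries (V l) := PowerSeries.mk fun n => x ^ (n + 1)
  set R2 : PowerSeries (V l) := PowerSeries.mk fun n => (qV * x) ^ (n + 1)
  have h1 : (1 - PowerSeries.C x * PowerSeries.X) * R1 = PowerSeries.C x := one_sub_mul_mk_pow x
  have h2 : (1 - PowerSeries.C (qV * x) * PowerSeries.X) * R2 = PowerSeries.C (qV * x) :=
    one_sub_mul_mk_pow _
  have hH : PowerSeries.derivative (V l) H = -P * H := (pExpNeg_spec l).2
  have hG' : PowerSeries.derivative (V l) G = -(P + R2 - R1) * G := by
    have e1 : PowerSeries.derivative (V l) G =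
        PowerSeries.map f.toRingHom (PowerSeries.derivative (V k) (pExpNeg k)) := by
      refine PowerSeries.ext fun n => ?_
      simp [hG, PowerSeries.coeff_derivative]
    have e2 : PowerSeries.map f.toRingHom (pSeries k) = P + R2 - R1 := by
      refine PowerSeries.ext fun n => ?_
      have := hf n.succPNat
      simp only [Nat.succPNat_coe, Nat.succ_eq_add_one] at this
      simp only [pSeries, PowerSeries.coeff_map, PowerSeries.coeff_mk, map_sub, map_add, P, R1, R2]
      refine this.trans ?_
      rw [MvPolynomial.smul_eq_C_mul, map_sub, map_pow, map_one]
      ring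
    rw [e1, (pExpNeg_spec k).2, map_mul, map_neg, e2]
  have hdX : ∀ c : V l, PowerSeries.derivative (V l) (1 - PowerSeries.C c * PowerSeries.X) =
      -PowerSeries.C c := by
    intro c
    simp [Derivation.leibniz]
  rw [← sub_eq_zero]
  refine eq_zero_of_derivative_eq (c := qV * x)
    (M := -(PowerSeries.C (qV * x) + P * (1 - PowerSeries.C (qV * x) * PowerSeries.X))) ?_ ?_
  · have hH0 : PowerSeries.constantCoeff H = 1 := by
      rw [← PowerSeries.coeff_zero_eq_constantCoeff_apply]; exact (pExpNeg_spec l).1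
    have hG0 : PowerSeries.constantCoeff G = 1 := by
      rw [← PowerSeries.coeff_zero_eq_constantCoeff_apply, hG, PowerSeries.coeff_map,
        (pExpNeg_spec k).1, map_one]
    simp [hH0, hG0]
  · rw [map_sub, Derivation.leibniz, Derivation.leibniz, hdX, hdX, hH, hG']
    simp only [smul_eq_mul]
    linear_combination
      -(1 - PowerSeries.C x * PowerSeries.X) * G * h2 +
      (1 - PowerSeries.C (qV * x) * PowerSeries.X) * G * h1

/-- The effect of adding the alphabet `(q - 1) x` on the coefficients of `pExp[-wX]`. -/
theorem map_pExpCoeff {k l : ℕ} (f : V k →ₐ[K] V l) (x : V l)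
    (hf : ∀ n : ℕ+, f (p n) = p n + (q ^ (n : ℕ) - 1) • x ^ (n : ℕ)) (n : ℕ) :
    f (pExpCoeff k (n + 1)) - x * f (pExpCoeff k n) =
      pExpCoeff l (n + 1) - qV * x * pExpCoeff l n := by
  have := congrArg (PowerSeries.coeff (n + 1)) (map_pExpNeg f x hf)
  rw [sub_mul, sub_mul, one_mul, one_mul, mul_assoc, mul_assoc, map_sub, map_sub,
    PowerSeries.coeff_C_mul, PowerSeries.coeff_C_mul, PowerSeries.coeff_succ_X_mul,
    PowerSeries.coeff_succ_X_mul, PowerSeries.coeff_map, PowerSeries.coeff_map] at this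
  exact this

/-- The expansion of `(1 - q w x) / (1 - w x) = 1 - (q - 1) ∑_{i ≥ 1} x ^ i w ^ i`. -/
theorem map_pExpCoeff_eq_sum {k l : ℕ} (f : V k →ₐ[K] V l) (x : V l)
    (hf : ∀ n : ℕ+, f (p n) = p n + (q ^ (n : ℕ) - 1) • x ^ (n : ℕ)) (n : ℕ) :
    f (pExpCoeff k n) =
      pExpCoeff l n - (qV - 1) * ∑ i ∈ Finset.range n, x ^ (i + 1) * pExpCoeff l (n - 1 - i) := by
  induction n with
  | zero => simp
  | succ n ih =>
    have h := map_pExpCoeff f x hf n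
    rw [ih] at h
    have e : ∑ i ∈ Finset.range (n + 1), x ^ (i + 1) * pExpCoeff l (n + 1 - 1 - i) =
        x * ∑ i ∈ Finset.range n, x ^ (i + 1) * pExpCoeff l (n - 1 - i) + x * pExpCoeff l n := by
      rw [Finset.sum_range_succ', Finset.mul_sum]
      congr 1
      · refine Finset.sum_congr rfl fun i _ => ?_
        rw [show n + 1 - 1 - (i + 1) = n - 1 - i by omega]
        ring
      · simp
    rw [e]
    linear_combination h

end

section

/-! ### The operators `d_-` and `d_+^*` on products -/

variable {k : ℕ}

@[simp] theorem addAlphabet_p (n : ℕ+) :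
    addAlphabet k (p n) = p n + (q ^ (n : ℕ) - 1) • y (Fin.last k) ^ (n : ℕ) := by
  simp [addAlphabet]

@[simp] theorem addAlphabet_y (i : Fin k) : addAlphabet k (y i) = y i.castSucc := by
  simp [addAlphabet]

theorem subAlphabet_addAlphabet (F : V k) : subAlphabet k (addAlphabet k F) = Polynomial.C F := by
  have : (subAlphabet k).comp (addAlphabet k) =
      (Polynomial.CAlgHom (R := V k) (A := V k)).restrictScalars K := by
    apply MvPolynomial.algHom_ext
    rintro (n | i)
    · change subAlphabet k (addAlphabet k (p n)) = Polynomial.C (p n)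
      simp only [addAlphabet_p, map_add, map_smul, map_pow, subAlphabet, substHom_p, substHom_y,
        Fin.lastCases_last]
      ring
    · change subAlphabet k (addAlphabet k (y i)) = Polynomial.C (y i)
      simp [subAlphabet]
  exact DFunLike.congr_fun this F

/-- The operator `d_-` is linear over `V_k` embedded by `F ↦ F[X + (q - 1) y_{k+1}]`. -/
@[simp] theorem opDMinus_addAlphabet_mul (F : V k) (G : V (k + 1)) :
    opDMinus k (addAlphabet k F * G) = F * opDMinus k G := by
  simp only [opDMinus, LinearMap.comp_apply, AlgHom.toLinearMap_apply, map_mul,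
    subAlphabet_addAlphabet, LinearMap.coe_restrictScalars]
  rw [← Polynomial.smul_eq_C_mul, map_smul, smul_eq_mul]

@[simp] theorem opDMinus_y_last_pow (n : ℕ) :
    opDMinus k (y (Fin.last k) ^ n) = pExpCoeff k n := by
  simp only [opDMinus, LinearMap.comp_apply, AlgHom.toLinearMap_apply, map_pow, subAlphabet,
    substHom_y, Fin.lastCases_last, LinearMap.coe_restrictScalars, constTerm]
  rw [Polynomial.X_pow_eq_monomial, Polynomial.lsum_apply, Polynomial.sum_monomial_index]
  · simp [pExpCoeff]
  · simp

@[simp] theorem opDMinus_y_castSucc_mul (i : Fin k) (G : V (k + 1)) :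
    opDMinus k (y i.castSucc * G) = y i * opDMinus k G := by
  rw [← addAlphabet_y, opDMinus_addAlphabet_mul]

/-- `V_{k+1}` is spanned by the products `F[X + (q - 1) y_{k+1}] y_{k+1}^n` with `F` in `V_k`. -/
theorem span_addAlphabet_mul : Submodule.span K
    {G : V (k + 1) | ∃ (F : V k) (n : ℕ), addAlphabet k F * y (Fin.last k) ^ n = G} = ⊤ := by
  set S := Submodule.span K
    {G : V (k + 1) | ∃ (F : V k) (n : ℕ), addAlphabet k F * y (Fin.last k) ^ n = G} with hS
  have mem : ∀ (F : V k) (n : ℕ), addAlphabet k F * y (Fin.last k) ^ n ∈ S :=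
    fun F n => Submodule.subset_span ⟨F, n, rfl⟩
  have hmul : ∀ i G, G ∈ S → G * MvPolynomial.X i ∈ S := by
    intro i G hG
    induction hG using Submodule.span_induction with
    | zero => rw [zero_mul]; exact S.zero_mem
    | add G H _ _ hG hH => rw [add_mul]; exact S.add_mem hG hH
    | smul c G _ hG => rw [smul_mul_assoc]; exact S.smul_mem c hG
    | mem G hG =>
      obtain ⟨F, n, rfl⟩ := hG
      rcases i with m | i
      · have : (MvPolynomial.X (Sum.inl m) : V (k + 1)) =
            addAlphabet k (p m) - (q ^ (m : ℕ) - 1) • y (Fin.last k) ^ (m : ℕ) := by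
          rw [addAlphabet_p, add_sub_cancel_right]; rfl
        rw [this, mul_sub, mul_smul_comm, mul_assoc, mul_assoc, ← pow_add, mul_comm (_ ^ n),
          ← mul_assoc, ← map_mul]
        exact S.sub_mem (mem _ _) (S.smul_mem _ (mem _ _))
      · induction i using Fin.lastCases with
        | last =>
          have := mem F (n + 1)
          rwa [pow_succ, ← mul_assoc] at this
        | cast i =>
          have := mem (F * y i) n
          rwa [map_mul, addAlphabet_y, mul_right_comm] at this
  rw [eq_top_iff]
  rintro G -
  induction G using MvPolynomial.induction_on with
  | C c =>
    have := S.smul_mem c (mem 1 0)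
    rwa [map_one, one_mul, pow_zero, ← MvPolynomial.C_eq_smul_one] at this
  | add G H hG hH => exact S.add_mem hG hH
  | mul_X G i hG => exact hmul i G hG

theorem induction_addAlphabet {P : V (k + 1) → Prop} (hadd : ∀ G H, P G → P H → P (G + H))
    (hsmul : ∀ (c : K) G, P G → P (c • G))
    (h : ∀ (F : V k) (n : ℕ), P (addAlphabet k F * y (Fin.last k) ^ n)) (G : V (k + 1)) : P G := by
  have hG : G ∈ Submodule.span K {G : V (k + 1) |
      ∃ (F : V k) (n : ℕ), addAlphabet k F * y (Fin.last k) ^ n = G} := by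
    rw [span_addAlphabet_mul]; exact Submodule.mem_top
  induction hG using Submodule.span_induction with
  | zero => simpa using hsmul 0 _ (h 0 0)
  | add G H _ _ hG hH => exact hadd _ _ hG hH
  | smul c G _ hG => exact hsmul _ _ hG
  | mem G hG =>
    obtain ⟨F, n, rfl⟩ := hG
    exact h F n

/-- The variable `y_{k+1}` of `V_{k+2}`. -/
abbrev yL (k : ℕ) : V (k + 2) := y (Fin.last k).castSucc

/-- The variable `y_{k+2}` of `V_{k+2}`. -/
abbrev yR (k : ℕ) : V (k + 2) := y (Fin.last (k + 1))

/-- The embedding `F ↦ F[X + (q - 1) (y_{k+1} + y_{k+2})]` of `V_k` in `V_{k+2}`. -/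
abbrev addAlphabet₂ (k : ℕ) : V k →ₐ[K] V (k + 2) := (addAlphabet (k + 1)).comp (addAlphabet k)

theorem induction_addAlphabet₂ {P : V (k + 2) → Prop} (hadd : ∀ G H, P G → P H → P (G + H))
    (hsmul : ∀ (c : K) G, P G → P (c • G))
    (h : ∀ (F : V k) (m n : ℕ), P (addAlphabet₂ k F * (yL k ^ m * yR k ^ n))) (G : V (k + 2)) :
    P G := by
  refine induction_addAlphabet hadd hsmul (fun F n => ?_) G
  induction F using induction_addAlphabet with
  | hadd F G hF hG => rw [map_add, add_mul]; exact hadd _ _ hF hG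
  | hsmul c F hF => rw [map_smul, smul_mul_assoc]; exact hsmul _ _ hF
  | h F m => simpa [mul_assoc] using h F m n

/-- `d_+^*` as a homomorphism of algebras. -/
def dStar (k : ℕ) : V k →ₐ[K] V (k + 1) := (gam k).comp (addAlphabet k)

theorem opDPlusStar_eq (F : V k) : opDPlusStar k F = dStar k F := rfl

theorem dStar_p (n : ℕ+) :
    dStar k (p n) = p n + (q ^ (n : ℕ) - 1) • (t • y 0) ^ (n : ℕ) := by
  simp [dStar, gam]

@[simp] theorem dStar_y (i : Fin k) : dStar k (y i) = y i.succ := by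
  simp [dStar, gam]

theorem dStar_addAlphabet (F : V k) :
    dStar (k + 1) (addAlphabet k F) = addAlphabet (k + 1) (dStar k F) := by
  have : (dStar (k + 1)).comp (addAlphabet k) = (addAlphabet (k + 1)).comp (dStar k) := by
    apply algHom_ext_V
    · intro n
      simp only [AlgHom.comp_apply, addAlphabet_p, map_add, dStar_p, map_smul, map_pow, dStar_y,
        addAlphabet_y, Fin.succ_last, Fin.castSucc_zero]
      ring
    · intro i
      simp
  exact DFunLike.congr_fun this F

theorem dStar_dStar_p (n : ℕ+) : dStar (k + 1) (dStar k (p n)) = p n +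
    (q ^ (n : ℕ) - 1) • ((t • y 0) ^ (n : ℕ) + (t • y 1) ^ (n : ℕ)) := by
  simp only [dStar_p, map_add, map_smul, map_pow, dStar_y, smul_add, Fin.succ_zero_eq_one]
  ring

theorem addAlphabet_pExpCoeff (n : ℕ) :
    addAlphabet k (pExpCoeff k (n + 1)) - y (Fin.last k) * addAlphabet k (pExpCoeff k n) =
      pExpCoeff (k + 1) (n + 1) - qV * y (Fin.last k) * pExpCoeff (k + 1) n :=
  map_pExpCoeff _ _ addAlphabet_p n

theorem dStar_pExpCoeff (n : ℕ) :
    dStar k (pExpCoeff k (n + 1)) - t • y 0 * dStar k (pExpCoeff k n) =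
      pExpCoeff (k + 1) (n + 1) - qV * (t • y 0) * pExpCoeff (k + 1) n :=
  map_pExpCoeff _ _ dStar_p n

/-! ### The operators `T_i` -/

theorem opT_eq {i : ℕ} (h1 : 1 ≤ i) (h2 : i < k) (h : (⟨i - 1, by omega⟩ : Fin k) ≠ ⟨i, h2⟩) :
    opT k i = hecke ⟨i - 1, by omega⟩ ⟨i, h2⟩ h := by
  rw [opT, dif_pos ⟨h1, h2⟩]

theorem opT_succ {i : ℕ} (h2 : i + 1 < k) (h : (⟨i, by omega⟩ : Fin k) ≠ ⟨i + 1, h2⟩) :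
    opT k (i + 1) = hecke ⟨i, by omega⟩ ⟨i + 1, h2⟩ h := by
  rw [opT, dif_pos ⟨by omega, h2⟩]
  rfl

theorem fin_ne_succ {i : ℕ} (h2 : i + 1 < k) : (⟨i, by omega⟩ : Fin k) ≠ ⟨i + 1, h2⟩ := by
  intro e; have := congrArg Fin.val e; simp at this

theorem yL_ne_yR : (Fin.last k).castSucc ≠ Fin.last (k + 1) := (Fin.castSucc_lt_last _).ne

theorem opT_last : opT (k + 2) (k + 1) = hecke (Fin.last k).castSucc (Fin.last (k + 1)) yL_ne_yR :=
  opT_succ (by omega) _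

theorem opT_one : opT (k + 2) 1 = hecke 0 1 (by simp) :=
  opT_succ (by omega) _

/-- `F[X + (q - 1) (y_{k+1} + y_{k+2})]` is symmetric in the last two variables. -/
theorem swapY_addAlphabet₂ (F : V k) :
    swapY (Fin.last k).castSucc (Fin.last (k + 1)) (addAlphabet₂ k F) = addAlphabet₂ k F := by
  have : (swapY (Fin.last k).castSucc (Fin.last (k + 1))).comp (addAlphabet₂ k) =
      addAlphabet₂ k := by
    apply algHom_ext_V
    · intro n
      simp
      ring
    · intro i
      simp only [AlgHom.comp_apply, addAlphabet_y, swapY_y]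
      rw [Equiv.swap_apply_of_ne_of_ne]
      · exact fun h => (Fin.castSucc_lt_last i).ne (Fin.castSucc_injective _ h)
      · exact (Fin.castSucc_lt_last _).ne
  exact DFunLike.congr_fun this F

theorem opT_last_addAlphabet₂_mul (F : V k) (G : V (k + 2)) :
    opT (k + 2) (k + 1) (addAlphabet₂ k F * G) = addAlphabet₂ k F * opT (k + 2) (k + 1) G := by
  rw [opT_last, hecke_mul _ (swapY_addAlphabet₂ F)]

end

section

/-! ### Braid words -/

/-- The elements `t 1, …, t (k - 1)` satisfy the braid relations. -/
structure IsBraid {G : Type*} [Monoid G] (k : ℕ) (t : ℕ → G) : Prop where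
  braid : ∀ i, 1 ≤ i → i + 1 < k → t i * t (i + 1) * t i = t (i + 1) * t i * t (i + 1)
  far : ∀ i j, 1 ≤ i → i + 1 < j → j < k → t i * t j = t j * t i

/-- The word `t 1 * t 2 * ⋯ * t j`. -/
def up {G : Type*} [Monoid G] (t : ℕ → G) : ℕ → G
  | 0 => 1
  | j + 1 => up t j * t (j + 1)

/-- The word `t j * ⋯ * t 2 * t 1`. -/
def down {G : Type*} [Monoid G] (t : ℕ → G) : ℕ → G
  | 0 => 1
  | j + 1 => t (j + 1) * down t j

theorem up_succ {G : Type*} [Monoid G] (t : ℕ → G) (j : ℕ) : up t (j + 1) = up t j * t (j + 1) :=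
  rfl

namespace IsBraid

theorem inv {G : Type*} [Group G] {k : ℕ} {t : ℕ → G} (h : IsBraid k t) :
    IsBraid k fun i => (t i)⁻¹ where
  braid i h1 h2 := by
    have := congrArg (·⁻¹) (h.braid i h1 h2)
    simpa only [mul_inv_rev, mul_assoc] using this
  far i j h1 h2 h3 := by
    have := congrArg (·⁻¹) (h.far i j h1 h2 h3)
    simpa only [mul_inv_rev] using this.symm

variable {G : Type*} [Monoid G] {k : ℕ} {t : ℕ → G} (h : IsBraid k t)
include h

theorem commute_far {i j : ℕ} (hi : 1 ≤ i) (hi' : i < k) (hj : 1 ≤ j) (hj' : j < k)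
    (hij : i + 1 < j ∨ j + 1 < i) : t i * t j = t j * t i := by
  rcases hij with hij | hij
  · exact h.far i j hi hij hj'
  · exact (h.far j i hj hij hi').symm

theorem up_mul_far {j i : ℕ} (hij : j + 1 < i) (hi : i < k) : up t j * t i = t i * up t j := by
  induction j with
  | zero => simp [up]
  | succ j ih =>
    rw [up, mul_assoc, h.far (j + 1) i (by omega) (by omega) hi, ← mul_assoc, ih (by omega),
      mul_assoc]

/-- Conjugation by `t 1 ⋯ t j` shifts the generators. -/
theorem up_mul {j i : ℕ} (hi : 1 ≤ i) (hij : i < j) (hj : j < k) :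
    up t j * t i = t (i + 1) * up t j := by
  induction j with
  | zero => omega
  | succ j ih =>
    rcases Nat.lt_succ_iff_lt_or_eq.1 hij with hlt | rfl
    · rw [up, mul_assoc, ← h.far i (j + 1) hi (by omega) hj, ← mul_assoc, ih hlt (by omega),
        mul_assoc]
    · obtain ⟨i, rfl⟩ : ∃ i', i = i' + 1 := ⟨i - 1, by omega⟩
      have := h.braid (i + 1) (by omega) hj
      rw [up, up, mul_assoc, mul_assoc, ← mul_assoc (t (i + 1)), this, ← mul_assoc, ← mul_assoc,
        h.up_mul_far (by omega) hj]
      simp only [mul_assoc]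

theorem up_mul_up {j i : ℕ} (hij : i ≤ j) (hj : j + 1 < k) :
    up t (j + 1) * up t i = up (fun n => t (n + 1)) i * up t (j + 1) := by
  induction i with
  | zero => simp [up]
  | succ i ih =>
    rw [up_succ t i, ← mul_assoc, ih (by omega), mul_assoc, h.up_mul (by omega) (by omega) hj,
      ← mul_assoc]
    rfl

omit h in
theorem up_succ' (j : ℕ) : up t (j + 1) = t 1 * up (fun n => t (n + 1)) j := by
  induction j with
  | zero => simp [up]
  | succ j ih => rw [up, ih, mul_assoc]; rfl

theorem mul_up_mul_up {j : ℕ} (hj : j + 1 < k) :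
    t 1 * (up t (j + 1) * up t j) = up t (j + 1) * up t j * t (j + 1) := by
  rw [h.up_mul_up le_rfl hj, ← mul_assoc, ← up_succ', ← h.up_mul_up le_rfl hj, mul_assoc]
  rfl

end IsBraid

end

section

variable {k : ℕ}

/-! ### The relations between `T_i`, `d_-` and `d_+` -/

theorem opT_opT {i : ℕ} (h1 : 1 ≤ i) (h2 : i < k) (F : V k) :
    opT k i (opT k i F) = (1 - qV) * opT k i F + qV * F := by
  obtain ⟨i, rfl⟩ : ∃ i', i = i' + 1 := ⟨i - 1, by omega⟩
  rw [opT_succ h2 (fin_ne_succ h2), hecke_hecke]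

theorem opT_braid {i : ℕ} (h : i + 2 < k) (F : V k) :
    opT k (i + 1) (opT k (i + 2) (opT k (i + 1) F)) =
      opT k (i + 2) (opT k (i + 1) (opT k (i + 2) F)) := by
  rw [opT_succ (i := i) (by omega) (fin_ne_succ _), opT_succ (i := i + 1) h (fin_ne_succ h)]
  refine hecke_braid _ _ ?_ F
  intro e; have := congrArg Fin.val e; simp only at this; omega

theorem opT_far {i j : ℕ} (hij : i + 1 < j) (h : j + 1 < k) (F : V k) :
    opT k (i + 1) (opT k (j + 1) F) = opT k (j + 1) (opT k (i + 1) F) := by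
  rw [opT_succ (i := i) (by omega) (fin_ne_succ _), opT_succ (i := j) h (fin_ne_succ h)]
  refine hecke_comm _ _ ?_ ?_ ?_ ?_ F <;>
  · intro e; have := congrArg Fin.val e; simp only at this; omega

theorem opT_isBraid (k : ℕ) : IsBraid (G := Module.End K (V k)) k (opT k) where
  braid i h1 h2 := by
    obtain ⟨i, rfl⟩ : ∃ i', i = i' + 1 := ⟨i - 1, by omega⟩
    exact LinearMap.ext fun F => opT_braid h2 F
  far i j h1 h2 h3 := by
    obtain ⟨i, rfl⟩ : ∃ i', i = i' + 1 := ⟨i - 1, by omega⟩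
    obtain ⟨j, rfl⟩ : ∃ j', j = j' + 1 := ⟨j - 1, by omega⟩
    exact LinearMap.ext fun F => opT_far (by omega) h3 F

/-- Multiplication by `y_{i+1}` commutes with `T_j` for `i + 1 ≠ j, j + 1`. -/
theorem opT_y_mul {i j : ℕ} (hi : i < k) (hj : j + 1 < k) (h1 : i ≠ j) (h2 : i ≠ j + 1) (F : V k) :
    opT k (j + 1) (y ⟨i, hi⟩ * F) = y ⟨i, hi⟩ * opT k (j + 1) F := by
  rw [opT_succ hj (fin_ne_succ hj), hecke_mul]
  rw [swapY_y, Equiv.swap_apply_of_ne_of_ne]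
  · intro e; exact h1 (congrArg Fin.val e)
  · intro e; exact h2 (congrArg Fin.val e)

theorem opT_y_right_mul {i : ℕ} (hi : i + 1 < k) (F : V k) :
    opT k (i + 1) (y ⟨i + 1, hi⟩ * F) =
      y ⟨i, by omega⟩ * (opT k (i + 1) F + (qV - 1) * F) := by
  rw [opT_succ hi (fin_ne_succ hi), hecke_y_right_mul]
  ring

theorem opT_y_left_mul {i : ℕ} (hi : i + 1 < k) (F : V k) :
    opT k (i + 1) (y ⟨i, by omega⟩ * F) =
      y ⟨i + 1, hi⟩ * opT k (i + 1) F - (qV - 1) * y ⟨i, by omega⟩ * F := by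
  rw [opT_succ hi (fin_ne_succ hi), hecke_y_left_mul]

theorem y_last_eq : (y (Fin.last k) : V (k + 1)) = y ⟨k, by omega⟩ := rfl

theorem swap_castSucc {n : ℕ} (a b i : Fin n) :
    Equiv.swap a.castSucc b.castSucc i.castSucc = (Equiv.swap a b i).castSucc := by
  rw [Equiv.swap_apply_def, Equiv.swap_apply_def]
  simp only [Fin.castSucc_inj]
  split_ifs <;> rfl

theorem swap_succ {n : ℕ} (a b i : Fin n) :
    Equiv.swap a.succ b.succ i.succ = (Equiv.swap a b i).succ := by
  rw [Equiv.swap_apply_def, Equiv.swap_apply_def]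
  simp only [Fin.succ_inj]
  split_ifs <;> rfl

theorem swap_castSucc_last {n : ℕ} (a b : Fin n) :
    Equiv.swap a.castSucc b.castSucc (Fin.last n) = Fin.last n :=
  Equiv.swap_apply_of_ne_of_ne (Fin.castSucc_lt_last a).ne' (Fin.castSucc_lt_last b).ne'

theorem swap_succ_zero {n : ℕ} (a b : Fin n) :
    Equiv.swap a.succ b.succ 0 = 0 :=
  Equiv.swap_apply_of_ne_of_ne (Fin.succ_ne_zero a).symm (Fin.succ_ne_zero b).symm

theorem opT_addAlphabet {i : ℕ} (h1 : 1 ≤ i) (h2 : i < k) (F : V k) :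
    addAlphabet k (opT k i F) = opT (k + 1) i (addAlphabet k F) := by
  obtain ⟨i, rfl⟩ : ∃ i', i = i' + 1 := ⟨i - 1, by omega⟩
  rw [opT_succ h2 (fin_ne_succ h2), opT_succ (i := i) (k := k + 1) (by omega) (fin_ne_succ _)]
  refine algHom_hecke _ (addAlphabet k) _ ?_ ?_ (addAlphabet_y _) (addAlphabet_y _) F
  · intro n
    simp only [addAlphabet_p, map_add, swapY_p, map_smul, map_pow, swapY_y]
    exact congrArg (fun j => p n + (q ^ (n : ℕ) - 1) • y j ^ (n : ℕ)) (swap_castSucc_last _ _)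
  · intro j
    rw [addAlphabet_y, addAlphabet_y, swapY_y]
    exact congrArg y (swap_castSucc _ _ j)

theorem opT_dStar {i : ℕ} (h1 : 1 ≤ i) (h2 : i < k) (F : V k) :
    dStar k (opT k i F) = opT (k + 1) (i + 1) (dStar k F) := by
  obtain ⟨i, rfl⟩ : ∃ i', i = i' + 1 := ⟨i - 1, by omega⟩
  rw [opT_succ h2 (fin_ne_succ h2), opT_succ (i := i + 1) (k := k + 1) (by omega) (fin_ne_succ _)]
  refine algHom_hecke _ (dStar k) _ ?_ ?_ (dStar_y _) (dStar_y _) F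
  · intro n
    simp only [dStar_p, map_add, swapY_p, map_smul, map_pow, swapY_y]
    exact congrArg (fun j => p n + (q ^ (n : ℕ) - 1) • (t • y j) ^ (n : ℕ)) (swap_succ_zero _ _)
  · intro j
    rw [dStar_y, dStar_y, swapY_y]
    exact congrArg y (swap_succ _ _ j)

theorem swapY_pExpCoeff (a b : Fin k) (n : ℕ) : swapY a b (pExpCoeff k n) = pExpCoeff k n := by
  have := map_pExpCoeff_eq_sum (swapY a b) 0 (by simp) n
  simpa using this

theorem swapY_opDMinus (a b : Fin k) (F : V (k + 1)) :
    opDMinus k (swapY a.castSucc b.castSucc F) = swapY a b (opDMinus k F) := by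
  have h : (swapY a.castSucc b.castSucc).comp (addAlphabet k) =
      (addAlphabet k).comp (swapY a b) := by
    apply algHom_ext_V
    · intro n
      simp [swap_castSucc_last]
    · intro i
      simp [swap_castSucc]
  have h' := DFunLike.congr_fun h
  simp only [AlgHom.comp_apply] at h'
  induction F using induction_addAlphabet with
  | hadd F G hF hG => simp only [map_add, hF, hG]
  | hsmul c F hF => simp only [map_smul, hF]
  | h F n => simp [h', swap_castSucc_last, swapY_pExpCoeff]

theorem opT_opDMinus {i : ℕ} (h1 : 1 ≤ i) (h2 : i < k) (F : V (k + 1)) :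
    opDMinus k (opT (k + 1) i F) = opT k i (opDMinus k F) := by
  obtain ⟨i, rfl⟩ : ∃ i', i = i' + 1 := ⟨i - 1, by omega⟩
  rw [opT_succ h2 (fin_ne_succ h2), opT_succ (i := i) (k := k + 1) (by omega) (fin_ne_succ _)]
  exact map_hecke (M := opDMinus k) (a := Fin.castSucc ⟨i, by omega⟩)
    (b := Fin.castSucc ⟨i + 1, h2⟩) _ _ (fun F => opDMinus_y_castSucc_mul _ F)
    (fun F => opDMinus_y_castSucc_mul _ F) (fun F => swapY_opDMinus _ _ F) F

theorem opDMinus_opDMinus_addAlphabet₂_mul (F : V k) (G : V (k + 2)) :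
    opDMinus k (opDMinus (k + 1) (addAlphabet₂ k F * G)) =
      F * opDMinus k (opDMinus (k + 1) G) := by
  rw [AlgHom.comp_apply, opDMinus_addAlphabet_mul, opDMinus_addAlphabet_mul]

theorem opDMinus_yL_pow_mul_yR_pow (m n : ℕ) :
    opDMinus (k + 1) (yL k ^ m * yR k ^ n) = y (Fin.last k) ^ m * pExpCoeff (k + 1) n := by
  have : yL k ^ m = addAlphabet (k + 1) (y (Fin.last k) ^ m) := by simp
  rw [this, opDMinus_addAlphabet_mul, opDMinus_y_last_pow]

theorem opDMinus_opDMinus_yR_sub (m n : ℕ) :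
    opDMinus k (opDMinus (k + 1) (yL k ^ m * yR k ^ (n + 1))) -
      q • opDMinus k (opDMinus (k + 1) (yL k ^ (m + 1) * yR k ^ n)) =
    pExpCoeff k m * pExpCoeff k (n + 1) - pExpCoeff k (m + 1) * pExpCoeff k n := by
  simp only [opDMinus_yL_pow_mul_yR_pow]
  rw [← map_smul, ← map_sub]
  have : y (Fin.last k) ^ m * pExpCoeff (k + 1) (n + 1) -
      q • (y (Fin.last k) ^ (m + 1) * pExpCoeff (k + 1) n) =
      addAlphabet k (pExpCoeff k (n + 1)) * y (Fin.last k) ^ m -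
      addAlphabet k (pExpCoeff k n) * y (Fin.last k) ^ (m + 1) := by
    rw [smul_q]
    linear_combination -y (Fin.last k) ^ m * addAlphabet_pExpCoeff (k := k) n
  rw [this, map_sub, opDMinus_addAlphabet_mul, opDMinus_addAlphabet_mul, opDMinus_y_last_pow,
    opDMinus_y_last_pow]
  ring

theorem opDMinus_opDMinus_yR_sub_mul (F : V k) (m n : ℕ) :
    opDMinus k (opDMinus (k + 1)
      ((yR k - qV * yL k) * (addAlphabet₂ k F * (yL k ^ m * yR k ^ n)))) =
      F * (pExpCoeff k m * pExpCoeff k (n + 1) - pExpCoeff k (m + 1) * pExpCoeff k n) := by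
  have e : (yR k - qV * yL k) * (addAlphabet₂ k F * (yL k ^ m * yR k ^ n)) =
      addAlphabet₂ k F * (yL k ^ m * yR k ^ (n + 1) - q • (yL k ^ (m + 1) * yR k ^ n)) := by
    rw [smul_q]
    ring
  rw [e, opDMinus_opDMinus_addAlphabet₂_mul, ← opDMinus_opDMinus_yR_sub, map_sub, map_sub,
    map_smul, map_smul]

/-- The factor `y_{k+2} - q y_{k+1}` makes the constant term of two vertex operators
antisymmetric. -/
theorem opDMinus_opDMinus_swapY (G : V (k + 2)) :
    opDMinus k (opDMinus (k + 1) ((yR k - qV * yL k) *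
      swapY (Fin.last k).castSucc (Fin.last (k + 1)) G)) =
      -opDMinus k (opDMinus (k + 1) ((yR k - qV * yL k) * G)) := by
  induction G using induction_addAlphabet₂ with
  | hadd F G hF hG => simp only [map_add, mul_add, hF, hG, neg_add]
  | hsmul c F hF => simp only [map_smul, mul_smul_comm, hF, smul_neg]
  | h F m n =>
    rw [opDMinus_opDMinus_yR_sub_mul, map_mul (swapY _ _), swapY_addAlphabet₂,
      map_mul (swapY _ _), map_pow, map_pow,
      swapY_y, swapY_y, Equiv.swap_apply_left, Equiv.swap_apply_right, mul_comm (_ ^ m),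
      opDMinus_opDMinus_yR_sub_mul]
    ring

/-- The difference `F - T F` is `y_{k+2} - q y_{k+1}` times a symmetric polynomial. -/
theorem opDMinus_opDMinus_opT (F : V (k + 2)) :
    opDMinus k (opDMinus (k + 1) (opT (k + 2) (k + 1) F)) = opDMinus k (opDMinus (k + 1) F) := by
  obtain ⟨G, hG⟩ := dvd_sub_swapY (Fin.last k).castSucc (Fin.last (k + 1)) F
  have hT : opT (k + 2) (k + 1) F = F - (yR k - qV * yL k) * G := by
    rw [opT_last]
    apply hecke_unique
    linear_combination (yR k - qV * yL k) * hG
  have hs : swapY (Fin.last k).castSucc (Fin.last (k + 1)) G = G := by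
    apply mul_left_cancel₀ (y_sub_y_ne_zero (yL_ne_yR (k := k)))
    have := congrArg (swapY (Fin.last k).castSucc (Fin.last (k + 1))) hG
    simp only [map_mul, map_sub, swapY_swapY, swapY_y, Equiv.swap_apply_left,
      Equiv.swap_apply_right] at this
    linear_combination this + hG
  have h0 := opDMinus_opDMinus_swapY G
  rw [hs, eq_neg_iff_add_eq_zero, ← two_mul, mul_eq_zero, or_iff_right two_ne_zero] at h0
  rw [hT, map_sub, map_sub, h0, sub_zero]

end

section

variable {k : ℕ}

/-- The rule `mul_neg` for the instances found on `V k`. -/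
theorem mul_neg_V (F G : V k) : F * -G = -(F * G) := by ring

theorem opTUp_succ (k j : ℕ) (F : V k) : opTUp k (j + 1) F = opTUp k j (opT k (j + 1) F) := rfl

theorem opTUp_eq_up (k j : ℕ) : opTUp k j = up (G := Module.End K (V k)) (opT k) j := by
  induction j with
  | zero => rfl
  | succ j ih => rw [opTUp, ih]; rfl

theorem opTUp_opT {i j : ℕ} (hi : 1 ≤ i) (hij : i < j) (hj : j < k) (F : V k) :
    opTUp k j (opT k i F) = opT k (i + 1) (opTUp k j F) := by
  rw [opTUp_eq_up]
  exact DFunLike.congr_fun ((opT_isBraid k).up_mul hi hij hj) F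

theorem opT_opTUp_opTUp {j : ℕ} (hj : j + 1 < k) (F : V k) :
    opT k 1 (opTUp k (j + 1) (opTUp k j F)) = opTUp k (j + 1) (opTUp k j (opT k (j + 1) F)) := by
  rw [opTUp_eq_up, opTUp_eq_up]
  exact DFunLike.congr_fun ((opT_isBraid k).mul_up_mul_up hj) F

theorem addAlphabet_opTUp {j : ℕ} (hj : j < k) (F : V k) :
    addAlphabet k (opTUp k j F) = opTUp (k + 1) j (addAlphabet k F) := by
  induction j generalizing F with
  | zero => rfl
  | succ j ih => rw [opTUp_succ, ih (by omega), opT_addAlphabet (by omega) hj]; rfl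

theorem opDMinus_opTUp {j : ℕ} (hj : j < k) (F : V (k + 1)) :
    opDMinus k (opTUp (k + 1) j F) = opTUp k j (opDMinus k F) := by
  induction j generalizing F with
  | zero => rfl
  | succ j ih => rw [opTUp_succ, ih (by omega), opT_opDMinus (by omega) hj]; rfl

theorem opT_y_last_mul {i : ℕ} (h1 : 1 ≤ i) (h2 : i < k) (F : V (k + 1)) :
    opT (k + 1) i (y (Fin.last k) * F) = y (Fin.last k) * opT (k + 1) i F := by
  obtain ⟨i, rfl⟩ : ∃ i', i = i' + 1 := ⟨i - 1, by omega⟩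
  exact opT_y_mul (by omega) (by omega) (by omega) (by omega) F

theorem opTUp_y_last_mul {j : ℕ} (hj : j < k) (F : V (k + 1)) :
    opTUp (k + 1) j (y (Fin.last k) * F) = y (Fin.last k) * opTUp (k + 1) j F := by
  induction j generalizing F with
  | zero => rfl
  | succ j ih => rw [opTUp_succ, opT_y_last_mul (by omega) hj, ih (by omega)]; rfl

theorem opDPlus_apply (F : V k) :
    opDPlus k F = -opTUp (k + 1) k (y (Fin.last k) * addAlphabet k F) := rfl

theorem opT_y_right_mul_opT {i : ℕ} (hi : i + 1 < k) (F : V k) :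
    opT k (i + 1) (y ⟨i + 1, hi⟩ * opT k (i + 1) F) = q • (y ⟨i, by omega⟩ * F) := by
  rw [opT_y_right_mul, opT_opT (by omega) hi, smul_q]
  ring

theorem opT_yR_mul (F : V (k + 2)) :
    opT (k + 2) (k + 1) (yR k * F) = yL k * (opT (k + 2) (k + 1) F + (qV - 1) * F) :=
  opT_y_right_mul (by omega) F

theorem opT_yR_mul_opT (F : V (k + 2)) :
    opT (k + 2) (k + 1) (yR k * opT (k + 2) (k + 1) F) = q • (yL k * F) :=
  opT_y_right_mul_opT (by omega) F

theorem opT_yL_pow (n : ℕ) : opT (k + 2) (k + 1) (yL k ^ n) =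
    yR k ^ n - (qV - 1) * ∑ j ∈ Finset.range n, yL k ^ (j + 1) * yR k ^ (n - 1 - j) := by
  induction n with
  | zero =>
    rw [opT_last, pow_zero, hecke_of_swapY_eq _ (map_one _)]
    simp
  | succ n ih =>
    have h : opT (k + 2) (k + 1) (yL k * yL k ^ n) =
        yR k * opT (k + 2) (k + 1) (yL k ^ n) - (qV - 1) * yL k * yL k ^ n :=
      opT_y_left_mul (by omega) _
    have e : ∑ j ∈ Finset.range (n + 1), yL k ^ (j + 1) * yR k ^ (n + 1 - 1 - j) =
        yR k * ∑ j ∈ Finset.range n, yL k ^ (j + 1) * yR k ^ (n - 1 - j) + yL k ^ (n + 1) := by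
      rw [Finset.sum_range_succ, Finset.mul_sum]
      congr 1
      · refine Finset.sum_congr rfl fun j hj => ?_
        have : n + 1 - 1 - j = (n - 1 - j) + 1 := by have := Finset.mem_range.1 hj; omega
        rw [this]
        ring
      · simp
    rw [pow_succ' (yL k), h, ih, e]
    ring

theorem opT_yR_mul_yL_pow (n : ℕ) : opT (k + 2) (k + 1) (yR k * yL k ^ n) =
    yL k * (yR k ^ n - (qV - 1) * ∑ j ∈ Finset.range n, yL k ^ (j + 1) * yR k ^ (n - 1 - j) +
      (qV - 1) * yL k ^ n) := by
  rw [opT_yR_mul, opT_yL_pow]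

theorem opT_yR_mul_addAlphabet (F : V k) (n : ℕ) :
    opT (k + 2) (k + 1)
      (yR k * addAlphabet (k + 1) (addAlphabet k F * y (Fin.last k) ^ n)) =
    addAlphabet₂ k F * opT (k + 2) (k + 1) (yR k * yL k ^ n) := by
  rw [map_mul (addAlphabet (k + 1)), map_pow, addAlphabet_y, mul_left_comm]
  exact opT_last_addAlphabet₂_mul F _

theorem opDMinus_yL_mul (F : V (k + 2)) :
    opDMinus (k + 1) (yL k * F) = y (Fin.last k) * opDMinus (k + 1) F :=
  opDMinus_y_castSucc_mul _ _

theorem opDMinus_opT_yR_mul_yL_pow (n : ℕ) :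
    opDMinus (k + 1) (opT (k + 2) (k + 1) (yR k * yL k ^ n)) =
      y (Fin.last k) * (addAlphabet k (pExpCoeff k n) + (qV - 1) * y (Fin.last k) ^ n) := by
  have h1 := opDMinus_yL_pow_mul_yR_pow (k := k)
  have h2 : opDMinus (k + 1) (yL k ^ n) = y (Fin.last k) ^ n := by
    rw [← mul_one (yL k ^ n), ← pow_zero (yR k), h1, pExpCoeff_zero, mul_one]
  have h3 : opDMinus (k + 1) (yR k ^ n) = pExpCoeff (k + 1) n := by
    rw [← one_mul (yR k ^ n), ← pow_zero (yL k), h1, pow_zero, one_mul]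
  rw [opT_yR_mul_yL_pow, opDMinus_yL_mul, map_add, map_sub, ← smul_q_sub_one, ← smul_q_sub_one,
    map_smul, map_smul, map_sum, h2, h3, smul_q_sub_one, smul_q_sub_one,
    map_pExpCoeff_eq_sum (addAlphabet k) _ addAlphabet_p]
  simp only [h1]

theorem opDMinus_opT_yR_mul (F : V (k + 1)) :
    opDMinus (k + 1) (opT (k + 2) (k + 1) (yR k * addAlphabet (k + 1) F)) =
      y (Fin.last k) * addAlphabet k (opDMinus k F) + (q - 1) • (y (Fin.last k) * F) := by
  induction F using induction_addAlphabet with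
  | hadd F G hF hG => simp only [map_add, mul_add, hF, hG, smul_add]; abel
  | hsmul c F hF =>
    simp only [map_smul, mul_smul_comm, hF, smul_add, smul_comm c (q - 1)]
  | h F n =>
    rw [opT_yR_mul_addAlphabet, AlgHom.comp_apply, opDMinus_addAlphabet_mul,
      opDMinus_opT_yR_mul_yL_pow, opDMinus_addAlphabet_mul, opDMinus_y_last_pow, map_mul,
      smul_q_sub_one]
    ring

/-- The commutator of `d_+` and `d_-` at the vertex `k + 1` is `(q - 1) T_1 ⋯ T_k y_{k+1}`. -/
theorem opDPlus_comm (F : V (k + 1)) :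
    opDPlus k (opDMinus k F) - opDMinus (k + 1) (opDPlus (k + 1) F) =
      (q - 1) • opTUp (k + 1) k (y (Fin.last k) * F) := by
  rw [opDPlus_apply, opDPlus_apply, map_neg, opTUp_succ, opDMinus_opTUp (by omega),
    opDMinus_opT_yR_mul, map_add, map_smul]
  abel

theorem opT_opDPlus_opDPlus (F : V k) :
    opT (k + 2) 1 (opDPlus (k + 1) (opDPlus k F)) = opDPlus (k + 1) (opDPlus k F) := by
  have h : opDPlus (k + 1) (opDPlus k F) = opTUp (k + 2) (k + 1) (opTUp (k + 2) k
      (yR k * yL k * addAlphabet₂ k F)) := by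
    rw [opDPlus_apply, opDPlus_apply, map_neg, mul_neg_V, map_neg, neg_neg,
      addAlphabet_opTUp (by omega), ← opTUp_y_last_mul (by omega), map_mul (addAlphabet _),
      addAlphabet_y, ← mul_assoc]
    rfl
  rw [h, opT_opTUp_opTUp (by omega), opT_last, hecke_of_swapY_eq]
  rw [map_mul, map_mul, swapY_addAlphabet₂, swapY_y, swapY_y, Equiv.swap_apply_left,
    Equiv.swap_apply_right, mul_comm (yR k)]

theorem opDPlus_opT {i : ℕ} (h1 : 1 ≤ i) (h2 : i < k) (F : V k) :
    opDPlus k (opT k i F) = opT (k + 1) (i + 1) (opDPlus k F) := by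
  rw [opDPlus_apply, opDPlus_apply, opT_addAlphabet h1 h2, ← opT_y_last_mul h1 h2,
    opTUp_opT h1 h2 (by omega), map_neg]

theorem opDMinus_comm_opT (F : V (k + 2)) :
    opDMinus (k + 1) (opTUp (k + 2) (k + 1) (yR k * opT (k + 2) (k + 1) F)) =
      q • opTUp (k + 1) k (y (Fin.last k) * opDMinus (k + 1) F) := by
  rw [opTUp_succ, opDMinus_opTUp (by omega), opT_yR_mul_opT, map_smul, map_smul, opDMinus_yL_mul]

theorem opT_comm_opDPlus (F : V (k + 1)) :
    opT (k + 2) 1 (opTUp (k + 2) (k + 1) (yR k * opDPlus (k + 1) F)) =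
      q • opDPlus (k + 1) (opTUp (k + 1) k (y (Fin.last k) * F)) := by
  have e : ∀ G : V (k + 1), addAlphabet (k + 1) (opTUp (k + 1) k (y (Fin.last k) * G)) =
      opTUp (k + 2) k (yL k * addAlphabet (k + 1) G) := by
    intro G
    rw [addAlphabet_opTUp (by omega), map_mul, addAlphabet_y]
  rw [opDPlus_apply, opDPlus_apply, e, mul_neg_V, map_neg, map_neg, smul_neg,
    opTUp_succ (k + 2) k (y _ * addAlphabet (k + 1) F),
    ← opTUp_y_last_mul (j := k) (by omega), ← opTUp_y_last_mul (j := k) (by omega),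
    opT_opTUp_opTUp (by omega), opT_yR_mul_opT, map_smul, map_smul, mul_left_comm]

theorem opTUp_y_mul_down {j : ℕ} (hj : j < k) (F : V k) :
    opTUp k j (y ⟨j, hj⟩ * (down (opT k) j : Module.End K (V k)) F) =
      q ^ j • (y ⟨0, by omega⟩ * F) := by
  induction j generalizing F with
  | zero => rw [pow_zero, one_smul]; rfl
  | succ j ih =>
    rw [opTUp_succ, down, Module.End.mul_apply, opT_y_right_mul_opT, map_smul, ih (by omega),
      smul_smul, pow_succ']

/-! ### The operators `T_i⁻¹` -/

/-- The inverse `q⁻¹ (T_i + q - 1)` of `T_i`. -/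
def opTinv (k i : ℕ) : Module.End K (V k) := q⁻¹ • (opT k i + (q - 1) • (1 : Module.End K (V k)))

theorem opTinv_apply (i : ℕ) (F : V k) : opTinv k i F = q⁻¹ • (opT k i F + (q - 1) • F) := rfl

theorem opT_opTinv {i : ℕ} (h1 : 1 ≤ i) (h2 : i < k) (F : V k) : opT k i (opTinv k i F) = F := by
  rw [opTinv_apply, map_smul, map_add, map_smul, opT_opT h1 h2, smul_q_sub_one,
    inv_smul_eq_iff₀ q_ne_zero, smul_q]
  ring

theorem opTinv_opT {i : ℕ} (h1 : 1 ≤ i) (h2 : i < k) (F : V k) : opTinv k i (opT k i F) = F := by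
  rw [opTinv_apply, opT_opT h1 h2, smul_q_sub_one, inv_smul_eq_iff₀ q_ne_zero, smul_q]
  ring

/-- `T_i` as a unit of the ring of operators on `V_k` (and `1` for `i` out of range). -/
def opTUnit (k i : ℕ) : (Module.End K (V k))ˣ :=
  if h : 1 ≤ i ∧ i < k then
    ⟨opT k i, opTinv k i, LinearMap.ext fun F => opT_opTinv h.1 h.2 F,
      LinearMap.ext fun F => opTinv_opT h.1 h.2 F⟩
  else 1

theorem opTUnit_val {i : ℕ} (h1 : 1 ≤ i) (h2 : i < k) :
    (opTUnit k i : Module.End K (V k)) = opT k i := by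
  rw [opTUnit, dif_pos ⟨h1, h2⟩]

theorem opTUnit_inv_val {i : ℕ} (h1 : 1 ≤ i) (h2 : i < k) :
    (((opTUnit k i)⁻¹ : (Module.End K (V k))ˣ) : Module.End K (V k)) = opTinv k i := by
  rw [opTUnit, dif_pos ⟨h1, h2⟩]
  rfl

theorem opTUnit_isBraid (k : ℕ) : IsBraid k (opTUnit k) where
  braid i h1 h2 := by
    ext1
    simp only [Units.val_mul, opTUnit_val h1 (show i < k by omega),
      opTUnit_val (show 1 ≤ i + 1 by omega) h2]
    exact (opT_isBraid k).braid i h1 h2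
  far i j h1 h2 h3 := by
    ext1
    simp only [Units.val_mul, opTUnit_val h1 (show i < k by omega),
      opTUnit_val (show 1 ≤ j by omega) h3]
    exact (opT_isBraid k).far i j h1 h2 h3

theorem opTinv_isBraid (k : ℕ) : IsBraid k (opTinv k) where
  braid i h1 h2 := by
    have := congrArg Units.val ((opTUnit_isBraid k).inv.braid i h1 h2)
    simpa only [Units.val_mul, opTUnit_inv_val h1 (show i < k by omega),
      opTUnit_inv_val (show 1 ≤ i + 1 by omega) h2] using this
  far i j h1 h2 h3 := by
    have := congrArg Units.val ((opTUnit_isBraid k).inv.far i j h1 h2 h3)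
    simpa only [Units.val_mul, opTUnit_inv_val h1 (show i < k by omega),
      opTUnit_inv_val (show 1 ≤ j by omega) h3] using this

end

section

variable {k : ℕ}

/-! ### The commutator of `d_+^*` and `d_-` -/

/-- The commutator of `d_+^*` and `d_-` on `V_{k+1}`. -/
def commStar (k : ℕ) : V (k + 1) →ₗ[K] V (k + 1) :=
  (dStar k).toLinearMap.comp (opDMinus k) -
    (opDMinus (k + 1)).comp (dStar (k + 1)).toLinearMap

theorem commStar_apply (F : V (k + 1)) :
    commStar k F = dStar k (opDMinus k F) - opDMinus (k + 1) (dStar (k + 1) F) := rfl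

theorem commStar_addAlphabet_mul (F : V k) (G : V (k + 1)) :
    commStar k (addAlphabet k F * G) = dStar k F * commStar k G := by
  rw [commStar_apply, commStar_apply, opDMinus_addAlphabet_mul, map_mul, map_mul,
    dStar_addAlphabet, opDMinus_addAlphabet_mul, mul_sub]

theorem commStar_y_last_pow (n : ℕ) : commStar k (y (Fin.last k) ^ n) =
    dStar k (pExpCoeff k n) - pExpCoeff (k + 1) n := by
  rw [commStar_apply, opDMinus_y_last_pow, map_pow, dStar_y, Fin.succ_last, opDMinus_y_last_pow]

theorem commStar_opT {i : ℕ} (h1 : 1 ≤ i) (h2 : i < k) (F : V (k + 1)) :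
    commStar k (opT (k + 1) i F) = opT (k + 1) (i + 1) (commStar k F) := by
  rw [commStar_apply, commStar_apply, opT_opDMinus h1 h2, opT_dStar h1 h2,
    opT_dStar h1 (by omega), opT_opDMinus (by omega) (by omega), map_sub]

theorem commStar_y_last_mul_addAlphabet (F : V k) :
    commStar k (y (Fin.last k) * addAlphabet k F) = ((1 - q) * t) • (y 0 * dStar k F) := by
  have h := dStar_pExpCoeff (k := k) 0
  have h1 := commStar_y_last_pow (k := k) 1
  simp only [pExpCoeff_zero, map_one, mul_one, zero_add] at h
  rw [pow_one] at h1
  rw [mul_comm, commStar_addAlphabet_mul, h1, mul_smul, sub_smul, one_smul, smul_q,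
    ← smul_mul_assoc]
  linear_combination dStar k F * h

theorem commStar_yL_mul (F : V (k + 2)) :
    commStar (k + 1) (yL k * F) = y (Fin.last (k + 1)) * commStar (k + 1) F := by
  have : yL k = addAlphabet (k + 1) (y (Fin.last k)) := by simp
  rw [this, commStar_addAlphabet_mul, dStar_y, Fin.succ_last]

theorem commStar_yL_pow_mul (m : ℕ) (F : V (k + 2)) :
    commStar (k + 1) (yL k ^ m * F) = y (Fin.last (k + 1)) ^ m * commStar (k + 1) F := by
  induction m generalizing F with
  | zero => simp
  | succ m ih => rw [pow_succ, mul_assoc, ih, commStar_yL_mul, pow_succ, mul_assoc]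

theorem dStar_qV : dStar k (qV : V k) = qV := (dStar k).commutes q

theorem commStar_opT_yR_mul_yL_pow (n : ℕ) :
    commStar (k + 1) (opT (k + 2) (k + 1) (yR k * yL k ^ n)) =
      yR k * (addAlphabet (k + 1) (dStar k (pExpCoeff k n)) -
        addAlphabet (k + 1) (pExpCoeff (k + 1) n)) := by
  have h1 : ∀ m n, commStar (k + 1) (yL k ^ m * yR k ^ n) = yR k ^ m *
      (dStar (k + 1) (pExpCoeff (k + 1) n) - pExpCoeff (k + 2) n) := by
    intro m n
    rw [commStar_yL_pow_mul, commStar_y_last_pow]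
  have h2 : commStar (k + 1) (yL k ^ n) = 0 := by
    rw [← mul_one (yL k ^ n), ← pow_zero (yR k), h1, pExpCoeff_zero, pExpCoeff_zero, map_one,
      sub_self, mul_zero]
  have h3 : commStar (k + 1) (yR k ^ n) =
      dStar (k + 1) (pExpCoeff (k + 1) n) - pExpCoeff (k + 2) n := commStar_y_last_pow n
  have h4 := congrArg (dStar (k + 1)) (map_pExpCoeff_eq_sum (addAlphabet k) _ addAlphabet_p n)
  rw [dStar_addAlphabet] at h4
  simp only [map_sub, map_mul, map_sum, map_pow, map_one, dStar_qV, dStar_y, Fin.succ_last] at h4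
  rw [opT_yR_mul_yL_pow, commStar_yL_mul, map_add, map_sub, ← smul_q_sub_one, ← smul_q_sub_one,
    map_smul, map_smul, map_sum, h2, h3, smul_zero, add_zero, smul_q_sub_one,
    map_pExpCoeff_eq_sum (addAlphabet (k + 1)) _ addAlphabet_p, h4]
  simp only [h1, mul_sub, Finset.sum_sub_distrib]
  ring

/-- The relation behind `d_+ z_i = z_{i+1} d_+`. -/
theorem commStar_opT_yR_mul_addAlphabet (F : V (k + 1)) :
    commStar (k + 1) (opT (k + 2) (k + 1) (yR k * addAlphabet (k + 1) F)) =
      yR k * addAlphabet (k + 1) (commStar k F) := by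
  induction F using induction_addAlphabet with
  | hadd F G hF hG => simp only [map_add, mul_add, hF, hG]
  | hsmul c F hF => simp only [map_smul, mul_smul_comm, hF]
  | h F n =>
    rw [opT_yR_mul_addAlphabet, AlgHom.comp_apply, commStar_addAlphabet_mul,
      commStar_opT_yR_mul_yL_pow, commStar_addAlphabet_mul, commStar_y_last_pow, map_mul,
      map_sub, dStar_addAlphabet]
    ring

/-- `d_+^{*2} F` is symmetric in `y_1` and `y_2`. -/
theorem swapY_dStar_dStar (F : V k) : swapY 0 1 (dStar (k + 1) (dStar k F)) =
    dStar (k + 1) (dStar k F) := by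
  have : (swapY 0 1).comp ((dStar (k + 1)).comp (dStar k)) = (dStar (k + 1)).comp (dStar k) := by
    apply algHom_ext_V
    · intro n
      simp [dStar_dStar_p]
      ring
    · intro i
      simp only [AlgHom.comp_apply, dStar_y, swapY_y]
      rw [Equiv.swap_apply_of_ne_of_ne]
      · exact Fin.succ_ne_zero _
      · intro h
        rw [← Fin.succ_zero_eq_one, Fin.succ_inj] at h
        exact Fin.succ_ne_zero _ h
  exact DFunLike.congr_fun this F

theorem opT_dStar_dStar (F : V k) :
    opT (k + 2) 1 (dStar (k + 1) (dStar k F)) = dStar (k + 1) (dStar k F) := by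
  rw [opT_one, hecke_of_swapY_eq _ (swapY_dStar_dStar F)]

theorem t_ne_zero : t ≠ 0 := by
  rw [t, Ne, FaithfulSMul.algebraMap_eq_zero_iff]
  exact MvPolynomial.X_ne_zero 1

theorem opT_one_dStar_pExpCoeff (n : ℕ) :
    opT (k + 2) 1 (dStar (k + 1) (pExpCoeff (k + 1) n)) =
      dStar (k + 1) (dStar k (pExpCoeff k n)) -
        qV * (dStar (k + 1) (pExpCoeff (k + 1) n) - pExpCoeff (k + 2) n) := by
  have h1 := dStar_pExpCoeff (k := k + 1) n
  have h2 := congrArg (swapY 0 1) h1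
  have h3 := congrArg (dStar (k + 1)) (dStar_pExpCoeff (k := k) n)
  have h4 := congrArg (swapY 0 1) h3
  have hq' : swapY 0 1 (qV : V (k + 2)) = qV := (swapY 0 1).commutes q
  simp only [map_sub, map_mul, map_smul, dStar_y, dStar_qV, hq', swapY_y, Equiv.swap_apply_left,
    Equiv.swap_apply_right, swapY_dStar_dStar, swapY_pExpCoeff, Fin.succ_zero_eq_one]
    at h2 h3 h4
  rw [opT_one]
  apply hecke_unique
  have ht : (MvPolynomial.C t : V (k + 2)) ≠ 0 := by
    rw [Ne, MvPolynomial.C_eq_zero]; exact t_ne_zero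
  apply mul_left_cancel₀ ht
  simp only [MvPolynomial.smul_eq_C_mul] at h1 h2 h3 h4
  linear_combination h4 - h3 + h2 - h1

/-- The relation between `d_+^* d_- - d_- d_+^*` and `d_+^*`. -/
theorem opT_dStar_commStar (F : V (k + 1)) :
    opT (k + 2) 1 (dStar (k + 1) (commStar k F)) = q • commStar (k + 1) (dStar (k + 1) F) := by
  induction F using induction_addAlphabet with
  | hadd F G hF hG => simp only [map_add, hF, hG, smul_add]
  | hsmul c F hF => simp only [map_smul, hF, smul_comm c q]
  | h F n =>
    have h : swapY 0 1 (dStar (k + 1) (dStar k F)) = _ := swapY_dStar_dStar F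
    rw [commStar_addAlphabet_mul, commStar_y_last_pow, map_mul (dStar _), map_mul (dStar _),
      dStar_addAlphabet, map_pow, dStar_y, Fin.succ_last, commStar_addAlphabet_mul,
      commStar_y_last_pow, opT_one,
      hecke_mul _ h, ← opT_one, map_sub, map_sub, opT_dStar_dStar, opT_one_dStar_pExpCoeff, smul_q]
    ring

/-- The operator whose vanishing on polynomials symmetric in the last two variables is the
relation between `d_+^* d_- - d_- d_+^*` and `d_-`. -/
def commStarDefect (k : ℕ) : V (k + 2) →ₗ[K] V (k + 1) :=
  (1 + q) • (opDMinus (k + 1)).comp ((dStar (k + 1)).toLinearMap.comp (opDMinus (k + 1))) -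
    q • (opDMinus (k + 1)).comp ((opDMinus (k + 2)).comp (dStar (k + 2)).toLinearMap) -
    (dStar k).toLinearMap.comp ((opDMinus k).comp (opDMinus (k + 1)))

theorem commStarDefect_apply (F : V (k + 2)) : commStarDefect k F =
    (1 + q) • opDMinus (k + 1) (dStar (k + 1) (opDMinus (k + 1) F)) -
      q • opDMinus (k + 1) (opDMinus (k + 2) (dStar (k + 2) F)) -
      dStar k (opDMinus k (opDMinus (k + 1) F)) := rfl

theorem dStar_yL_pow_mul_yR_pow (m n : ℕ) :
    dStar (k + 2) (yL k ^ m * yR k ^ n) = yL (k + 1) ^ m * yR (k + 1) ^ n := by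
  rw [map_mul, map_pow, map_pow, dStar_y, dStar_y, Fin.succ_last, Fin.succ_castSucc,
    Fin.succ_last]

theorem opDMinus_dStar_opDMinus_sub (m n : ℕ) :
    opDMinus (k + 1) (dStar (k + 1) (opDMinus (k + 1) (yL k ^ m * yR k ^ (n + 1)))) -
      q • opDMinus (k + 1) (dStar (k + 1) (opDMinus (k + 1) (yL k ^ (m + 1) * yR k ^ n))) =
    pExpCoeff (k + 1) m * dStar k (pExpCoeff k (n + 1)) -
      pExpCoeff (k + 1) (m + 1) * dStar k (pExpCoeff k n) := by
  simp only [opDMinus_yL_pow_mul_yR_pow]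
  rw [← map_smul, ← map_sub, map_mul, map_mul, map_pow, map_pow, dStar_y, Fin.succ_last]
  have h := congrArg (dStar (k + 1)) (addAlphabet_pExpCoeff (k := k) n)
  simp only [map_sub, map_mul, dStar_y, Fin.succ_last, dStar_addAlphabet, dStar_qV] at h
  have : y (Fin.last (k + 1)) ^ m * dStar (k + 1) (pExpCoeff (k + 1) (n + 1)) -
      q • (y (Fin.last (k + 1)) ^ (m + 1) * dStar (k + 1) (pExpCoeff (k + 1) n)) =
      addAlphabet (k + 1) (dStar k (pExpCoeff k (n + 1))) * y (Fin.last (k + 1)) ^ m -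
      addAlphabet (k + 1) (dStar k (pExpCoeff k n)) * y (Fin.last (k + 1)) ^ (m + 1) := by
    rw [smul_q]
    linear_combination -y (Fin.last (k + 1)) ^ m * h
  rw [this, map_sub, opDMinus_addAlphabet_mul, opDMinus_addAlphabet_mul, opDMinus_y_last_pow,
    opDMinus_y_last_pow]
  ring

theorem commStarDefect_yL_pow_mul_yR_pow (m n : ℕ) :
    commStarDefect k (yL k ^ m * yR k ^ n) =
      pExpCoeff (k + 1) m * dStar k (pExpCoeff k n) -
        pExpCoeff (k + 1) n * dStar k (pExpCoeff k m) := by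
  induction n generalizing m with
  | zero =>
    rw [commStarDefect_apply, dStar_yL_pow_mul_yR_pow]
    simp only [opDMinus_yL_pow_mul_yR_pow, pExpCoeff_zero, mul_one, map_pow, dStar_y, map_one,
      Fin.succ_last, opDMinus_y_last_pow, add_smul, one_smul, one_mul]
    ring
  | succ n ih =>
    have h0 := ih (m + 1)
    have h1 := opDMinus_dStar_opDMinus_sub (k := k) m n
    have h2 := opDMinus_opDMinus_yR_sub (k := k + 1) m n
    have h3 := congrArg (dStar k) (opDMinus_opDMinus_yR_sub (k := k) m n)
    have h4 := dStar_pExpCoeff (k := k) n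
    have h5 := dStar_pExpCoeff (k := k) m
    rw [commStarDefect_apply, dStar_yL_pow_mul_yR_pow] at h0 ⊢
    simp only [map_sub, map_mul, smul_q, dStar_qV] at h1 h2 h3
    simp only [smul_q, add_smul, one_smul] at h0 ⊢
    linear_combination qV * h0 + (1 + qV) * h1 - qV * h2 - h3 +
      (qV * pExpCoeff (k + 1) m - dStar k (pExpCoeff k m)) * h4 +
      (dStar k (pExpCoeff k n) - qV * pExpCoeff (k + 1) n) * h5

theorem commStarDefect_addAlphabet₂_mul (F : V k) (G : V (k + 2)) :
    commStarDefect k (addAlphabet₂ k F * G) = dStar k F * commStarDefect k G := by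
  simp only [commStarDefect_apply, AlgHom.comp_apply, opDMinus_addAlphabet_mul, map_mul,
    dStar_addAlphabet, smul_q, add_smul, one_smul]
  ring

/-- On the spanning monomials the defect is visibly antisymmetric, although none of its three terms
is. -/
theorem commStarDefect_swapY (F : V (k + 2)) :
    commStarDefect k (swapY (Fin.last k).castSucc (Fin.last (k + 1)) F) =
      -commStarDefect k F := by
  induction F using induction_addAlphabet₂ with
  | hadd F G hF hG => simp only [map_add, hF, hG, neg_add]
  | hsmul c F hF => simp only [map_smul, hF, smul_neg]
  | h F m n =>
    rw [map_mul (swapY _ _), swapY_addAlphabet₂, map_mul (swapY _ _), map_pow, map_pow, swapY_y,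
      swapY_y, Equiv.swap_apply_left, Equiv.swap_apply_right, mul_comm (_ ^ m),
      commStarDefect_addAlphabet₂_mul, commStarDefect_addAlphabet₂_mul,
      commStarDefect_yL_pow_mul_yR_pow, commStarDefect_yL_pow_mul_yR_pow]
    ring

theorem commStarDefect_of_opT_eq {F : V (k + 2)} (hF : opT (k + 2) (k + 1) F = F) :
    commStarDefect k F = 0 := by
  rw [opT_last] at hF
  have h := commStarDefect_swapY F
  rwa [swapY_eq_of_hecke_eq _ hF, eq_neg_iff_add_eq_zero, ← two_mul, mul_eq_zero,
    or_iff_right two_ne_zero] at h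

/-- The relation between `d_+^* d_- - d_- d_+^*` and `d_-`. -/
theorem opDMinus_commStar (F : V (k + 2)) :
    q • opDMinus (k + 1) (commStar (k + 1) F) =
      commStar k (opDMinus (k + 1) (opT (k + 2) (k + 1) F)) := by
  -- The image of `T + q` is fixed by `T`, so the defect vanishes on it.
  have hT : opT (k + 2) (k + 1) (opT (k + 2) (k + 1) F + q • F) =
      opT (k + 2) (k + 1) F + q • F := by
    rw [map_add, map_smul, opT_opT (by omega) (by omega), smul_q, smul_q]
    ring
  have h := commStarDefect_of_opT_eq hT
  rw [commStarDefect_apply] at h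
  simp only [map_add, map_smul] at h
  rw [opT_dStar (by omega) (by omega), opDMinus_opDMinus_opT, opDMinus_opDMinus_opT] at h
  rw [commStar_apply, commStar_apply, map_sub, opDMinus_opDMinus_opT]
  have hq : (1 + qV : V (k + 1)) ≠ 0 := by
    rw [← map_one MvPolynomial.C, ← map_add, Ne, MvPolynomial.C_eq_zero]
    exact one_add_q_ne_zero
  apply mul_left_cancel₀ hq
  simp only [smul_q, add_smul, one_smul] at h ⊢
  linear_combination h

end

section

/-! ### The action of the algebra on `V_*` -/

section ExtendOp

variable {k l m : ℕ}

theorem extendOp_lof (f : V k →ₗ[K] V l) (F : V k) :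
    extendOp f (DirectSum.lof K ℕ V k F) = DirectSum.lof K ℕ V l (f F) := by
  simp only [extendOp, LinearMap.comp_apply, DirectSum.component.lof_self]

theorem extendOp_lof_ne (f : V k →ₗ[K] V l) (h : m ≠ k) (F : V m) :
    extendOp f (DirectSum.lof K ℕ V m F) = 0 := by
  simp only [extendOp, LinearMap.comp_apply]
  rw [DirectSum.component.of, dif_neg h, map_zero, map_zero]

theorem extendOp_mul (f : V l →ₗ[K] V m) (g : V k →ₗ[K] V l) :
    extendOp f * extendOp g = extendOp (f ∘ₗ g) := by
  refine LinearMap.ext fun x => ?_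
  simp only [extendOp, Module.End.mul_apply, LinearMap.comp_apply, DirectSum.component.lof_self]

theorem extendOp_mul_of_ne {l' : ℕ} (h : l ≠ l') (f : V l' →ₗ[K] V m) (g : V k →ₗ[K] V l) :
    extendOp f * extendOp g = 0 := by
  refine LinearMap.ext fun x => ?_
  have := extendOp_lof_ne f h (g (DirectSum.component K ℕ V k x))
  exact this

theorem extendOp_zero : extendOp (0 : V k →ₗ[K] V l) = 0 := by
  simp [extendOp]

theorem extendOp_add (f g : V k →ₗ[K] V l) : extendOp (f + g) = extendOp f + extendOp g := by
  rw [extendOp, LinearMap.add_comp, LinearMap.comp_add]; rfl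

theorem extendOp_smul (c : K) (f : V k →ₗ[K] V l) : extendOp (c • f) = c • extendOp f := by
  rw [extendOp, LinearMap.smul_comp, LinearMap.comp_smul]; rfl

end ExtendOp

/-- The relations of the Dyck path algebra for operators `V_k → V_l`, in pointwise form. -/
structure DyckOps (Q : K) (T : ∀ k, ℕ → Module.End K (V k)) (dp : ∀ k, V k →ₗ[K] V (k + 1))
    (c : ∀ k, Module.End K (V (k + 1))) : Prop where
  comm (k : ℕ) (F : V (k + 1)) :
    c k F = dp k (opDMinus k F) - opDMinus (k + 1) (dp (k + 1) F)
  quad {k i : ℕ} (h1 : 1 ≤ i) (h2 : i < k) (F : V k) :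
    T k i (T k i F) = (1 - Q) • T k i F + Q • F
  braid (k : ℕ) : IsBraid k (T k)
  dm_dm_T (k : ℕ) (F : V (k + 2)) :
    opDMinus k (opDMinus (k + 1) (T (k + 2) (k + 1) F)) = opDMinus k (opDMinus (k + 1) F)
  T_dm {k i : ℕ} (h1 : 1 ≤ i) (h2 : i < k) (F : V (k + 1)) :
    T k i (opDMinus k F) = opDMinus k (T (k + 1) i F)
  T_dp_dp (k : ℕ) (F : V k) : T (k + 2) 1 (dp (k + 1) (dp k F)) = dp (k + 1) (dp k F)
  dp_T {k i : ℕ} (h1 : 1 ≤ i) (h2 : i < k) (F : V k) :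
    dp k (T k i F) = T (k + 1) (i + 1) (dp k F)
  dm_comm (k : ℕ) (F : V (k + 2)) :
    opDMinus (k + 1) (c (k + 1) (T (k + 2) (k + 1) F)) = Q • c k (opDMinus (k + 1) F)
  comm_dp (k : ℕ) (F : V (k + 1)) :
    T (k + 2) 1 (c (k + 1) (dp (k + 1) F)) = Q • dp (k + 1) (c k F)

/-- The operator `(q - 1) T_1 ⋯ T_k y_{k+1}` on `V_{k+1}`. -/
def commPlus (k : ℕ) : Module.End K (V (k + 1)) :=
  (q - 1) • (opTUp (k + 1) k ∘ₗ LinearMap.mulLeft K (y (Fin.last k)))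

theorem commPlus_apply (k : ℕ) (F : V (k + 1)) :
    commPlus k F = (q - 1) • opTUp (k + 1) k (y (Fin.last k) * F) := rfl

theorem dyckOps_plus : DyckOps q opT opDPlus commPlus where
  comm k F := (opDPlus_comm F).symm
  quad h1 h2 F := by
    rw [opT_opT h1 h2, sub_smul, smul_q, smul_q, one_smul, sub_mul, one_mul]
  braid := opT_isBraid
  dm_dm_T k F := opDMinus_opDMinus_opT F
  T_dm h1 h2 F := (opT_opDMinus h1 h2 F).symm
  T_dp_dp k F := opT_opDPlus_opDPlus F
  dp_T h1 h2 F := opDPlus_opT h1 h2 F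
  dm_comm k F := by
    rw [commPlus_apply, commPlus_apply, map_smul, opDMinus_comm_opT, smul_comm]
  comm_dp k F := by
    rw [commPlus_apply, commPlus_apply, map_smul, opT_comm_opDPlus, map_smul, smul_comm]

theorem dyckOps_star : DyckOps q⁻¹ opTinv opDPlusStar commStar where
  comm k F := rfl
  quad {k i} h1 h2 F := by
    rw [opTinv_apply i (opTinv k i F), opT_opTinv h1 h2, smul_add, smul_smul, mul_sub,
      inv_mul_cancel₀ q_ne_zero, mul_one, add_comm]
  braid := opTinv_isBraid
  dm_dm_T k F := by
    rw [← opDMinus_opDMinus_opT, opT_opTinv (by omega) (by omega)]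
  T_dm {k i} h1 h2 F := by
    rw [opTinv_apply, opTinv_apply, map_smul, map_add, map_smul, opT_opDMinus h1 h2]
  T_dp_dp k F := by
    have h := opT_dStar_dStar F
    change opTinv (k + 2) 1 (dStar (k + 1) (dStar k F)) = dStar (k + 1) (dStar k F)
    rw [opTinv_apply, h, inv_smul_eq_iff₀ q_ne_zero, sub_smul, one_smul]
    abel
  dp_T {k i} h1 h2 F := by
    change dStar k (opTinv k i F) = opTinv (k + 1) (i + 1) (dStar k F)
    rw [opTinv_apply, opTinv_apply, map_smul, map_add, map_smul, opT_dStar h1 h2]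
  dm_comm k F := by
    have h := opDMinus_commStar (opTinv (k + 2) (k + 1) F)
    rw [opT_opTinv (by omega) (by omega)] at h
    rw [← h, inv_smul_smul₀ q_ne_zero]
  comm_dp k F := by
    have h := opT_dStar_commStar F
    change opTinv (k + 2) 1 (commStar (k + 1) (dStar (k + 1) F)) =
      q⁻¹ • dStar (k + 1) (commStar k F)
    rw [← opTinv_opT (k := k + 2) (i := 1) (by omega) (by omega) (dStar (k + 1) (commStar k F)), h,
      map_smul,
      inv_smul_smul₀ q_ne_zero]

/-- The loops `y_i` (for `i ≥ 1`) on `V_{k+1}`, built from operators `T_i`, their inverses and the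
commutator `c`. -/
def loopOp (Q : K) (T Tinv : ∀ k, ℕ → Module.End K (V k)) (c : ∀ k, Module.End K (V (k + 1)))
    (k : ℕ) : ℕ → Module.End K (V (k + 1))
  | 0 => 0
  | 1 => (Q ^ k * (Q - 1))⁻¹ • (c k * down (T (k + 1)) k)
  | i + 2 => Q • (Tinv (k + 1) (i + 1) * loopOp Q T Tinv c k (i + 1) * Tinv (k + 1) (i + 1))

/-- The loops `y_i` on `V_{k+1}`. -/
abbrev opY (k : ℕ) : ℕ → Module.End K (V (k + 1)) := loopOp q opT opTinv commPlus k

theorem opY_one_apply (k : ℕ) (F : V (k + 1)) : opY k 1 F = (q ^ k * (q - 1))⁻¹ •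
    commPlus k ((down (opT (k + 1)) k : Module.End K (V (k + 1))) F) := rfl

theorem opY_succ_apply (k i : ℕ) (F : V (k + 1)) : opY k (i + 2) F =
    q • opTinv (k + 1) (i + 1) (opY k (i + 1) (opTinv (k + 1) (i + 1) F)) := rfl

/-- The loops `y_i` act as multiplication by the variables. -/
theorem opY_apply {k i : ℕ} (hi : i < k + 1) (F : V (k + 1)) :
    opY k (i + 1) F = y ⟨i, hi⟩ * F := by
  induction i generalizing F with
  | zero =>
    rw [zero_add, opY_one_apply, commPlus_apply, y_last_eq,
      opTUp_y_mul_down (k := k + 1) (j := k) (by omega),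
      inv_smul_eq_iff₀ (mul_ne_zero (pow_ne_zero _ q_ne_zero) q_sub_one_ne_zero), smul_smul,
      mul_comm (q - 1)]
  | succ i ih =>
    rw [opY_succ_apply, ih (by omega), ← map_smul]
    have h := opT_y_right_mul_opT hi (opTinv (k + 1) (i + 1) F)
    rw [opT_opTinv (by omega) hi] at h
    rw [← h, opTinv_opT (by omega) hi]

/-- The loops `z_i` on `V_{k+1}`. -/
abbrev opZ (k : ℕ) : ℕ → Module.End K (V (k + 1)) := loopOp q⁻¹ opTinv opT commStar k

theorem down_opTinv_opTUp {k j : ℕ} (hj : j < k) (F : V k) :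
    (down (opTinv k) j : Module.End K (V k)) (opTUp k j F) = F := by
  induction j generalizing F with
  | zero => rfl
  | succ j ih =>
    rw [opTUp_succ, down, Module.End.mul_apply, ih (by omega), opTinv_opT (by omega) hj]

theorem opTUp_down_opTinv {k j : ℕ} (hj : j < k) (F : V k) :
    opTUp k j ((down (opTinv k) j : Module.End K (V k)) F) = F := by
  induction j generalizing F with
  | zero => rfl
  | succ j ih =>
    rw [opTUp_succ, down, Module.End.mul_apply, opT_opTinv (by omega) hj, ih (by omega)]

theorem opZ_one_apply (k : ℕ) (F : V (k + 1)) : opZ k 1 F = (q ^ (k + 1) * (1 - q)⁻¹) •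
    commStar k ((down (opTinv (k + 1)) k : Module.End K (V (k + 1))) F) := by
  have : (q⁻¹ ^ k * (q⁻¹ - 1))⁻¹ = q ^ (k + 1) * (1 - q)⁻¹ := by
    have h1 := q_ne_zero
    have h2 : 1 - q ≠ 0 := by rw [← neg_sub, neg_ne_zero]; exact q_sub_one_ne_zero
    have h3 : q⁻¹ - 1 = (1 - q) * q⁻¹ := by field_simp
    rw [h3, mul_inv, mul_inv, inv_inv, inv_pow, inv_inv]
    ring
  rw [opZ, loopOp, this]
  rfl

theorem opZ_opDPlus (k : ℕ) (F : V k) :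
    opZ k 1 (opDPlus k F) = -(t * q ^ (k + 1)) • (y 0 * dStar k F) := by
  have h2 : 1 - q ≠ 0 := by rw [← neg_sub, neg_ne_zero]; exact q_sub_one_ne_zero
  rw [opZ_one_apply, opDPlus_apply, map_neg, down_opTinv_opTUp (by omega), map_neg,
    commStar_y_last_mul_addAlphabet, smul_neg, smul_smul, neg_smul]
  congr 2
  field_simp

theorem opT_commStar_opTUp {k j : ℕ} (hj : j ≤ k) (F : V (k + 2)) :
    opT (k + 2) 1 (commStar (k + 1) (opTUp (k + 2) j F)) =
      opTUp (k + 2) (j + 1) (commStar (k + 1) F) := by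
  induction j generalizing F with
  | zero => rfl
  | succ j ih =>
    rw [opTUp_succ, ih (by omega), commStar_opT (by omega) (by omega)]
    rfl

theorem opDPlus_opZ {k i : ℕ} (hi : i < k + 1) (F : V (k + 1)) :
    opDPlus (k + 1) (opZ k (i + 1) F) = opZ (k + 1) (i + 2) (opDPlus (k + 1) F) := by
  induction i generalizing F with
  | zero =>
    set G := (down (opTinv (k + 1)) k : Module.End K (V (k + 1))) F
    have hF : F = opTUp (k + 1) k G := (opTUp_down_opTinv (by omega) F).symm
    have h1 : opDPlus (k + 1) F =
        -opTUp (k + 2) (k + 1) (opTUp (k + 2) k (yR k * addAlphabet (k + 1) G)) := by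
      rw [hF, opDPlus_apply, addAlphabet_opTUp (by omega), ← opTUp_y_last_mul (by omega)]
    have h2 : (down (opTinv (k + 2)) (k + 1) : Module.End K (V (k + 2)))
        (opT (k + 2) 1 (opDPlus (k + 1) F)) =
        -opTUp (k + 2) k (opT (k + 2) (k + 1) (yR k * addAlphabet (k + 1) G)) := by
      rw [h1, map_neg, map_neg, opT_opTUp_opTUp (by omega), down_opTinv_opTUp (by omega)]
    have h3 : opZ (k + 1) 2 (opDPlus (k + 1) F) =
        q⁻¹ • opT (k + 2) 1 (opZ (k + 1) 1 (opT (k + 2) 1 (opDPlus (k + 1) F))) := rfl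
    rw [h3, opZ_one_apply, opZ_one_apply, h2, map_neg, smul_neg, map_neg, map_smul, map_smul,
      opT_commStar_opTUp le_rfl, commStar_opT_yR_mul_addAlphabet, opDPlus_apply, smul_neg,
      smul_neg, smul_smul]
    congr 2
    have h1 := q_ne_zero
    field_simp
    ring
  | succ i ih =>
    have e1 : ∀ F, opZ k (i + 2) F =
        q⁻¹ • opT (k + 1) (i + 1) (opZ k (i + 1) (opT (k + 1) (i + 1) F)) := fun _ => rfl
    have e2 : ∀ F, opZ (k + 1) (i + 3) F =
        q⁻¹ • opT (k + 2) (i + 2) (opZ (k + 1) (i + 2) (opT (k + 2) (i + 2) F)) := fun _ => rfl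
    rw [e1, e2, map_smul, opDPlus_opT (by omega) hi, ih (by omega), opDPlus_opT (by omega) hi]

end

section

/-- The action of the free algebra on `V_*`. -/
def freeAction : Free →ₐ[K] Module.End K VStar := FreeAlgebra.lift K op

section

open Free

variable {k l : ℕ}

theorem freeAction_ι (g : Gen) : freeAction (FreeAlgebra.ι K g) = op g :=
  FreeAlgebra.lift_ι_apply _ _

theorem freeAction_e (k : ℕ) : freeAction (e k) = extendOp (1 : Module.End K (V k)) :=
  freeAction_ι _

theorem freeAction_dp (k : ℕ) : freeAction (dp k) = extendOp (opDPlus k) := freeAction_ι _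

theorem freeAction_ds (k : ℕ) : freeAction (ds k) = extendOp (opDPlusStar k) := freeAction_ι _

theorem freeAction_dm (k : ℕ) : freeAction (dm k) = extendOp (opDMinus k) := freeAction_ι _

theorem freeAction_T (k i : ℕ) : freeAction (T k i) = extendOp (opT k i) := by
  rw [T]
  split_ifs with h
  · exact freeAction_ι _
  · rw [opT, dif_neg h, map_zero, extendOp_zero]

theorem freeAction_Tinv (k i : ℕ) : freeAction (Tinv k i) = extendOp (opTinv k i) := by
  rw [Tinv, map_smul, map_add, map_smul, freeAction_T, freeAction_e, opTinv, extendOp_smul,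
    extendOp_add, extendOp_smul]

/-- `map_sub` for `freeAction`, whose target is only seen as a semiring. -/
theorem freeAction_sub (a b : Free) :
    freeAction (a - b) = freeAction a + (-1 : K) • freeAction b := by
  have : a - b = a + (-1 : K) • b := by
    rw [sub_eq_add_neg]
    congr 1
  rw [this, map_add, map_smul]

theorem freeAction_sub_eq {a b : Free} {f g : V k →ₗ[K] V l} (ha : freeAction a = extendOp f)
    (hb : freeAction b = extendOp g) : freeAction (a - b) = extendOp (f - g) := by
  have : f - g = f + (-1 : K) • g := by
    refine LinearMap.ext fun F => ?_
    rw [LinearMap.sub_apply, LinearMap.add_apply, LinearMap.smul_apply,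
      MvPolynomial.smul_eq_C_mul, map_neg, map_one]
    ring
  rw [freeAction_sub, ha, hb, ← extendOp_smul, ← extendOp_add, this]

theorem freeAction_mul_eq {m : ℕ} {a b : Free} {f : V l →ₗ[K] V m} {g : V k →ₗ[K] V l}
    (ha : freeAction a = extendOp f) (hb : freeAction b = extendOp g) :
    freeAction (a * b) = extendOp (f ∘ₗ g) := by
  rw [map_mul, ha, hb, extendOp_mul]

theorem freeAction_smul_eq {a : Free} {f : V k →ₗ[K] V l} (c : K)
    (ha : freeAction a = extendOp f) : freeAction (c • a) = extendOp (c • f) := by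
  rw [map_smul, ha, extendOp_smul]

theorem freeAction_add_eq {a b : Free} {f g : V k →ₗ[K] V l} (ha : freeAction a = extendOp f)
    (hb : freeAction b = extendOp g) : freeAction (a + b) = extendOp (f + g) := by
  rw [map_add, ha, hb, ← extendOp_add]

variable {Q : K} {T' Tinv' : ∀ k, ℕ → Module.End K (V k)} {dp' : ∀ k, V k →ₗ[K] V (k + 1)}
  {c : ∀ k, Module.End K (V (k + 1))} {fT fTinv : ℕ → ℕ → Free} {fdp : ℕ → Free}

theorem freeAction_comm (h : DyckOps Q T' dp' c)
    (hdp : ∀ k, freeAction (fdp k) = extendOp (dp' k)) (k : ℕ) :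
    freeAction (comm dm fdp (k + 1)) = extendOp (c k) := by
  have : c k = dp' k ∘ₗ opDMinus k - opDMinus (k + 1) ∘ₗ dp' (k + 1) :=
    LinearMap.ext fun F => h.comm k F
  rw [this]
  exact freeAction_sub_eq (freeAction_mul_eq (hdp k) (freeAction_dm k))
    (freeAction_mul_eq (freeAction_dm (k + 1)) (hdp (k + 1)))

theorem freeAction_tDown (hT : ∀ k i, freeAction (fT k i) = extendOp (T' k i)) (k j : ℕ) :
    freeAction (tDown e fT k j) = extendOp (down (T' k) j : Module.End K (V k)) := by
  induction j with
  | zero => exact freeAction_e k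
  | succ j ih => exact freeAction_mul_eq (hT k (j + 1)) ih

theorem freeAction_yLoop (h : DyckOps Q T' dp' c)
    (hdp : ∀ k, freeAction (fdp k) = extendOp (dp' k))
    (hT : ∀ k i, freeAction (fT k i) = extendOp (T' k i))
    (hTinv : ∀ k i, freeAction (fTinv k i) = extendOp (Tinv' k i)) (k i : ℕ) :
    freeAction (yLoop Q e fT fTinv dm fdp (k + 1) (i + 1)) =
      extendOp (loopOp Q T' Tinv' c k (i + 1)) := by
  induction i with
  | zero =>
    exact freeAction_smul_eq _ (freeAction_mul_eq (freeAction_comm h hdp k)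
      (freeAction_tDown hT (k + 1) k))
  | succ i ih =>
    exact freeAction_smul_eq _ (freeAction_mul_eq (freeAction_mul_eq (hTinv _ _) ih) (hTinv _ _))

theorem freeAction_dyckRel (h : DyckOps Q T' dp' c)
    (hdp : ∀ k, freeAction (fdp k) = extendOp (dp' k))
    (hT : ∀ k i, freeAction (fT k i) = extendOp (T' k i)) {a b : Free}
    (hab : DyckRel Q e fT dm fdp a b) : freeAction a = freeAction b := by
  have hc := freeAction_comm h hdp
  have hdm := freeAction_dm
  cases hab with
  | quad k i h1 h2 =>
    rw [freeAction_mul_eq (freeAction_sub_eq (hT k i) (freeAction_e k))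
      (freeAction_add_eq (hT k i) (freeAction_smul_eq Q (freeAction_e k))), map_zero,
      ← extendOp_zero (k := k) (l := k)]
    congr 1
    refine LinearMap.ext fun F => ?_
    change T' k i (T' k i F + Q • F) - (T' k i F + Q • F) = 0
    rw [map_add, map_smul, h.quad h1 h2, sub_smul, one_smul]
    abel
  | braid k i h1 h2 =>
    rw [freeAction_mul_eq (freeAction_mul_eq (hT k i) (hT k (i + 1))) (hT k i),
      freeAction_mul_eq (freeAction_mul_eq (hT k (i + 1)) (hT k i)) (hT k (i + 1))]
    exact congrArg extendOp ((h.braid k).braid i h1 h2)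
  | far k i j h1 h2 h3 =>
    rw [freeAction_mul_eq (hT k i) (hT k j), freeAction_mul_eq (hT k j) (hT k i)]
    exact congrArg extendOp ((h.braid k).far i j h1 h2 h3)
  | dm_dm_T k =>
    rw [freeAction_mul_eq (freeAction_mul_eq (hdm k) (hdm (k + 1))) (hT _ _),
      freeAction_mul_eq (hdm k) (hdm (k + 1))]
    exact congrArg extendOp (LinearMap.ext fun F => h.dm_dm_T k F)
  | T_dm k i h1 h2 =>
    rw [freeAction_mul_eq (hT k i) (hdm k), freeAction_mul_eq (hdm k) (hT (k + 1) i)]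
    exact congrArg extendOp (LinearMap.ext fun F => h.T_dm h1 h2 F)
  | T_dp_dp k =>
    rw [freeAction_mul_eq (freeAction_mul_eq (hT (k + 2) 1) (hdp (k + 1))) (hdp k),
      freeAction_mul_eq (hdp (k + 1)) (hdp k)]
    exact congrArg extendOp (LinearMap.ext fun F => h.T_dp_dp k F)
  | dp_T k i h1 h2 =>
    rw [freeAction_mul_eq (hdp k) (hT k i), freeAction_mul_eq (hT (k + 1) (i + 1)) (hdp k)]
    exact congrArg extendOp (LinearMap.ext fun F => h.dp_T h1 h2 F)
  | dm_comm k hk =>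
    obtain ⟨k, rfl⟩ : ∃ m, k = m + 2 := ⟨k - 2, by omega⟩
    refine (freeAction_mul_eq (freeAction_mul_eq (hdm (k + 1)) (hc (k + 1)))
      (hT (k + 2) (k + 1))).trans (Eq.trans ?_
      (freeAction_smul_eq Q (freeAction_mul_eq (hc k) (hdm (k + 1)))).symm)
    exact congrArg extendOp (LinearMap.ext fun F => h.dm_comm k F)
  | comm_dp k hk =>
    obtain ⟨k, rfl⟩ : ∃ m, k = m + 1 := ⟨k - 1, by omega⟩
    refine (freeAction_mul_eq (freeAction_mul_eq (hT (k + 2) 1) (hc (k + 1)))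
      (hdp (k + 1))).trans (Eq.trans ?_
      (freeAction_smul_eq Q (freeAction_mul_eq (hdp (k + 1)) (hc k))).symm)
    exact congrArg extendOp (LinearMap.ext fun F => h.comm_dp k F)

theorem freeAction_yl (k i : ℕ) : freeAction (yl (k + 1) (i + 1)) = extendOp (opY k (i + 1)) :=
  freeAction_yLoop dyckOps_plus freeAction_dp freeAction_T freeAction_Tinv k i

theorem freeAction_zl (k i : ℕ) : freeAction (zl (k + 1) (i + 1)) = extendOp (opZ k (i + 1)) :=
  freeAction_yLoop dyckOps_star freeAction_ds freeAction_Tinv freeAction_T k i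

theorem freeAction_quiverRel {a b : Free} (h : QuiverRel a b) : freeAction a = freeAction b := by
  have he := freeAction_e
  cases h with
  | e_e k =>
    rw [freeAction_mul_eq (he k) (he k), he]
    rfl
  | e_e_ne k l h =>
    rw [map_mul, map_zero, he, he]
    exact extendOp_mul_of_ne h.symm _ _
  | e_dp k =>
    rw [freeAction_mul_eq (he (k + 1)) (freeAction_dp k), freeAction_dp]
    rfl
  | dp_e k =>
    rw [freeAction_mul_eq (freeAction_dp k) (he k), freeAction_dp]
    rfl
  | e_ds k =>
    rw [freeAction_mul_eq (he (k + 1)) (freeAction_ds k), freeAction_ds]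
    rfl
  | ds_e k =>
    rw [freeAction_mul_eq (freeAction_ds k) (he k), freeAction_ds]
    rfl
  | e_dm k =>
    rw [freeAction_mul_eq (he k) (freeAction_dm k), freeAction_dm]
    rfl
  | dm_e k =>
    rw [freeAction_mul_eq (freeAction_dm k) (he (k + 1)), freeAction_dm]
    rfl
  | e_T k i h1 h2 =>
    rw [freeAction_mul_eq (he k) (freeAction_T k i), freeAction_T]
    rfl
  | T_e k i h1 h2 =>
    rw [freeAction_mul_eq (freeAction_T k i) (he k), freeAction_T]
    rfl
  | dyck h => exact freeAction_dyckRel dyckOps_plus freeAction_dp freeAction_T h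
  | dyckStar h => exact freeAction_dyckRel dyckOps_star freeAction_ds freeAction_Tinv h
  | dp_z k i h1 h2 =>
    obtain ⟨i, rfl⟩ : ∃ m, i = m + 1 := ⟨i - 1, by omega⟩
    obtain ⟨k, rfl⟩ : ∃ m, k = m + 1 := ⟨k - 1, by omega⟩
    rw [freeAction_mul_eq (freeAction_dp (k + 1)) (freeAction_zl k i),
      freeAction_mul_eq (freeAction_zl (k + 1) (i + 1)) (freeAction_dp (k + 1))]
    exact congrArg extendOp (LinearMap.ext fun F => opDPlus_opZ (by omega) F)
  | ds_y k i h1 h2 =>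
    obtain ⟨i, rfl⟩ : ∃ m, i = m + 1 := ⟨i - 1, by omega⟩
    obtain ⟨k, rfl⟩ : ∃ m, k = m + 1 := ⟨k - 1, by omega⟩
    rw [freeAction_mul_eq (freeAction_ds (k + 1)) (freeAction_yl k i),
      freeAction_mul_eq (freeAction_yl (k + 1) (i + 1)) (freeAction_ds (k + 1))]
    refine congrArg extendOp (LinearMap.ext fun F => ?_)
    rw [LinearMap.comp_apply, LinearMap.comp_apply, opY_apply (by omega), opY_apply (by omega),
      opDPlusStar_eq, opDPlusStar_eq, map_mul, dStar_y]
    rfl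
  | z_dp k =>
    rw [freeAction_mul_eq (freeAction_zl k 0) (freeAction_dp k),
      freeAction_smul_eq _ (freeAction_mul_eq (freeAction_yl k 0) (freeAction_ds k))]
    refine congrArg extendOp (LinearMap.ext fun F => ?_)
    have h := opY_apply (k := k) (i := 0) (by omega) (dStar k F)
    refine (opZ_opDPlus k F).trans ?_
    rw [LinearMap.smul_apply, LinearMap.comp_apply, opDPlusStar_eq, h]
    rfl

end

/-- The action of `𝔸_{q,t}` on `V_*`. -/
def action : Aqt →ₐ[K] Module.End K VStar :=
  RingQuot.liftAlgHom K ⟨freeAction, fun _ _ h => freeAction_quiverRel h⟩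

theorem action_toAqt (a : Free) : action (toAqt a) = freeAction a :=
  RingQuot.liftAlgHom_mkAlgHom_apply _ _ _ _

theorem action_gen (g : Gen) : action (gen g) = op g := by
  rw [gen, action_toAqt, freeAction_ι]

end

section

/-! ### Consequences of the relations of the Dyck path algebra -/

namespace IsBraid

variable {G : Type*} [Monoid G] {k : ℕ} {t : ℕ → G}

theorem down_succ' (t : ℕ → G) (j : ℕ) :
    down t (j + 1) = down (fun n => t (n + 1)) j * t 1 := by
  induction j with
  | zero => simp [down]
  | succ j ih =>
    have h : ∀ (s : ℕ → G) (n : ℕ), down s (n + 1) = s (n + 1) * down s n := fun _ _ => rfl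
    rw [h t, ih, h, mul_assoc]

theorem op (h : IsBraid k t) : IsBraid k fun i => MulOpposite.op (t i) where
  braid i h1 h2 := by
    have := congrArg MulOpposite.op (h.braid i h1 h2)
    simpa only [MulOpposite.op_mul, mul_assoc] using this
  far i j h1 h2 h3 := by
    have := congrArg MulOpposite.op (h.far i j h1 h2 h3)
    simpa only [MulOpposite.op_mul] using this.symm

theorem op_down (t : ℕ → G) (j : ℕ) :
    MulOpposite.op (down t j) = up (fun i => MulOpposite.op (t i)) j := by
  induction j with
  | zero => rfl
  | succ j ih => rw [up_succ, ← ih]; rfl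

theorem down_mul (h : IsBraid k t) {j i : ℕ} (hi : 1 ≤ i) (hij : i < j) (hj : j < k) :
    down t j * t (i + 1) = t i * down t j := by
  apply MulOpposite.op_injective
  rw [MulOpposite.op_mul, MulOpposite.op_mul, op_down]
  exact (h.op.up_mul hi hij hj).symm

end IsBraid

theorem commute_down {G : Type*} [Monoid G] {t : ℕ → G} {a : G} {j : ℕ}
    (h : ∀ i, 1 ≤ i → i ≤ j → Commute a (t i)) : Commute a (down t j) := by
  induction j with
  | zero => exact Commute.one_right a
  | succ j ih =>
    exact (h (j + 1) (by omega) le_rfl).mul_right (ih fun i h1 h2 => h i h1 (by omega))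

theorem commute_up {G : Type*} [Monoid G] {t : ℕ → G} {a : G} {j : ℕ}
    (h : ∀ i, 1 ≤ i → i ≤ j → Commute a (t i)) : Commute a (up t j) := by
  induction j with
  | zero => exact Commute.one_right a
  | succ j ih =>
    exact (ih fun i h1 h2 => h i h1 (by omega)).mul_right (h (j + 1) (by omega) le_rfl)

theorem semiconjBy_up {G : Type*} [Monoid G] {s t : ℕ → G} {a : G} {j : ℕ}
    (h : ∀ i, 1 ≤ i → i ≤ j → SemiconjBy a (s i) (t i)) : SemiconjBy a (up s j) (up t j) := by
  induction j with
  | zero => exact SemiconjBy.one_right a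
  | succ j ih =>
    exact (ih fun i h1 h2 => h i h1 (by omega)).mul_right (h (j + 1) (by omega) le_rfl)

theorem semiconjBy_down {G : Type*} [Monoid G] {s t : ℕ → G} {a : G} {j : ℕ}
    (h : ∀ i, 1 ≤ i → i ≤ j → SemiconjBy a (s i) (t i)) :
    SemiconjBy a (down s j) (down t j) := by
  induction j with
  | zero => exact SemiconjBy.one_right a
  | succ j ih =>
    exact (h (j + 1) (by omega) le_rfl).mul_right (ih fun i h1 h2 => h i h1 (by omega))

theorem coe_up {G : Type*} [Monoid G] (t : ℕ → Gˣ) (j : ℕ) :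
    ((up t j : Gˣ) : G) = up (fun i => (t i : G)) j := by
  induction j with
  | zero => rfl
  | succ j ih => rw [up_succ, up_succ, Units.val_mul, ih]

theorem coe_down {G : Type*} [Monoid G] (t : ℕ → Gˣ) (j : ℕ) :
    ((down t j : Gˣ) : G) = down (fun i => (t i : G)) j := by
  induction j with
  | zero => rfl
  | succ j ih => rw [down, down, Units.val_mul, ih]

/-- The commutator `d_+ d_- - d_- d_+` at the vertex `k + 1`. -/
def ringComm {A : Type*} [Ring A] (dm dp : ℕ → A) (k : ℕ) : A :=
  dp k * dm k - dm (k + 1) * dp (k + 1)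

/-- The relations of the Dyck path algebra in a unital ring in which the `T_i` are units. The
quadratic relation is written as `T = q T⁻¹ + 1 - q`, and `dp k`, `dm k` are the arrows between the
vertices `k` and `k + 1`. -/
structure DyckRing {A : Type*} [Ring A] [Algebra K A] (T : ℕ → ℕ → Aˣ) (dm dp : ℕ → A) :
    Prop where
  quad (k i : ℕ) (h1 : 1 ≤ i) (h2 : i < k) :
    (T k i : A) = q • (((T k i)⁻¹ : Aˣ) : A) + (1 - q) • (1 : A)
  braid (k : ℕ) : IsBraid k (T k)
  dm_dm_T (k : ℕ) : dm k * dm (k + 1) * T (k + 2) (k + 1) = dm k * dm (k + 1)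
  dm_T (k i : ℕ) (h1 : 1 ≤ i) (h2 : i < k) : SemiconjBy (dm k) (T (k + 1) i : A) (T k i : A)
  T_dp_dp (k : ℕ) : T (k + 2) 1 * (dp (k + 1) * dp k) = dp (k + 1) * dp k
  dp_T (k i : ℕ) (h1 : 1 ≤ i) (h2 : i < k) :
    SemiconjBy (dp k) (T k i : A) (T (k + 1) (i + 1) : A)
  dm_comm (k : ℕ) : dm (k + 1) * ringComm dm dp (k + 1) * T (k + 2) (k + 1) =
    q • (ringComm dm dp k * dm (k + 1))
  comm_dp (k : ℕ) : T (k + 2) 1 * ringComm dm dp (k + 1) * dp (k + 1) =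
    q • (dp (k + 1) * ringComm dm dp k)

/-- The loops `y_i`, `i ≥ 1`, at the vertex `k + 1`; the index `0` carries a junk value. -/
def ringY {A : Type*} [Ring A] [Algebra K A] (T : ℕ → ℕ → Aˣ) (dm dp : ℕ → A) (k : ℕ) : ℕ → A
  | 0 => 0
  | 1 => (q ^ k * (q - 1))⁻¹ • (ringComm dm dp k * ((down (T (k + 1)) k : Aˣ) : A))
  | i + 2 => q • ((((T (k + 1) (i + 1))⁻¹ : Aˣ) : A) * ringY T dm dp k (i + 1) *
      (((T (k + 1) (i + 1))⁻¹ : Aˣ) : A))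

theorem semiconjBy_smul {A : Type*} [Ring A] [Algebra K A] {a x z : A} (c : K)
    (h : SemiconjBy a x z) : SemiconjBy a (c • x) (c • z) := by
  rw [SemiconjBy, mul_smul_comm, h.eq, smul_mul_assoc]

namespace DyckRing

variable {A : Type*} [Ring A] [Algebra K A] {T : ℕ → ℕ → Aˣ} {dm dp : ℕ → A}
  (h : DyckRing T dm dp)

local notation "Y" => ringY T dm dp
local notation "cc" => ringComm dm dp

theorem Y_succ (k i : ℕ) : Y k (i + 2) = q • ((((T (k + 1) (i + 1))⁻¹ : Aˣ) : A) * Y k (i + 1) *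
      (((T (k + 1) (i + 1))⁻¹ : Aˣ) : A)) := rfl

theorem Y_one (k : ℕ) :
    Y k 1 = (q ^ k * (q - 1))⁻¹ • (cc k * ((down (T (k + 1)) k : Aˣ) : A)) := rfl

theorem coeff_ne_zero (k : ℕ) : q ^ k * (q - 1) ≠ 0 :=
  mul_ne_zero (pow_ne_zero _ q_ne_zero) q_sub_one_ne_zero

theorem comm_mul_down (k : ℕ) :
    cc k * ((down (T (k + 1)) k : Aˣ) : A) = (q ^ k * (q - 1)) • Y k 1 := by
  rw [Y_one, smul_inv_smul₀ (coeff_ne_zero k)]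

include h

theorem comm_T {k i : ℕ} (h1 : 1 ≤ i) (h2 : i < k) :
    SemiconjBy (cc k) (T (k + 1) i : A) (T (k + 1) (i + 1) : A) := by
  rw [ringComm]
  exact ((h.dp_T k i h1 h2).mul_left (h.dm_T k i h1 h2)).sub_left
    ((h.dm_T (k + 1) (i + 1) (by omega) (by omega)).mul_left
      (h.dp_T (k + 1) i h1 (by omega)))

theorem commute_Y_one_T {k j : ℕ} (h1 : 2 ≤ j) (h2 : j ≤ k) :
    Commute (Y k 1) (T (k + 1) j : A) := by
  obtain ⟨j, rfl⟩ : ∃ i, j = i + 1 := ⟨j - 1, by omega⟩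
  rw [Y_one]
  apply Commute.smul_left
  have e := congrArg Units.val
    ((h.braid (k + 1)).down_mul (j := k) (i := j) (by omega) (by omega) (by omega))
  rw [Units.val_mul, Units.val_mul] at e
  exact (h.comm_T (by omega) (by omega)).mul_left e

theorem dm_Y_one (k : ℕ) : SemiconjBy (dm (k + 1)) (Y (k + 1) 1) (Y k 1) := by
  have e : SemiconjBy (dm (k + 1)) ((down (T (k + 2)) k : Aˣ) : A)
      ((down (T (k + 1)) k : Aˣ) : A) := by
    rw [coe_down, coe_down]
    exact semiconjBy_down fun i h1 h2 => h.dm_T (k + 1) i h1 (by omega)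
  have e2 : dm (k + 1) * (cc (k + 1) * ((down (T (k + 2)) (k + 1) : Aˣ) : A)) =
      q • (cc k * ((down (T (k + 1)) k : Aˣ) : A) * dm (k + 1)) := by
    rw [down, Units.val_mul, ← mul_assoc, ← mul_assoc, h.dm_comm, smul_mul_assoc, mul_assoc, e.eq,
      mul_assoc]
  rw [comm_mul_down, comm_mul_down, mul_smul_comm, smul_mul_assoc, smul_smul, pow_succ',
    mul_assoc] at e2
  exact smul_right_injective A (mul_ne_zero q_ne_zero (coeff_ne_zero k)) e2

theorem dp_Y_one (k : ℕ) : SemiconjBy (dp (k + 1)) (Y k 1)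
    (T (k + 2) 1 * Y (k + 1) 1 * (((T (k + 2) 1)⁻¹ : Aˣ) : A)) := by
  have e : SemiconjBy (dp (k + 1)) ((down (T (k + 1)) k : Aˣ) : A)
      ((down (fun n => T (k + 2) (n + 1)) k : Aˣ) : A) := by
    rw [coe_down, coe_down]
    exact semiconjBy_down fun i h1 h2 => h.dp_T (k + 1) i h1 (by omega)
  have e2 : T (k + 2) 1 * (cc (k + 1) * ((down (T (k + 2)) (k + 1) : Aˣ) : A)) *
      (((T (k + 2) 1)⁻¹ : Aˣ) : A) * dp (k + 1) =
      q • (dp (k + 1) * (cc k * ((down (T (k + 1)) k : Aˣ) : A))) := by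
    rw [IsBraid.down_succ', Units.val_mul, mul_assoc (T (k + 2) 1 : A), mul_assoc (cc (k + 1)),
      Units.mul_inv_cancel_right, mul_assoc, mul_assoc, ← e.eq, ← mul_assoc, ← mul_assoc,
      h.comm_dp, smul_mul_assoc, mul_assoc]
  rw [comm_mul_down, comm_mul_down, mul_smul_comm, mul_smul_comm, smul_mul_assoc, smul_mul_assoc,
    smul_smul, pow_succ', mul_assoc q] at e2
  exact (smul_right_injective A (mul_ne_zero q_ne_zero (coeff_ne_zero k)) e2).symm

/-- The commutator `d_+ d_- - d_- d_+` carries `y_1` to `T_1 y_1 T_1⁻¹`, and it is a multiple of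
`y_1 T_1⁻¹ T_2⁻¹ ⋯`, whose tail `T_2⁻¹ ⋯` commutes with `y_1`. -/
theorem commute_Y_one_Y_two (k : ℕ) : Commute (Y (k + 1) 1) (Y (k + 1) 2) := by
  set z : ℕ → A := fun k => T (k + 2) 1 * Y (k + 1) 1 * (((T (k + 2) 1)⁻¹ : Aˣ) : A)
  have hz : SemiconjBy (dm (k + 2)) (z (k + 1)) (z k) := by
    have h1 := h.dm_T (k + 2) 1 le_rfl (by omega)
    exact (h1.mul_right (h.dm_Y_one (k + 1))).mul_right h1.units_inv_right
  have hc : SemiconjBy (cc (k + 1)) (Y (k + 1) 1) (z k) :=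
    ((h.dp_Y_one k).mul_left (h.dm_Y_one k)).sub_left (hz.mul_left (h.dp_Y_one (k + 1)))
  set t1 := T (k + 2) 1
  set D : Aˣ := down (fun n => T (k + 2) (n + 1)) k
  have hD : Commute (Y (k + 1) 1) (D : A) := by
    rw [coe_down]
    exact commute_down fun i h1 h2 => h.commute_Y_one_T (by omega) (by omega)
  have hd : (down (T (k + 2)) (k + 1) : Aˣ) = D * t1 := IsBraid.down_succ' _ _
  have e := comm_mul_down (T := T) (dm := dm) (dp := dp) (k + 1)
  rw [hd, Units.val_mul] at e
  have hcc : cc (k + 1) = (q ^ (k + 1) * (q - 1)) •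
      (Y (k + 1) 1 * ((t1⁻¹ : Aˣ) : A) * ((D⁻¹ : Aˣ) : A)) := by
    rw [← smul_mul_assoc, ← smul_mul_assoc, ← e, mul_assoc, mul_assoc, mul_assoc,
      Units.mul_inv_cancel_left, Units.mul_inv, mul_one]
  rw [hcc, SemiconjBy, mul_smul_comm, smul_mul_assoc] at hc
  have e2 := smul_right_injective A (coeff_ne_zero (k + 1)) hc
  simp only [z] at e2
  have hD' : ((D⁻¹ : Aˣ) : A) * Y (k + 1) 1 = Y (k + 1) 1 * ((D⁻¹ : Aˣ) : A) :=
    hD.units_inv_right.eq.symm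
  rw [mul_assoc _ _ (Y (k + 1) 1), hD', ← mul_assoc, ← mul_assoc, ← mul_assoc] at e2
  have e3 := congrArg (fun x => ((t1⁻¹ : Aˣ) : A) * (x * D) ) e2
  simp only [Units.inv_mul_cancel_right] at e3
  rw [mul_assoc, mul_assoc, mul_assoc, mul_assoc, Units.inv_mul_cancel_left] at e3
  rw [Y_succ]
  apply Commute.smul_right
  change _ * (_ * _ * _) = (_ * _ * _) * _
  simp only [mul_assoc] at e3 ⊢
  exact e3.symm

end DyckRing

end

section

/-! ### Commutation of the loops `y_i` -/

/-- An element commuting with `b` is turned by the two conjugations defining `y_{i+2}` from `y_i`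
into one commuting with `a`, because `a` becomes `b` on passing through `b⁻¹ a⁻¹`. -/
theorem commute_braid_conj {A : Type*} [Ring A] [Algebra K A] {a b : Aˣ} {x : A}
    (hab : a * b * a = b * a * b) (hx : Commute x b) :
    Commute (q • (((b⁻¹ : Aˣ) : A) * (q • (((a⁻¹ : Aˣ) : A) * x * ((a⁻¹ : Aˣ) : A))) *
      ((b⁻¹ : Aˣ) : A))) (a : A) := by
  have h1 : a * (b⁻¹ * a⁻¹) = b⁻¹ * a⁻¹ * b := by
    have : a * b * a⁻¹ = b⁻¹ * a * b := by
      rw [mul_inv_eq_iff_eq_mul, mul_assoc, mul_assoc, eq_inv_mul_iff_mul_eq, ← mul_assoc,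
        ← mul_assoc, ← hab, mul_assoc]
    simpa [mul_assoc] using congrArg (·⁻¹) this
  have h2 : b * (a⁻¹ * b⁻¹) = a⁻¹ * b⁻¹ * a := by
    have : b * a * b⁻¹ = a⁻¹ * b * a := by
      rw [mul_inv_eq_iff_eq_mul, mul_assoc, mul_assoc, eq_inv_mul_iff_mul_eq, ← mul_assoc,
        ← mul_assoc, hab, mul_assoc]
    simpa [mul_assoc] using congrArg (·⁻¹) this
  apply Commute.symm
  rw [mul_smul_comm, smul_mul_assoc]
  apply Commute.smul_right
  apply Commute.smul_right
  have h1' := congrArg Units.val h1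
  have h2' := congrArg Units.val h2
  simp only [Units.val_mul] at h1' h2'
  have e : ((b⁻¹ : Aˣ) : A) * (((a⁻¹ : Aˣ) : A) * x * ((a⁻¹ : Aˣ) : A)) * ((b⁻¹ : Aˣ) : A) =
      ((b⁻¹ : Aˣ) : A) * ((a⁻¹ : Aˣ) : A) * (x * (((a⁻¹ : Aˣ) : A) * ((b⁻¹ : Aˣ) : A))) := by
    simp only [mul_assoc]
  rw [e, Commute, SemiconjBy, ← mul_assoc, h1', mul_assoc, ← mul_assoc (b : A), ← hx.eq,
    mul_assoc x, h2']
  simp only [mul_assoc]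

namespace DyckRing

variable {A : Type*} [Ring A] [Algebra K A] {T : ℕ → ℕ → Aˣ} {dm dp : ℕ → A}
  (h : DyckRing T dm dp)

local notation "Y" => ringY T dm dp
local notation "cc" => ringComm dm dp

include h

theorem commute_Y_T {k i j : ℕ} (hi : 1 ≤ i) (hi' : i ≤ k + 1) (hj : 1 ≤ j) (hj' : j ≤ k)
    (h1 : j ≠ i) (h2 : j + 1 ≠ i) : Commute (Y k i) (T (k + 1) j : A) := by
  induction i using Nat.strong_induction_on generalizing j with
  | _ i ih =>
    match i, hi with
    | 1, _ => exact h.commute_Y_one_T (by omega) hj'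
    | i + 2, _ =>
      by_cases hji : j = i
      · subst hji
        obtain ⟨j, rfl⟩ : ∃ j', j = j' + 1 := ⟨j - 1, by omega⟩
        rw [Y_succ, Y_succ]
        exact commute_braid_conj ((h.braid (k + 1)).braid (j + 1) (by omega) (by omega))
          (ih (j + 1) (by omega) (by omega) (by omega) (by omega) (by omega) (by omega) (by omega))
      · rw [Y_succ]
        apply Commute.smul_left
        have e1 : Commute (T (k + 1) (i + 1)) (T (k + 1) j) :=
          (h.braid (k + 1)).commute_far (by omega) (by omega) hj (by omega) (by omega)
        have e2 : Commute (((T (k + 1) (i + 1))⁻¹ : Aˣ) : A) (T (k + 1) j : A) :=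
          congrArg Units.val e1.inv_left.eq
        exact (e2.mul_left (ih (i + 1) (by omega) (by omega) (by omega) hj (by omega) (by omega)
          (by omega))).mul_left e2

theorem commute_Y_one {k j : ℕ} (hj : 1 ≤ j) (hj' : j ≤ k + 1) : Commute (Y k 1) (Y k j) := by
  induction j, hj using Nat.le_induction with
  | base => exact Commute.refl _
  | succ j hj ih =>
    obtain ⟨j, rfl⟩ : ∃ j', j = j' + 1 := ⟨j - 1, by omega⟩
    match j with
    | 0 =>
      obtain ⟨k, rfl⟩ : ∃ k', k = k' + 1 := ⟨k - 1, by omega⟩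
      exact h.commute_Y_one_Y_two k
    | j + 1 =>
      rw [Y_succ]
      have e : Commute (Y k 1) (((T (k + 1) (j + 2))⁻¹ : Aˣ) : A) :=
        (h.commute_Y_one_T (by omega) (by omega)).units_inv_right
      exact Commute.smul_right ((e.mul_right (ih (by omega))).mul_right e) _

theorem commute_Y {k i j : ℕ} (hi : 1 ≤ i) (hi' : i ≤ k + 1) (hj : 1 ≤ j) (hj' : j ≤ k + 1) :
    Commute (Y k i) (Y k j) := by
  wlog hij : i ≤ j generalizing i j
  · exact (this hj hj' hi hi' (by omega)).symm
  rcases hij.eq_or_lt with rfl | hij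
  · exact Commute.refl _
  clear hi'
  induction i, hi using Nat.le_induction with
  | base => exact h.commute_Y_one hj hj'
  | succ i hi ih =>
    obtain ⟨i, rfl⟩ : ∃ i', i = i' + 1 := ⟨i - 1, by omega⟩
    rw [Y_succ]
    have e : Commute (((T (k + 1) (i + 1))⁻¹ : Aˣ) : A) (Y k j) :=
      (h.commute_Y_T hj hj' (by omega) (by omega) (by omega) (by omega)).units_inv_right.symm
    exact Commute.smul_left ((e.mul_left (ih (by omega) (by omega))).mul_left e) _

theorem dm_Y {k i : ℕ} (hi : 1 ≤ i) (hi' : i ≤ k + 1) :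
    SemiconjBy (dm (k + 1)) (Y (k + 1) i) (Y k i) := by
  induction i, hi using Nat.le_induction with
  | base => exact h.dm_Y_one k
  | succ i hi ih =>
    obtain ⟨i, rfl⟩ : ∃ i', i = i' + 1 := ⟨i - 1, by omega⟩
    rw [Y_succ, Y_succ]
    have e := (h.dm_T (k + 1) (i + 1) (by omega) (by omega)).units_inv_right
    exact semiconjBy_smul _ ((e.mul_right (ih (by omega))).mul_right e)

theorem Tinv_eq {k i : ℕ} (h1 : 1 ≤ i) (h2 : i < k) :
    (((T k i)⁻¹ : Aˣ) : A) = q⁻¹ • ((T k i : A) + (q - 1) • (1 : A)) := by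
  rw [eq_inv_smul_iff₀ q_ne_zero, h.quad k i h1 h2, add_assoc, ← add_smul, sub_add_sub_cancel',
    sub_self, zero_smul, add_zero]

theorem T_mul_Y_succ {k i : ℕ} (h1 : 1 ≤ i) (h2 : i ≤ k) :
    (T (k + 1) i : A) * Y k (i + 1) = Y k i * T (k + 1) i + (q - 1) • Y k i := by
  obtain ⟨i, rfl⟩ : ∃ i', i = i' + 1 := ⟨i - 1, by omega⟩
  rw [Y_succ, mul_smul_comm, ← mul_assoc, Units.mul_inv_cancel_left, h.Tinv_eq h1 (by omega),
    mul_smul_comm, smul_inv_smul₀ q_ne_zero, mul_add, mul_smul_comm, mul_one]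

theorem T_mul_Y_self {k i : ℕ} (h1 : 1 ≤ i) (h2 : i ≤ k) :
    (T (k + 1) i : A) * Y k i = Y k (i + 1) * T (k + 1) i - (q - 1) • Y k i := by
  obtain ⟨i, rfl⟩ : ∃ i', i = i' + 1 := ⟨i - 1, by omega⟩
  rw [Y_succ, smul_mul_assoc, Units.inv_mul_cancel_right, h.Tinv_eq h1 (by omega),
    smul_mul_assoc, smul_inv_smul₀ q_ne_zero, add_mul, smul_mul_assoc, one_mul,
    add_sub_cancel_right]

end DyckRing

end

section

/-! ### The elements `S = -(T_1 ⋯ T_k)⁻¹ d_+` and `E_n` -/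

/-- The element `-(T_1 ⋯ T_k)⁻¹ d_+`. On `V_k` it is `F ↦ y_{k+1} F[X + (q-1) y_{k+1}]`. -/
def ringS {A : Type*} [Ring A] (T : ℕ → ℕ → Aˣ) (dp : ℕ → A) (k : ℕ) : A :=
  -((((up (T (k + 1)) k)⁻¹ : Aˣ) : A) * dp k)

/-- The elements `1` and `d_- y_{k+1}^{n-1} (-(T_1 ⋯ T_k)⁻¹ d_+)` for `n ≥ 1`. On `V_k` they are
multiplication by the coefficients of `exp (-∑ p_n w^n / n)`. -/
def ringE {A : Type*} [Ring A] [Algebra K A] (T : ℕ → ℕ → Aˣ) (dm dp : ℕ → A) (k : ℕ) : ℕ → A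
  | 0 => 1
  | n + 1 => dm k * (ringY T dm dp k (k + 1) ^ n * ringS T dp k)

/-- Relations in the affine Hecke algebra between `T_i`, `y_i`, `y_{i+1}`, together with a left
annihilator `D` of `T_i - 1`. The letters `a`, `b` stand for `y_i`, `y_{i+1}`. -/
structure HeckePair {A : Type*} [Ring A] [Algebra K A] (T a b D : A) : Prop where
  T_mul_b : T * b = a * T + (q - 1) • a
  T_mul_a : T * a = b * T - (q - 1) • a
  comm : Commute a b
  D_mul_T : D * T = D

namespace HeckePair

variable {A : Type*} [Ring A] [Algebra K A] {T a b D : A} (h : HeckePair T a b D)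
include h

/-- The intertwiner `T y_i - y_i T` exchanges `y_i` and `y_{i+1}`. -/
theorem semiconjBy_a : SemiconjBy (T * a - a * T) a b := by
  have h1 : T * a * a = b * b * T - (q - 1) • (b * a) - (q - 1) • (a * a) := by
    rw [h.T_mul_a, sub_mul, mul_assoc, h.T_mul_a, mul_sub, mul_assoc, smul_mul_assoc,
      mul_smul_comm]
  have h2 : a * T * a = a * b * T - (q - 1) • (a * a) := by
    rw [mul_assoc, h.T_mul_a, mul_sub, mul_smul_comm, mul_assoc]
  have h3 : b * (T * a) = b * b * T - (q - 1) • (b * a) := by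
    rw [h.T_mul_a, mul_sub, mul_smul_comm, mul_assoc]
  rw [SemiconjBy, sub_mul, mul_sub, h1, h2, h3, ← mul_assoc, h.comm.eq]
  abel

theorem semiconjBy_b : SemiconjBy (T * a - a * T) b a := by
  have h1 : T * a * b = a * (T * a) + (q - 1) • (a * a) := by
    rw [mul_assoc, h.comm.eq, ← mul_assoc, h.T_mul_b, add_mul, smul_mul_assoc, mul_assoc]
  have h2 : a * T * b = a * a * T + (q - 1) • (a * a) := by
    rw [mul_assoc, h.T_mul_b, mul_add, mul_smul_comm, mul_assoc]
  rw [SemiconjBy, sub_mul, mul_sub, h1, h2, mul_assoc]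
  abel

theorem D_mul_sub : D * (b - q • a) = D * (a * T - T * a) := by
  have h1 : D * (T * b) = D * b := by rw [← mul_assoc, h.D_mul_T]
  have h2 : D * (T * a) = D * a := by rw [← mul_assoc, h.D_mul_T]
  have h3 : D * (a * T) = D * b - (q - 1) • (D * a) := by
    rw [← h1, h.T_mul_b, mul_add, mul_smul_comm, add_sub_cancel_right]
  rw [mul_sub, mul_sub, h2, h3, mul_smul_comm, sub_smul, one_smul]
  abel

theorem D_mul_sub_mul_pow (m : ℕ) :
    D * ((b - q • a) * b ^ m) = D * (a ^ m * (a * T - T * a)) := by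
  rw [← mul_assoc, h.D_mul_sub, mul_assoc, ← neg_sub (T * a), neg_mul,
    (h.semiconjBy_b.pow_right m).eq, ← mul_neg, neg_sub]

theorem antisymm {x : A} (hx : T * x = x) (m n : ℕ) :
    D * ((b - q • a) * (a ^ m * b ^ n) * x) = -(D * ((b - q • a) * (a ^ n * b ^ m) * x)) := by
  have h1 : (T * a - a * T) * x = (b - q • a) * x := by
    rw [h.T_mul_a, sub_mul, sub_mul, mul_assoc, mul_assoc a, hx, sub_mul, smul_mul_assoc,
      smul_mul_assoc, sub_smul, one_smul]
    abel
  have hc : Commute (b - q • a) (b ^ m * a ^ n) :=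
    (((Commute.refl b).sub_left (h.comm.smul_left q)).pow_right m).mul_right
      ((h.comm.symm.sub_left ((Commute.refl a).smul_left q)).pow_right n)
  calc D * ((b - q • a) * (a ^ m * b ^ n) * x)
      = D * (b - q • a) * (a ^ m * b ^ n) * x := by simp only [mul_assoc]
    _ = -(D * ((T * a - a * T) * (a ^ m * b ^ n) * x)) := by
        rw [h.D_mul_sub, ← neg_sub, mul_neg, neg_mul, neg_mul]; simp only [mul_assoc]
    _ = -(D * (b ^ m * a ^ n * ((T * a - a * T) * x))) := by
        rw [((h.semiconjBy_a.pow_right m).mul_right (h.semiconjBy_b.pow_right n)).eq, mul_assoc]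
    _ = _ := by
        rw [h1, ← mul_assoc (b ^ m * a ^ n), ← hc.eq, (h.comm.pow_pow n m).eq]

/-- `d_-² y_i^m T_i y_i^n x` is symmetric in `m` and `n` when `T_i x = x`. -/
theorem symm {x : A} (hx : T * x = x) (m n : ℕ) :
    D * (a ^ m * (T * (a ^ n * x))) = D * (a ^ n * (T * (a ^ m * x))) := by
  set C : ℕ → ℕ → A := fun m n => D * (a ^ m * (T * (a ^ n * x)))
  have hC : ∀ m n, C m (n + 1) - C (m + 1) n = -(D * ((b - q • a) * (a ^ n * b ^ m) * x)) := by
    intro m n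
    have e := h.D_mul_sub_mul_pow m
    have e2 : C m (n + 1) - C (m + 1) n = D * (a ^ m * (T * a - a * T)) * (a ^ n * x) := by
      simp only [C, pow_succ a m, pow_succ' a n, mul_sub, sub_mul, mul_assoc]
    rw [e2, ← neg_sub (a * T), mul_neg, mul_neg, ← e, neg_mul, (h.comm.pow_pow n m).eq]
    simp only [mul_assoc]
  have hD : ∀ n m, C m n - C n m = C (m + n) 0 - C 0 (m + n) := by
    intro n
    induction n with
    | zero => intro m; rfl
    | succ n ih =>
      intro m
      have h1 := hC m n
      rw [h.antisymm hx n m, neg_neg, ← neg_neg (D * _), ← hC n m] at h1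
      rw [show m + (n + 1) = m + 1 + n by ring, ← ih (m + 1), sub_eq_iff_eq_add.1 h1]
      abel
  have h0 : ∀ N, C N 0 - C 0 N = 0 := by
    intro N
    have h1 := hD N 0
    rw [zero_add, ← neg_sub] at h1
    have h2 : (2 : K) • (C N 0 - C 0 N) = 0 := by
      rw [two_smul, ← eq_neg_iff_add_eq_zero, h1]
    exact (smul_eq_zero_iff_right two_ne_zero).1 h2
  exact sub_eq_zero.1 ((hD n m).trans (h0 _))

end HeckePair

end

section

/-! ### Relations for `S` and `E_n` -/

namespace DyckRing

variable {A : Type*} [Ring A] [Algebra K A] {T : ℕ → ℕ → Aˣ} {dm dp : ℕ → A}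

local notation "Y" => ringY T dm dp
local notation "cc" => ringComm dm dp
local notation "S" => ringS T dp
local notation "E" => ringE T dm dp

theorem Y_eq_conj (k i : ℕ) : Y k (i + 1) = q ^ i • ((((up (T (k + 1)) i)⁻¹ : Aˣ) : A) * Y k 1 *
    (((down (T (k + 1)) i)⁻¹ : Aˣ) : A)) := by
  induction i with
  | zero => simp [up, down]
  | succ i ih =>
    rw [Y_succ, ih, mul_smul_comm, smul_mul_assoc, smul_smul, ← pow_succ', up, down, mul_inv_rev,
      mul_inv_rev, Units.val_mul, Units.val_mul]
    simp only [mul_assoc]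

theorem comm_eq (k : ℕ) :
    cc k = (q - 1) • (((up (T (k + 1)) k : Aˣ) : A) * Y k (k + 1)) := by
  have h1 : cc k = cc k * ((down (T (k + 1)) k : Aˣ) : A) *
      (((down (T (k + 1)) k)⁻¹ : Aˣ) : A) := by rw [Units.mul_inv_cancel_right]
  rw [h1, comm_mul_down, Y_eq_conj k k, mul_smul_comm, smul_smul, ← mul_assoc,
    Units.mul_inv_cancel_left, smul_mul_assoc, mul_comm (q - 1)]

theorem ringE_zero (k : ℕ) : E k 0 = 1 := rfl

theorem ringE_succ (k n : ℕ) : E k (n + 1) = dm k * (Y k (k + 1) ^ n * S k) := rfl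

variable (h : DyckRing T dm dp)
include h

theorem S_T {k i : ℕ} (h1 : 1 ≤ i) (h2 : i < k) :
    SemiconjBy (S k) (T k i : A) (T (k + 1) i : A) := by
  have e : SemiconjBy (up (T (k + 1)) k)⁻¹ (T (k + 1) (i + 1)) (T (k + 1) i) := by
    apply SemiconjBy.inv_symm_left
    exact (h.braid (k + 1)).up_mul h1 h2 (by omega)
  have e2 : SemiconjBy ((((up (T (k + 1)) k)⁻¹ : Aˣ) : A)) (T (k + 1) (i + 1) : A)
      (T (k + 1) i : A) := congrArg Units.val e
  exact (e2.mul_left (h.dp_T k i h1 h2)).neg_left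

theorem S_Y_one (k : ℕ) : SemiconjBy (S (k + 1)) (Y k 1) (Y (k + 1) 1) := by
  apply SemiconjBy.neg_left
  refine SemiconjBy.mul_left ?_ (h.dp_Y_one k)
  have hD : Commute (Y (k + 1) 1) ((up (fun n => T (k + 2) (n + 1)) k : Aˣ) : A) := by
    rw [coe_up]
    exact commute_up fun i h1 h2 => h.commute_Y_one_T (by omega) (by omega)
  rw [IsBraid.up_succ', mul_inv_rev, Units.val_mul]
  refine SemiconjBy.mul_left hD.units_inv_right.symm ?_
  rw [SemiconjBy, mul_assoc, Units.inv_mul_cancel_left]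

theorem S_Y {k i : ℕ} (hi : 1 ≤ i) (hi' : i ≤ k + 1) :
    SemiconjBy (S (k + 1)) (Y k i) (Y (k + 1) i) := by
  induction i, hi using Nat.le_induction with
  | base => exact h.S_Y_one k
  | succ i hi ih =>
    obtain ⟨i, rfl⟩ : ∃ i', i = i' + 1 := ⟨i - 1, by omega⟩
    rw [Y_succ, Y_succ]
    have e := (h.S_T (k := k + 1) (i := i + 1) (by omega) (by omega)).units_inv_right
    exact semiconjBy_smul _ ((e.mul_right (ih (by omega))).mul_right e)

theorem S_dm (k : ℕ) :
    S k * dm k = dm (k + 1) * (T (k + 2) (k + 1) * S (k + 1)) - (q - 1) • Y k (k + 1) := by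
  have e1 : dp k * dm k = cc k + dm (k + 1) * dp (k + 1) := by rw [ringComm, sub_add_cancel]
  have e2 : SemiconjBy (dm (k + 1)) ((up (T (k + 2)) k : Aˣ) : A)
      ((up (T (k + 1)) k : Aˣ) : A) := by
    rw [coe_up, coe_up]
    exact semiconjBy_up fun i h1 h2 => h.dm_T (k + 1) i h1 (by omega)
  rw [ringS, ringS, neg_mul, mul_assoc, e1, mul_add, comm_eq, mul_smul_comm,
    Units.inv_mul_cancel_left, ← mul_assoc _ (dm (k + 1)), ← e2.units_inv_right.eq, up_succ,
    mul_inv_rev, Units.val_mul, mul_neg, mul_neg,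
    mul_assoc (((T (k + 2) (k + 1))⁻¹ : Aˣ) : A), Units.mul_inv_cancel_left, mul_assoc]
  abel

theorem T_S_S (k : ℕ) : T (k + 2) (k + 1) * (S (k + 1) * S k) = S (k + 1) * S k := by
  have e1 : SemiconjBy (dp (k + 1)) ((up (T (k + 1)) k : Aˣ) : A)
      ((up (fun n => T (k + 2) (n + 1)) k : Aˣ) : A) := by
    rw [coe_up, coe_up]
    exact semiconjBy_up fun i h1 h2 => h.dp_T (k + 1) i h1 (by omega)
  have hb := h.braid (k + 2)
  set U := up (T (k + 2)) (k + 1) * up (T (k + 2)) k with hU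
  have e2 : S (k + 1) * S k = ((U⁻¹ : Aˣ) : A) * (dp (k + 1) * dp k) := by
    rw [hU, hb.up_mul_up le_rfl (by omega), mul_inv_rev, Units.val_mul, ringS, ringS, neg_mul_neg,
      mul_assoc, ← mul_assoc (dp (k + 1)), e1.units_inv_right.eq]
    simp only [mul_assoc]
  have e3 : T (k + 2) (k + 1) * U⁻¹ = U⁻¹ * T (k + 2) 1 := by
    rw [mul_inv_eq_iff_eq_mul, mul_assoc, hU, hb.mul_up_mul_up (by omega), ← mul_assoc,
      inv_mul_cancel, one_mul]
  rw [e2, ← mul_assoc, ← Units.val_mul, e3, Units.val_mul, mul_assoc, h.T_dp_dp]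

/-- The two last loops `y` at the vertex `k + 2` with `d_-²`. -/
theorem heckePair (k : ℕ) : HeckePair (T (k + 2) (k + 1) : A) (Y (k + 1) (k + 1))
    (Y (k + 1) (k + 2)) (dm k * dm (k + 1)) where
  T_mul_b := h.T_mul_Y_succ (by omega) le_rfl
  T_mul_a := h.T_mul_Y_self (by omega) le_rfl
  comm := h.commute_Y (by omega) (by omega) (by omega) le_rfl
  D_mul_T := h.dm_dm_T k

theorem commute_E_Y {k i : ℕ} (n : ℕ) (h1 : 1 ≤ i) (h2 : i ≤ k + 1) :
    Commute (E (k + 1) n) (Y k i) := by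
  cases n with
  | zero => exact Commute.one_left _
  | succ n =>
    exact (h.dm_Y h1 h2).mul_left
      (SemiconjBy.mul_left ((h.commute_Y (by omega) le_rfl h1 (by omega)).pow_left n)
        (h.S_Y h1 h2))

/-- The rule for moving `d_-` to the right of `E_{n+1}`. -/
theorem dm_E (k n : ℕ) : dm k * E (k + 1) (n + 1) =
    q • (dm k * (Y k (k + 1) * E (k + 1) n)) + E k (n + 1) * dm k
      - E k n * (dm k * Y k (k + 1)) := by
  have hS := h.S_dm k
  cases n with
  | zero =>
    rw [ringE_zero, ringE_zero, ringE_succ, ringE_succ, pow_zero, pow_zero, one_mul, one_mul,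
      mul_one, one_mul, mul_assoc, hS, mul_sub, mul_smul_comm, ← mul_assoc, ← mul_assoc,
      ← mul_assoc, h.dm_dm_T, sub_smul, one_smul]
    abel
  | succ m =>
    have hp := h.heckePair k
    have e1 := congrArg (· * S (k + 1)) (hp.D_mul_sub_mul_pow m)
    have hdY := h.dm_Y (k := k) (i := k + 1) (by omega) le_rfl
    have hSY := h.S_Y (k := k) (i := k + 1) (by omega) le_rfl
    have e2 : ∀ n, E k (n + 1) * dm k = dm k * dm (k + 1) * (Y (k + 1) (k + 1) ^ n *
        (T (k + 2) (k + 1) * S (k + 1))) - (q - 1) • (dm k * Y k (k + 1) ^ (n + 1)) := by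
      intro n
      rw [ringE_succ, mul_assoc, mul_assoc, hS, mul_sub, mul_sub, ← mul_assoc _ (dm (k + 1)),
        ← (hdY.pow_right n).eq, mul_smul_comm, mul_smul_comm, ← pow_succ]
      simp only [mul_assoc]
    have e3 : dm k * (Y k (k + 1) * E (k + 1) (m + 1)) = dm k * dm (k + 1) *
        (Y (k + 1) (k + 1) * (Y (k + 1) (k + 2) ^ m * S (k + 1))) := by
      rw [ringE_succ, ← mul_assoc (Y k (k + 1)), ← hdY.eq]
      simp only [mul_assoc]
    have e4 : E k (m + 1) * (dm k * Y k (k + 1)) = dm k * dm (k + 1) * (Y (k + 1) (k + 1) ^ m *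
        (T (k + 2) (k + 1) * (Y (k + 1) (k + 1) * S (k + 1)))) -
          (q - 1) • (dm k * Y k (k + 1) ^ (m + 2)) := by
      rw [← mul_assoc, e2, sub_mul, smul_mul_assoc, mul_assoc (dm k) (_ ^ _), ← pow_succ, ← hSY.eq]
      simp only [mul_assoc]
    rw [e2, e3, e4, ringE_succ (k + 1) (m + 1), pow_succ' (Y (k + 1) (k + 1 + 1)),
      ← mul_assoc (dm k)]
    simp only [mul_assoc, sub_mul, mul_sub, smul_mul_assoc, mul_smul_comm] at e1
    rw [sub_eq_iff_eq_add'] at e1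
    simp only [pow_succ _ (m + 1), pow_succ _ m, mul_assoc] at e1 ⊢
    rw [e1]
    abel

theorem commute_E (k m n : ℕ) : Commute (E k m) (E k n) := by
  match m, n with
  | 0, _ => exact Commute.one_left _
  | _, 0 => exact Commute.one_right _
  | m + 1, n + 1 =>
    have hS := h.S_dm k
    have hp := h.heckePair k
    have hdY := h.dm_Y (k := k) (i := k + 1) (by omega) le_rfl
    have hSY := h.S_Y (k := k) (i := k + 1) (by omega) le_rfl
    have e : ∀ m n, E k (m + 1) * E k (n + 1) = dm k * dm (k + 1) * (Y (k + 1) (k + 1) ^ m *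
        (T (k + 2) (k + 1) * (Y (k + 1) (k + 1) ^ n * (S (k + 1) * S k)))) -
        (q - 1) • (dm k * (Y k (k + 1) ^ (m + n + 1) * S k)) := by
      intro m n
      rw [ringE_succ, ringE_succ, mul_assoc, mul_assoc, ← mul_assoc (S k), hS, sub_mul, mul_sub,
        mul_sub, mul_assoc (dm (k + 1)), ← mul_assoc _ (dm (k + 1)), ← (hdY.pow_right m).eq,
        mul_assoc, mul_assoc ((T (k + 2) (k + 1) : Aˣ) : A), ← mul_assoc (S (k + 1)), (hSY.pow_right n).eq,
        smul_mul_assoc, mul_smul_comm,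
        mul_smul_comm, ← mul_assoc (Y k (k + 1)), ← pow_succ', ← mul_assoc (Y k (k + 1) ^ m),
        ← pow_add, ← add_assoc]
      simp only [mul_assoc]
    rw [Commute, SemiconjBy, e, e, hp.symm (h.T_S_S k), add_comm m n]

end DyckRing

end

section

/-! ### Vacuum vectors and the span of the words `d_-^m F(y_1, …, y_{k+m}) v_{k+m}` -/

/-- The relations of the double Dyck path algebra in a unital ring in which the `T_i` are units. -/
structure DoubleDyckRing {A : Type*} [Ring A] [Algebra K A] (T : ℕ → ℕ → Aˣ) (dm dp ds : ℕ → A) :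
    Prop extends DyckRing T dm dp where
  ds_T (k i : ℕ) (h1 : 1 ≤ i) (h2 : i < k) :
    SemiconjBy (ds k) (T k i : A) (T (k + 1) (i + 1) : A)
  T_ds_ds (k : ℕ) : T (k + 2) 1 * (ds (k + 1) * ds k) = ds (k + 1) * ds k
  ds_Y (k i : ℕ) (h1 : 1 ≤ i) (h2 : i ≤ k + 1) :
    SemiconjBy (ds (k + 1)) (ringY T dm dp k i) (ringY T dm dp (k + 1) (i + 1))
  comm_dm (k : ℕ) : ringComm dm ds k * dm (k + 1) =
    q • (dm (k + 1) * (ringComm dm ds (k + 1) * (((T (k + 2) (k + 1))⁻¹ : Aˣ) : A)))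
  comm_S (k : ℕ) : ringComm dm ds k * ringS T dp k =
    (t * (1 - q)) • (ringY T dm dp k 1 * ds k)

/-- Vectors `v_k` with the relations satisfied by `d_+^{*k} ⬝ 1 = 1 ∈ V_k`. -/
structure Vacuum {A : Type*} [Ring A] [Algebra K A] {N : Type*} [AddCommGroup N] [Module A N]
    (T : ℕ → ℕ → Aˣ) (dm dp ds : ℕ → A) (v : ℕ → N) : Prop where
  ds_v (k : ℕ) : ds k • v k = v (k + 1)
  dm_v (k : ℕ) : dm k • v (k + 1) = v k
  dp_v (k : ℕ) : dp k • v k = -((q ^ k • ringY T dm dp k 1) • v (k + 1))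

/-- The scalar bookkeeping in `comm_Y_last`, over an arbitrary field. -/
theorem smul_comm_identity {F M : Type*} [Field F] [AddCommGroup M] [Module F M] (a b : F)
    (x z : M) : a • (b * (1 - a)) • x - (b * (1 - a)) • z =
      (a - 1) • b • (z - x + (1 - a) • x) := by
  module

namespace DoubleDyckRing

variable {A : Type*} [Ring A] [Algebra K A] {T : ℕ → ℕ → Aˣ} {dm dp ds : ℕ → A}

local notation "Y" => ringY T dm dp
local notation "S" => ringS T dp
local notation "E" => ringE T dm dp
local notation "cs" => ringComm dm ds

variable (h : DoubleDyckRing T dm dp ds)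
include h

/-- The commutator of `d_+^*` and `d_-` applied to the last loop `y_{k+1}`, obtained by multiplying
the relation `S_dm` by this commutator. -/
theorem comm_Y_last (k : ℕ) :
    cs k * Y k (k + 1) = t • (Y k 1 * (cs k + (1 - q) • (dm (k + 1) * ds (k + 1)))) := by
  have e1 := congrArg (cs k * ·) (h.S_dm k)
  have e2 := (h.dm_Y (k := k) (i := 1) le_rfl (by omega)).eq
  beta_reduce at e1
  rw [← mul_assoc, h.comm_S, mul_sub (cs k), ← mul_assoc (cs k) (dm (k + 1)), h.comm_dm,
    smul_mul_assoc q, mul_assoc (dm (k + 1)), mul_assoc (cs (k + 1)), Units.inv_mul_cancel_left,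
    h.comm_S,
    mul_smul_comm, mul_smul_comm, ← mul_assoc (dm (k + 1)), e2] at e1
  have e3 : (q - 1) • (cs k * Y k (k + 1)) =
      (q - 1) • (t • (Y k 1 * (cs k + (1 - q) • (dm (k + 1) * ds (k + 1))))) := by
    rw [eq_sub_iff_add_eq, ← eq_sub_iff_add_eq'] at e1
    rw [e1, ringComm]
    simp only [mul_add, mul_sub (Y k 1), mul_smul_comm, smul_mul_assoc, mul_assoc]
    exact smul_comm_identity q t _ _
  exact smul_right_injective A q_sub_one_ne_zero e3

theorem comm_Y {k i : ℕ} (h1 : 1 ≤ i) (h2 : i ≤ k) :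
    SemiconjBy (cs k) (Y k i) (Y k (i + 1)) := by
  obtain ⟨k, rfl⟩ : ∃ k', k = k' + 1 := ⟨k - 1, by omega⟩
  exact ((h.ds_Y k i h1 h2).mul_left (h.dm_Y h1 h2)).sub_left
    ((h.dm_Y (by omega) (by omega)).mul_left (h.ds_Y (k + 1) i h1 (by omega)))

end DoubleDyckRing

section Module

variable {A : Type*} [Ring A] [Algebra K A] {N : Type*} [AddCommGroup N] [Module A N]

theorem smul_smul_algebraMap (c : K) (a : A) (x : N) :
    (c • a) • x = algebraMap K A c • a • x := by rw [Algebra.smul_def, mul_smul]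

theorem smul_algebraMap_smul (c : K) (a : A) (x : N) :
    a • algebraMap K A c • x = algebraMap K A c • a • x := by
  rw [← mul_smul, ← mul_smul, Algebra.commutes]

namespace Vacuum

variable {T : ℕ → ℕ → Aˣ} {dm dp ds : ℕ → A} {v : ℕ → N}

/-- The vectors `F(y_1, …, y_k) v_k` with a polynomial `F`. -/
inductive PolyVec (T : ℕ → ℕ → Aˣ) (dm dp : ℕ → A) (v : ℕ → N) (k : ℕ) : N → Prop
  | vec : PolyVec T dm dp v k (v k)
  | add {x x' : N} : PolyVec T dm dp v k x → PolyVec T dm dp v k x' →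
      PolyVec T dm dp v k (x + x')
  | smul (c : K) {x : N} : PolyVec T dm dp v k x → PolyVec T dm dp v k (algebraMap K A c • x)
  | loop {i : ℕ} (h1 : 1 ≤ i) (h2 : i ≤ k) {x : N} : PolyVec T dm dp v k x →
      PolyVec T dm dp v k (ringY T dm dp (k - 1) i • x)

/-- The vectors `d_-^m F(y_1, …, y_{k+m}) v_{k+m}` with a polynomial `F`. -/
inductive Word (T : ℕ → ℕ → Aˣ) (dm dp : ℕ → A) (v : ℕ → N) : ℕ → ℕ → N → Prop
  | zero {k : ℕ} {x : N} : PolyVec T dm dp v k x → Word T dm dp v 0 k x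
  | succ {m k : ℕ} {x : N} : Word T dm dp v m (k + 1) x → Word T dm dp v (m + 1) k (dm k • x)

/-- The sums of vectors `d_-^m F(y_1, …, y_{k+m}) v_{k+m}` for varying `m`. -/
inductive WordSum (T : ℕ → ℕ → Aˣ) (dm dp : ℕ → A) (v : ℕ → N) (k : ℕ) : N → Prop
  | word {m : ℕ} {x : N} : Word T dm dp v m k x → WordSum T dm dp v k x
  | add {x x' : N} : WordSum T dm dp v k x → WordSum T dm dp v k x' →
      WordSum T dm dp v k (x + x')

local notation "Y" => ringY T dm dp
local notation "S" => ringS T dp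
local notation "E" => ringE T dm dp
local notation "cs" => ringComm dm ds
local notation "Poly" => PolyVec T dm dp v
local notation "Wd" => Word T dm dp v
local notation "Ws" => WordSum T dm dp v

theorem PolyVec.sub {k : ℕ} {x x' : N} (hx : Poly k x) (hx' : Poly k x') : Poly k (x - x') := by
  have := hx.add (hx'.smul (-1))
  rwa [map_neg, map_one, neg_one_smul, ← sub_eq_add_neg] at this

theorem Word.smul {m k : ℕ} (c : K) {x : N} (hx : Wd m k x) : Wd m k (algebraMap K A c • x) := by
  induction hx with
  | zero hx => exact .zero (hx.smul c)
  | succ _ ih => rw [← smul_algebraMap_smul]; exact .succ ih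

theorem WordSum.map {k l : ℕ} {a : A} (ha : ∀ m x, Wd m k x → Ws l (a • x)) {x : N}
    (hx : Ws k x) : Ws l (a • x) := by
  induction hx with
  | word hx => exact ha _ _ hx
  | add _ _ ih ih' => rw [smul_add]; exact ih.add ih'

theorem WordSum.smul {k : ℕ} (c : K) {x : N} (hx : Ws k x) : Ws k (algebraMap K A c • x) :=
  hx.map fun _ _ h => .word (h.smul c)

theorem WordSum.sub {k : ℕ} {x x' : N} (hx : Ws k x) (hx' : Ws k x') : Ws k (x - x') := by
  have := hx.add (hx'.smul (-1))
  rwa [map_neg, map_one, neg_one_smul, ← sub_eq_add_neg] at this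

theorem WordSum.dm_smul {k : ℕ} {x : N} (hx : Ws (k + 1) x) : Ws k (dm k • x) :=
  hx.map fun _ _ h => .word (.succ h)

theorem WordSum.of_poly {k : ℕ} {x : N} (hx : Poly k x) : Ws k x := .word (.zero hx)

variable (h : DoubleDyckRing T dm dp ds) (hv : Vacuum T dm dp ds v)
include h hv

theorem T_v {k i : ℕ} (h1 : 1 ≤ i) (h2 : i < k) : (T k i : A) • v k = v k := by
  induction k generalizing i with
  | zero => omega
  | succ k ih =>
    obtain ⟨i, rfl⟩ : ∃ i', i = i' + 1 := ⟨i - 1, by omega⟩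
    cases i with
    | zero =>
      obtain ⟨k, rfl⟩ : ∃ k', k = k' + 1 := ⟨k - 1, by omega⟩
      rw [← hv.ds_v, ← hv.ds_v, ← mul_smul, ← mul_smul, mul_assoc, h.T_ds_ds, mul_smul]
    | succ i =>
      rw [← hv.ds_v, ← mul_smul, ← (h.ds_T k (i + 1) (by omega) (by omega)).eq, mul_smul,
        ih (by omega) (by omega)]

theorem S_v (k : ℕ) : S k • v k = Y k (k + 1) • v (k + 1) := by
  have hD : ∀ j, j ≤ k → ((down (T (k + 1)) j : Aˣ) : A) • v (k + 1) = v (k + 1) := by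
    intro j hj
    induction j with
    | zero => exact one_smul A _
    | succ j ih =>
      rw [down, Units.val_mul, mul_smul, ih (by omega), hv.T_v h (by omega) (by omega)]
  have hD' : (((down (T (k + 1)) k)⁻¹ : Aˣ) : A) • v (k + 1) = v (k + 1) := by
    nth_rw 1 [← hD k le_rfl]
    rw [← mul_smul, Units.inv_mul, one_smul]
  rw [ringS, neg_smul, mul_smul, hv.dp_v, smul_neg, neg_neg, DyckRing.Y_eq_conj k k,
    smul_smul_algebraMap, smul_smul_algebraMap, smul_algebraMap_smul, mul_smul, hD', mul_smul]

theorem PolyVec.T_smul {k i : ℕ} (h1 : 1 ≤ i) (h2 : i < k) {x : N} (hx : Poly k x) :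
    Poly k ((T k i : A) • x) := by
  induction hx with
  | vec => rw [hv.T_v h h1 h2]; exact .vec
  | add _ _ ih ih' => rw [smul_add]; exact ih.add ih'
  | smul c _ ih => rw [smul_algebraMap_smul]; exact ih.smul c
  | @loop j h3 h4 x hx ih =>
    obtain ⟨k, rfl⟩ : ∃ k', k = k' + 1 := ⟨k - 1, by omega⟩
    rw [← mul_smul, Nat.add_sub_cancel]
    by_cases hij : i = j
    · subst hij
      rw [h.T_mul_Y_self h1 (by omega), sub_smul, smul_smul_algebraMap, mul_smul]
      exact (PolyVec.loop (i := i + 1) (by omega) (by omega) ih).sub ((hx.loop h3 h4).smul _)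
    by_cases hij' : i + 1 = j
    · subst hij'
      rw [h.T_mul_Y_succ h1 (by omega), add_smul, smul_smul_algebraMap, mul_smul]
      exact (PolyVec.loop h1 (by omega) ih).add ((hx.loop h1 (by omega)).smul _)
    · rw [← (h.commute_Y_T h3 h4 h1 (by omega) hij hij').eq, mul_smul]
      exact ih.loop h3 h4

theorem PolyVec.S_smul {k : ℕ} {x : N} (hx : Poly k x) : Poly (k + 1) (S k • x) := by
  induction hx with
  | vec => rw [hv.S_v h]; exact PolyVec.vec.loop (by omega) le_rfl
  | add _ _ ih ih' => rw [smul_add]; exact ih.add ih'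
  | smul c _ ih => rw [smul_algebraMap_smul]; exact ih.smul c
  | @loop j h3 h4 x hx ih =>
    obtain ⟨k, rfl⟩ : ∃ k', k = k' + 1 := ⟨k - 1, by omega⟩
    rw [← mul_smul, Nat.add_sub_cancel, (h.S_Y h3 h4).eq, mul_smul]
    exact ih.loop h3 (by omega)

theorem PolyVec.ds_smul {k : ℕ} {x : N} (hx : Poly k x) : Poly (k + 1) (ds k • x) := by
  induction hx with
  | vec => rw [hv.ds_v]; exact .vec
  | add _ _ ih ih' => rw [smul_add]; exact ih.add ih'
  | smul c _ ih => rw [smul_algebraMap_smul]; exact ih.smul c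
  | @loop j h3 h4 x hx ih =>
    obtain ⟨k, rfl⟩ : ∃ k', k = k' + 1 := ⟨k - 1, by omega⟩
    rw [← mul_smul, Nat.add_sub_cancel, (h.ds_Y k j h3 h4).eq, mul_smul]
    exact PolyVec.loop (i := j + 1) (by omega) (by omega) ih

theorem Word.T_smul {m k i : ℕ} (h1 : 1 ≤ i) (h2 : i < k) {x : N} (hx : Wd m k x) :
    Wd m k ((T k i : A) • x) := by
  induction hx with
  | zero hx => exact .zero (hx.T_smul h hv h1 h2)
  | @succ m k x hx ih =>
    rw [← mul_smul, ← (h.dm_T k i h1 h2).eq, mul_smul]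
    exact .succ (ih (by omega))

theorem Word.Tinv_smul {m k i : ℕ} (h1 : 1 ≤ i) (h2 : i < k) {x : N} (hx : Wd m k x) :
    Wd m k ((((T k i)⁻¹ : Aˣ) : A) • x) := by
  induction hx with
  | @zero k x hx =>
    rw [h.Tinv_eq h1 h2, smul_smul_algebraMap, add_smul, smul_smul_algebraMap, one_smul]
    exact .zero (((hx.T_smul h hv h1 h2).add (hx.smul _)).smul _)
  | @succ m k x hx ih =>
    rw [← mul_smul, ← (h.dm_T k i h1 h2).units_inv_right.eq, mul_smul]
    exact .succ (ih (by omega))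

omit hv in
theorem Word.Y_smul {m k i : ℕ} (h1 : 1 ≤ i) (h2 : i ≤ k) {x : N} (hx : Wd m k x) :
    Wd m k (Y (k - 1) i • x) := by
  induction hx with
  | zero hx => exact .zero (hx.loop h1 h2)
  | @succ m k x hx ih =>
    obtain ⟨k, rfl⟩ : ∃ k', k = k' + 1 := ⟨k - 1, by omega⟩
    rw [Nat.add_sub_cancel, ← mul_smul, ← (h.dm_Y h1 h2).eq, mul_smul]
    exact .succ (ih (by omega))

theorem WordSum.T_smul {k i : ℕ} (h1 : 1 ≤ i) (h2 : i < k) {x : N} (hx : Ws k x) :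
    Ws k ((T k i : A) • x) :=
  hx.map fun _ _ hw => .word (hw.T_smul h hv h1 h2)

omit hv in
theorem WordSum.Y_smul {k i : ℕ} (h1 : 1 ≤ i) (h2 : i ≤ k + 1) {x : N} (hx : Ws (k + 1) x) :
    Ws (k + 1) (Y k i • x) :=
  hx.map fun _ _ hw => .word (hw.Y_smul h h1 h2)

theorem WordSum.S_smul {k : ℕ} {x : N} (hx : Ws k x) : Ws (k + 1) (S k • x) := by
  refine hx.map fun m x hw => ?_
  clear hx
  induction hw with
  | zero hx => exact .of_poly (hx.S_smul h hv)
  | @succ m k x hw ih =>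
    rw [← mul_smul, h.S_dm, sub_smul, smul_smul_algebraMap, mul_smul, mul_smul]
    exact (ih.T_smul h hv (by omega) (by omega)).dm_smul.sub
      ((WordSum.Y_smul h (by omega) le_rfl (.word hw)).smul _)

theorem PolyVec.comm_smul {k : ℕ} {x : N} (hx : Poly (k + 1) x) : Ws (k + 1) (cs k • x) := by
  induction hx with
  | vec =>
    -- The commutator annihilates the vacuum vector.
    rw [ringComm, sub_smul, mul_smul, mul_smul, hv.dm_v, hv.ds_v, hv.ds_v, hv.dm_v]
    exact WordSum.sub (.of_poly .vec) (.of_poly .vec)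
  | add _ _ ih ih' => rw [smul_add]; exact ih.add ih'
  | smul c _ ih => rw [smul_algebraMap_smul]; exact ih.smul c
  | @loop j h3 h4 x hx ih =>
    rw [Nat.add_sub_cancel, ← mul_smul]
    rcases h4.eq_or_lt with rfl | h4
    · rw [h.comm_Y_last, smul_smul_algebraMap, mul_smul, add_smul, smul_smul_algebraMap, mul_smul]
      exact (WordSum.Y_smul h le_rfl (by omega)
        (ih.add (WordSum.dm_smul (.of_poly (hx.ds_smul h hv)) |>.smul _))).smul _
    · rw [(h.comm_Y h3 (by omega)).eq, mul_smul]
      exact ih.Y_smul h (by omega) (by omega)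

/-- The number of letters `d_-` drops by one when the commutator passes `d_-`, so the statement is
proved by induction on it; the factor `T⁻¹` that appears does not change it. -/
theorem WordSum.comm_smul {k : ℕ} {x : N} (hx : Ws (k + 1) x) : Ws (k + 1) (cs k • x) := by
  refine hx.map fun m x hw => ?_
  clear hx
  induction m generalizing k x with
  | zero => cases hw with | zero hx => exact hx.comm_smul h hv
  | succ m ih =>
    cases hw with
    | succ hw =>
      rw [← mul_smul, h.comm_dm, smul_smul_algebraMap, mul_smul, mul_smul]
      exact (ih _ (hw.Tinv_smul h hv (by omega) (by omega))).dm_smul.smul _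

theorem WordSum.ds_smul {k : ℕ} {x : N} (hx : Ws k x) : Ws (k + 1) (ds k • x) := by
  refine hx.map fun m x hw => ?_
  clear hx
  induction hw with
  | zero hx => exact .of_poly (hx.ds_smul h hv)
  | @succ m k x hw ih =>
    have e : ds k * dm k = dm (k + 1) * ds (k + 1) + cs k := by rw [ringComm]; abel
    rw [← mul_smul, e, add_smul, mul_smul]
    exact ih.dm_smul.add (WordSum.comm_smul h hv (.word hw))

end Vacuum

end Module

end

section

/-! ### The span of the vectors `F(E_1, E_2, …; y_1, …, y_k) v_k` -/

namespace Vacuum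

variable {A : Type*} [Ring A] [Algebra K A] {N : Type*} [AddCommGroup N] [Module A N]
  {T : ℕ → ℕ → Aˣ} {dm dp ds : ℕ → A} {v : ℕ → N}

/-- The vectors obtained from `v_k` by polynomials in the loops `y_i` and the elements `E_n`. -/
inductive SymVec (T : ℕ → ℕ → Aˣ) (dm dp : ℕ → A) (v : ℕ → N) (k : ℕ) : N → Prop
  | vec : SymVec T dm dp v k (v k)
  | add {x x' : N} : SymVec T dm dp v k x → SymVec T dm dp v k x' →
      SymVec T dm dp v k (x + x')
  | smul (c : K) {x : N} : SymVec T dm dp v k x → SymVec T dm dp v k (algebraMap K A c • x)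
  | loop {i : ℕ} (h1 : 1 ≤ i) (h2 : i ≤ k) {x : N} : SymVec T dm dp v k x →
      SymVec T dm dp v k (ringY T dm dp (k - 1) i • x)
  | elem (n : ℕ) {x : N} : SymVec T dm dp v k x →
      SymVec T dm dp v k (ringE T dm dp k n • x)

local notation "Y" => ringY T dm dp
local notation "S" => ringS T dp
local notation "E" => ringE T dm dp
local notation "Sv" => SymVec T dm dp v

theorem SymVec.sub {k : ℕ} {x x' : N} (hx : Sv k x) (hx' : Sv k x') : Sv k (x - x') := by
  have := hx.add (hx'.smul (-1))
  rwa [map_neg, map_one, neg_one_smul, ← sub_eq_add_neg] at this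

theorem PolyVec.symVec {k : ℕ} {x : N} (hx : PolyVec T dm dp v k x) : Sv k x := by
  induction hx with
  | vec => exact .vec
  | add _ _ ih ih' => exact ih.add ih'
  | smul c _ ih => exact ih.smul c
  | loop h1 h2 _ ih => exact ih.loop h1 h2

variable (h : DoubleDyckRing T dm dp ds) (hv : Vacuum T dm dp ds v)
include h hv

/-- The span of the `F(E_1, E_2, …; y_1, …, y_k) v_k` is stable under `d_-`. The power of `y_{k+1}`
makes the induction work: neither `y_{k+1}` nor `E_n` can be moved past `d_-` alone. -/
theorem SymVec.dm_pow_smul {k : ℕ} {x : N} (hx : Sv (k + 1) x) (a : ℕ) :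
    Sv k (dm k • Y k (k + 1) ^ a • x) := by
  induction hx generalizing a with
  | vec =>
    cases a with
    | zero => rw [pow_zero, one_smul, hv.dm_v]; exact .vec
    | succ a =>
      rw [pow_succ, mul_smul, ← hv.S_v h, ← mul_smul, ← mul_smul, mul_assoc]
      exact SymVec.vec.elem (a + 1)
  | add _ _ ih ih' => rw [smul_add, smul_add]; exact (ih a).add (ih' a)
  | smul c _ ih => rw [smul_algebraMap_smul, smul_algebraMap_smul]; exact (ih a).smul c
  | @loop i h1 h2 x _ ih =>
    rw [Nat.add_sub_cancel]
    rcases h2.eq_or_lt with rfl | h2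
    · rw [← mul_smul (_ ^ a), ← pow_succ]
      exact ih (a + 1)
    · obtain ⟨k, rfl⟩ : ∃ k', k = k' + 1 := ⟨k - 1, by omega⟩
      rw [← mul_smul (_ ^ a), ((h.commute_Y (by omega) le_rfl h1 (by omega)).pow_left a).eq,
        mul_smul, ← mul_smul, (h.dm_Y h1 (by omega)).eq, mul_smul]
      exact (ih a).loop h1 (by omega)
  | @elem n x _ ih =>
    -- `d_-` moves past `E_n` at the cost of terms with a smaller `n`.
    induction n generalizing a with
    | zero => rw [DyckRing.ringE_zero, one_smul]; exact ih a
    | succ n ihn =>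
      rw [← mul_smul (_ ^ a), ← ((h.commute_E_Y (n + 1) (by omega) le_rfl).pow_right a).eq,
        mul_smul, ← mul_smul, h.dm_E, sub_smul, add_smul, smul_smul_algebraMap, mul_smul, mul_smul,
        mul_smul, mul_smul, mul_smul, ← mul_smul (E (k + 1) n),
        ((h.commute_E_Y n (by omega) le_rfl).pow_right a).eq, mul_smul, ← mul_smul (Y k (k + 1)),
        ← pow_succ', ← mul_smul (Y k (k + 1)), ← pow_succ']
      exact (((ihn (a + 1)).smul _).add ((ih a).elem _)).sub ((ih (a + 1)).elem _)

theorem Word.symVec {m k : ℕ} {x : N} (hx : Word T dm dp v m k x) : Sv k x := by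
  induction hx with
  | zero hx => exact hx.symVec
  | succ _ ih => simpa using ih.dm_pow_smul h hv 0

theorem WordSum.symVec {k : ℕ} {x : N} (hx : WordSum T dm dp v k x) : Sv k x := by
  induction hx with
  | word hx => exact hx.symVec h hv
  | add _ _ ih ih' => exact ih.add ih'

end Vacuum

/-! ### Power sums from signed elementary symmetric functions -/

theorem natCast_add_one_ne_zero (n : ℕ) : ((n : K) + 1) ≠ 0 := Nat.cast_add_one_ne_zero n

theorem natCast_add_one_cancel {R : Type*} [Ring R] [Algebra K R] (n : ℕ) {x z : R}
    (h : ((n : R) + 1) * x = (n + 1) * z) : x = z := by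
  have e : ∀ w : R, ((n : R) + 1) * w = ((n : K) + 1) • w := by
    intro w
    rw [Algebra.smul_def, map_add, map_natCast, map_one]
  rw [e, e] at h
  exact smul_right_injective R (natCast_add_one_ne_zero n) h

/-- Newton's identities can be solved for the power sums: they are the coefficients of `-e' / e`. -/
theorem exists_newton {R : Type*} [CommRing R] (e : ℕ → R) (he : e 0 = 1) :
    ∃ f : ℕ → R, ∀ n : ℕ, ((n : R) + 1) * e (n + 1) =
      -∑ ij ∈ Finset.HasAntidiagonal.antidiagonal n, f ij.1 * e ij.2 := by
  set φ := PowerSeries.mk e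
  refine ⟨fun n => PowerSeries.coeff n (-(PowerSeries.derivative R φ * φ.invOfUnit 1)), fun n => ?_⟩
  have h : (-(PowerSeries.derivative R φ * φ.invOfUnit 1)) * φ = -PowerSeries.derivative R φ := by
    rw [neg_mul, mul_assoc, mul_comm (φ.invOfUnit 1), PowerSeries.mul_invOfUnit, mul_one]
    simp [φ, he]
  have h2 := congrArg (PowerSeries.coeff n) h
  rw [PowerSeries.coeff_mul, map_neg] at h2
  simp only [φ, PowerSeries.coeff_mk] at h2 ⊢
  rw [h2, neg_neg]
  simp [PowerSeries.coeff_derivative, mul_comm]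

/-- A homomorphism from `V_k` to a commutative algebra may be prescribed on the complete symmetric
functions instead of the power sums. -/
theorem exists_algHom_pExpCoeff {R : Type*} [CommRing R] [Algebra K R] (k : ℕ) (e : ℕ → R)
    (he : e 0 = 1) (g : Fin k → R) :
    ∃ ψ : V k →ₐ[K] R, (∀ n, ψ (pExpCoeff k n) = e n) ∧ ∀ i, ψ (y i) = g i := by
  obtain ⟨f, hf⟩ := exists_newton e he
  refine ⟨substHom (fun n => f n.natPred) g, fun n => ?_, fun i => by simp [substHom, y]⟩
  induction n using Nat.strong_induction_on with
  | _ n ih =>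
    cases n with
    | zero => rw [pExpCoeff_zero, map_one, he]
    | succ n =>
      apply natCast_add_one_cancel n
      have := congrArg (substHom (fun n => f n.natPred) g) (newton k n)
      rw [map_mul (substHom _ _), map_add, map_natCast, map_one] at this
      rw [this, hf, map_neg, map_sum]
      congr 1
      refine Finset.sum_congr rfl fun ij hij => ?_
      have := Finset.HasAntidiagonal.mem_antidiagonal.1 hij
      rw [map_mul (substHom _ _), ih ij.2 (by omega)]
      simp [substHom, p]

/-- `V_k` is generated by the signed elementary symmetric functions and the variables `y_i`. -/
theorem adjoin_pExpCoeff_y (k : ℕ) :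
    Algebra.adjoin K (Set.range (pExpCoeff k) ∪ Set.range y) = ⊤ := by
  set B := Algebra.adjoin K (Set.range (pExpCoeff k) ∪ Set.range y) with hB
  have hE : ∀ n, pExpCoeff k n ∈ B := fun n =>
    Algebra.subset_adjoin (Or.inl (Set.mem_range_self n))
  have hp : ∀ n : ℕ, (p n.succPNat : V k) ∈ B := by
    intro n
    induction n using Nat.strong_induction_on with
    | _ n ih =>
      have e := newton k n
      rw [← Finset.add_sum_erase _ _ (show (n, 0) ∈ Finset.HasAntidiagonal.antidiagonal n by simp),
        pExpCoeff_zero, mul_one] at e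
      have e2 : (p n.succPNat : V k) = -(((n : V k) + 1) * pExpCoeff k (n + 1)) -
          ∑ ij ∈ (Finset.HasAntidiagonal.antidiagonal n).erase (n, 0),
            p ij.1.succPNat * pExpCoeff k ij.2 := by
        rw [e]; ring
      rw [e2]
      refine B.sub_mem (B.neg_mem (B.mul_mem (B.add_mem (B.natCast_mem n) B.one_mem) (hE _)))
        (B.sum_mem fun ij hij => B.mul_mem (ih _ ?_) (hE _))
      have h1 := Finset.HasAntidiagonal.mem_antidiagonal.1 (Finset.mem_of_mem_erase hij)
      have h2 := Finset.ne_of_mem_erase hij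
      by_contra h3
      exact h2 (Prod.ext (by simp only; omega) (by simp only; omega))
  rw [eq_top_iff, ← MvPolynomial.adjoin_range_X, Algebra.adjoin_le_iff]
  rintro _ ⟨n | i, rfl⟩
  · have := hp n.natPred
    rwa [PNat.succPNat_natPred] at this
  · exact Algebra.subset_adjoin (Or.inr ⟨i, rfl⟩)

/-! ### The commutative algebra generated by the `E_n` and the loops `y_i` -/

namespace DyckRing

variable {A : Type*} [Ring A] [Algebra K A] {T : ℕ → ℕ → Aˣ} {dm dp : ℕ → A}

open scoped IsMulCommutative in
/-- The elements `E_n` and `y_i` generate a commutative algebra, so they define a homomorphism from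
the polynomial ring `V_k`. -/
theorem exists_algHom (h : DyckRing T dm dp) (k : ℕ) :
    ∃ ψ : V k →ₐ[K] A, (∀ n, ψ (pExpCoeff k n) = ringE T dm dp k n) ∧
      ∀ i : Fin k, ψ (y i) = ringY T dm dp (k - 1) (i + 1) := by
  set s : Set A := Set.range (ringE T dm dp k) ∪
    Set.range fun i : Fin k => ringY T dm dp (k - 1) (i + 1)
  have hs : ∀ a ∈ s, ∀ b ∈ s, a * b = b * a := by
    have hEY : ∀ n (i : Fin k), Commute (ringE T dm dp k n) (ringY T dm dp (k - 1) (i + 1)) := by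
      intro n i
      obtain ⟨k, rfl⟩ : ∃ k', k = k' + 1 := ⟨k - 1, by have := i.2; omega⟩
      exact h.commute_E_Y n (by omega) (by have := i.2; omega)
    rintro _ (⟨m, rfl⟩ | ⟨i, rfl⟩) _ (⟨n, rfl⟩ | ⟨j, rfl⟩)
    · exact h.commute_E k m n
    · exact hEY m j
    · exact (hEY n i).symm
    · exact h.commute_Y (by omega) (by have := i.2; omega) (by omega) (by have := j.2; omega)
  have := Algebra.isMulCommutative_adjoin K hs
  have hE : ∀ n, ringE T dm dp k n ∈ Algebra.adjoin K s := fun n =>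
    Algebra.subset_adjoin (Or.inl (Set.mem_range_self n))
  have hY : ∀ i : Fin k, ringY T dm dp (k - 1) (i + 1) ∈ Algebra.adjoin K s := fun i =>
    Algebra.subset_adjoin (Or.inr (Set.mem_range_self i))
  obtain ⟨ψ, h1, h2⟩ := exists_algHom_pExpCoeff (R := Algebra.adjoin K s) k
    (fun n => ⟨_, hE n⟩) rfl (fun i => ⟨_, hY i⟩)
  exact ⟨(Algebra.adjoin K s).val.comp ψ, fun n => congrArg Subtype.val (h1 n),
    fun i => congrArg Subtype.val (h2 i)⟩

end DyckRing

end

/-! ### The loops `T_i` completed to units -/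

/-- The image of the loop `T_i` in the algebra. -/
def loopT (k i : ℕ) : Aqt := toAqt (Free.T k i)

/-- The image of the loop `T_i⁻¹` in the algebra. -/
def loopTinv (k i : ℕ) : Aqt := toAqt (Free.Tinv k i)

theorem loopTinv_eq (k i : ℕ) :
    loopTinv k i = q⁻¹ • (loopT k i + (q - 1) • gen (Gen.e k)) := by
  rw [loopTinv, Free.Tinv, map_smul, map_add, map_smul]
  rfl

theorem e_loopT {k i : ℕ} (h1 : 1 ≤ i) (h2 : i < k) :
    gen (Gen.e k) * loopT k i = loopT k i := by
  have := toAqt_rel (QuiverRel.e_T k i h1 h2)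
  rwa [map_mul] at this

theorem loopT_e {k i : ℕ} (h1 : 1 ≤ i) (h2 : i < k) :
    loopT k i * gen (Gen.e k) = loopT k i := by
  have := toAqt_rel (QuiverRel.T_e k i h1 h2)
  rwa [map_mul] at this

theorem e_loopTinv {k i : ℕ} (h1 : 1 ≤ i) (h2 : i < k) :
    gen (Gen.e k) * loopTinv k i = loopTinv k i := by
  rw [loopTinv_eq, mul_smul_comm, mul_add, mul_smul_comm, gen_e_mul_self, e_loopT h1 h2]

theorem loopTinv_e {k i : ℕ} (h1 : 1 ≤ i) (h2 : i < k) :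
    loopTinv k i * gen (Gen.e k) = loopTinv k i := by
  rw [loopTinv_eq, smul_mul_assoc, add_mul, smul_mul_assoc, gen_e_mul_self, loopT_e h1 h2]

theorem loopT_sq {k i : ℕ} (h1 : 1 ≤ i) (h2 : i < k) :
    loopT k i * loopT k i + (q - 1) • loopT k i = q • gen (Gen.e k) := by
  have h := toAqt_rel (QuiverRel.dyck (DyckRel.quad k i h1 h2))
  rw [map_mul, map_zero, map_sub, map_add, map_smul] at h
  change (loopT k i - gen (Gen.e k)) * (loopT k i + q • gen (Gen.e k)) = 0 at h
  rw [sub_mul, mul_add, mul_add, mul_smul_comm, mul_smul_comm, loopT_e h1 h2, e_loopT h1 h2,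
    gen_e_mul_self] at h
  rw [← sub_eq_zero, ← h, sub_smul, one_smul]
  abel

theorem loopT_loopTinv {k i : ℕ} (h1 : 1 ≤ i) (h2 : i < k) :
    loopT k i * loopTinv k i = gen (Gen.e k) := by
  rw [loopTinv_eq, mul_smul_comm, mul_add, mul_smul_comm, loopT_e h1 h2, loopT_sq h1 h2,
    inv_smul_smul₀ q_ne_zero]

theorem loopTinv_loopT {k i : ℕ} (h1 : 1 ≤ i) (h2 : i < k) :
    loopTinv k i * loopT k i = gen (Gen.e k) := by
  rw [loopTinv_eq, smul_mul_assoc, add_mul, smul_mul_assoc, e_loopT h1 h2, loopT_sq h1 h2,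
    inv_smul_smul₀ q_ne_zero]

theorem add_one_sub_mul {R : Type*} [Ring R] {e x z : R} (he : e * e = e) (hx : x * e = x)
    (hz : e * z = z) : (x + (1 - e)) * (z + (1 - e)) = x * z + (1 - e) := by
  rw [add_mul, mul_add, mul_add, mul_sub x, sub_mul 1 e z, hx, hz, sub_mul, mul_sub e, he]
  simp

theorem mul_add_one_sub {R : Type*} [Ring R] {e a x : R} (ha : a * e = a) :
    a * (x + (1 - e)) = a * x := by
  rw [mul_add, mul_sub, ha, mul_one, sub_self, add_zero]

theorem add_one_sub_mul' {R : Type*} [Ring R] {e a x : R} (ha : e * a = a) :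
    (x + (1 - e)) * a = x * a := by
  rw [add_mul, sub_mul, ha, one_mul, sub_self, add_zero]

/-- The loop `T_i` at the vertex `k`, acting as the identity at the other vertices. This makes it a
unit of the algebra; for `i` out of range it is `1`. -/
def unitT (k i : ℕ) : Aqtˣ :=
  if h : 1 ≤ i ∧ i < k then
    { val := loopT k i + (1 - gen (Gen.e k))
      inv := loopTinv k i + (1 - gen (Gen.e k))
      val_inv := by
        rw [add_one_sub_mul (gen_e_mul_self k) (loopT_e h.1 h.2) (e_loopTinv h.1 h.2),
          loopT_loopTinv h.1 h.2, add_sub_cancel]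
      inv_val := by
        rw [add_one_sub_mul (gen_e_mul_self k) (loopTinv_e h.1 h.2) (e_loopT h.1 h.2),
          loopTinv_loopT h.1 h.2, add_sub_cancel] }
  else 1

theorem unitT_val {k i : ℕ} (h1 : 1 ≤ i) (h2 : i < k) :
    (unitT k i : Aqt) = loopT k i + (1 - gen (Gen.e k)) := by
  rw [unitT, dif_pos ⟨h1, h2⟩]

theorem unitT_inv {k i : ℕ} (h1 : 1 ≤ i) (h2 : i < k) :
    (((unitT k i)⁻¹ : Aqtˣ) : Aqt) = loopTinv k i + (1 - gen (Gen.e k)) := by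
  rw [unitT, dif_pos ⟨h1, h2⟩]
  rfl

theorem mul_unitT {k i : ℕ} (h1 : 1 ≤ i) (h2 : i < k) {a : Aqt} (ha : a * gen (Gen.e k) = a) :
    a * unitT k i = a * loopT k i := by
  rw [unitT_val h1 h2, mul_add_one_sub ha]

theorem unitT_mul {k i : ℕ} (h1 : 1 ≤ i) (h2 : i < k) {a : Aqt} (ha : gen (Gen.e k) * a = a) :
    (unitT k i : Aqt) * a = loopT k i * a := by
  rw [unitT_val h1 h2, add_one_sub_mul' ha]

theorem mul_unitT_inv {k i : ℕ} (h1 : 1 ≤ i) (h2 : i < k) {a : Aqt}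
    (ha : a * gen (Gen.e k) = a) : a * (((unitT k i)⁻¹ : Aqtˣ) : Aqt) = a * loopTinv k i := by
  rw [unitT_inv h1 h2, mul_add_one_sub ha]

theorem unitT_inv_mul {k i : ℕ} (h1 : 1 ≤ i) (h2 : i < k) {a : Aqt}
    (ha : gen (Gen.e k) * a = a) : (((unitT k i)⁻¹ : Aqtˣ) : Aqt) * a = loopTinv k i * a := by
  rw [unitT_inv h1 h2, add_one_sub_mul' ha]

theorem e_unitT {k i : ℕ} : gen (Gen.e k) * unitT k i = unitT k i * gen (Gen.e k) := by
  by_cases h : 1 ≤ i ∧ i < k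
  · rw [mul_unitT h.1 h.2 (gen_e_mul_self k), unitT_mul h.1 h.2 (gen_e_mul_self k),
      e_loopT h.1 h.2, loopT_e h.1 h.2]
  · rw [unitT, dif_neg h, Units.val_one, mul_one, one_mul]

/-! ### The relations of the algebra in terms of the units -/

/-- The arrow `d_-` from `k + 1` to `k` in the algebra. -/
def dmA (k : ℕ) : Aqt := gen (Gen.dMinus k)

/-- The arrow `d_+` from `k` to `k + 1` in the algebra. -/
def dpA (k : ℕ) : Aqt := gen (Gen.dPlus k)

/-- The arrow `d_+^*` from `k` to `k + 1` in the algebra. -/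
def dsA (k : ℕ) : Aqt := gen (Gen.dPlusStar k)

theorem e_dmA (k : ℕ) : gen (Gen.e k) * dmA k = dmA k := by
  have := toAqt_rel (QuiverRel.e_dm k)
  rwa [map_mul] at this

theorem dmA_e (k : ℕ) : dmA k * gen (Gen.e (k + 1)) = dmA k := by
  have := toAqt_rel (QuiverRel.dm_e k)
  rwa [map_mul] at this

theorem e_dpA (k : ℕ) : gen (Gen.e (k + 1)) * dpA k = dpA k := by
  have := toAqt_rel (QuiverRel.e_dp k)
  rwa [map_mul] at this

theorem dpA_e (k : ℕ) : dpA k * gen (Gen.e k) = dpA k := by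
  have := toAqt_rel (QuiverRel.dp_e k)
  rwa [map_mul] at this

theorem e_dsA (k : ℕ) : gen (Gen.e (k + 1)) * dsA k = dsA k := by
  have := toAqt_rel (QuiverRel.e_ds k)
  rwa [map_mul] at this

theorem dsA_e (k : ℕ) : dsA k * gen (Gen.e k) = dsA k := by
  have := toAqt_rel (QuiverRel.ds_e k)
  rwa [map_mul] at this

theorem toAqt_comm_dp (k : ℕ) : toAqt (comm Free.dm Free.dp (k + 1)) = ringComm dmA dpA k := by
  rw [comm, map_sub, map_mul, map_mul]
  rfl

theorem toAqt_comm_ds (k : ℕ) : toAqt (comm Free.dm Free.ds (k + 1)) = ringComm dmA dsA k := by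
  rw [comm, map_sub, map_mul, map_mul]
  rfl

theorem e_ringComm {d : ℕ → Aqt} (hd : ∀ k, gen (Gen.e (k + 1)) * d k = d k) (k : ℕ) :
    gen (Gen.e (k + 1)) * ringComm dmA d k = ringComm dmA d k := by
  rw [ringComm, mul_sub, ← mul_assoc, ← mul_assoc, hd, e_dmA]

theorem ringComm_e {d : ℕ → Aqt} (hd : ∀ k, d k * gen (Gen.e k) = d k) (k : ℕ) :
    ringComm dmA d k * gen (Gen.e (k + 1)) = ringComm dmA d k := by
  rw [ringComm, sub_mul, mul_assoc, mul_assoc, hd, dmA_e]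

theorem isBraid_unitT (k : ℕ) : IsBraid k (unitT k) where
  braid i h1 h2 := by
    have h := toAqt_rel (QuiverRel.dyck (DyckRel.braid k i h1 h2))
    simp only [map_mul] at h
    change loopT k i * loopT k (i + 1) * loopT k i =
      loopT k (i + 1) * loopT k i * loopT k (i + 1) at h
    have h1' : i < k := by omega
    have h3 : 1 ≤ i + 1 := by omega
    ext
    simp only [Units.val_mul]
    rw [unitT_val h1 h1', unitT_val h3 h2,
      add_one_sub_mul (gen_e_mul_self k) (loopT_e h1 h1') (e_loopT h3 h2),
      add_one_sub_mul (gen_e_mul_self k) (by rw [mul_assoc, loopT_e h3 h2]) (e_loopT h1 h1'),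
      add_one_sub_mul (gen_e_mul_self k) (loopT_e h3 h2) (e_loopT h1 h1'),
      add_one_sub_mul (gen_e_mul_self k) (by rw [mul_assoc, loopT_e h1 h1']) (e_loopT h3 h2), h]
  far i j h1 h2 h3 := by
    have h := toAqt_rel (QuiverRel.dyck (DyckRel.far k i j h1 h2 h3))
    rw [map_mul, map_mul] at h
    change loopT k i * loopT k j = loopT k j * loopT k i at h
    have h1' : i < k := by omega
    have h3' : 1 ≤ j := by omega
    ext
    rw [Units.val_mul, Units.val_mul, unitT_val h1 h1', unitT_val h3' h3,
      add_one_sub_mul (gen_e_mul_self k) (loopT_e h1 h1') (e_loopT h3' h3),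
      add_one_sub_mul (gen_e_mul_self k) (loopT_e h3' h3) (e_loopT h1 h1'), h]

theorem dyckRing : DyckRing unitT dmA dpA where
  quad k i h1 h2 := by
    rw [unitT_val h1 h2, unitT_inv h1 h2, loopTinv_eq, smul_add, smul_inv_smul₀ q_ne_zero,
      sub_smul, sub_smul, smul_sub, one_smul, one_smul]
    abel
  braid := isBraid_unitT
  dm_dm_T k := by
    have h := toAqt_rel (QuiverRel.dyck (DyckRel.dm_dm_T k))
    simp only [map_mul] at h
    rw [mul_unitT (by omega) (by omega) (by rw [mul_assoc, dmA_e])]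
    exact h
  dm_T k i h1 h2 := by
    have h := toAqt_rel (QuiverRel.dyck (DyckRel.T_dm k i h1 h2))
    simp only [map_mul] at h
    rw [SemiconjBy, mul_unitT h1 (by omega) (dmA_e k), unitT_mul h1 h2 (e_dmA k)]
    exact h.symm
  T_dp_dp k := by
    have h := toAqt_rel (QuiverRel.dyck (DyckRel.T_dp_dp k))
    simp only [map_mul, mul_assoc] at h
    rw [unitT_mul le_rfl (by omega) (by rw [← mul_assoc, e_dpA])]
    exact h
  dp_T k i h1 h2 := by
    have h := toAqt_rel (QuiverRel.dyck (DyckRel.dp_T k i h1 h2))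
    simp only [map_mul] at h
    rw [SemiconjBy, mul_unitT h1 h2 (dpA_e k), unitT_mul (by omega) (by omega) (e_dpA k)]
    exact h
  dm_comm k := by
    have h := toAqt_rel (QuiverRel.dyck (DyckRel.dm_comm (k + 2) (by omega)))
    rw [map_mul, map_mul, map_smul, map_mul, toAqt_comm_dp] at h
    rw [mul_unitT (by omega) (by omega) (by rw [mul_assoc, ringComm_e dpA_e])]
    exact h.trans (by rw [← toAqt_comm_dp]; rfl)
  comm_dp k := by
    have h := toAqt_rel (QuiverRel.dyck (DyckRel.comm_dp (k + 1) (by omega)))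
    rw [map_mul, map_mul, map_smul, map_mul, toAqt_comm_dp, toAqt_comm_dp] at h
    rw [unitT_mul le_rfl (by omega) (e_ringComm e_dpA _)]
    exact h

theorem mul_tDown (k j : ℕ) (hj : j < k) {a : Aqt} (ha : a * gen (Gen.e k) = a) :
    a * toAqt (tDown Free.e Free.T k j) = a * ((down (unitT k) j : Aqtˣ) : Aqt) := by
  induction j generalizing a with
  | zero => exact ha.trans (mul_one a).symm
  | succ j ih =>
    rw [tDown, down, map_mul, Units.val_mul, ← mul_assoc, ← mul_assoc,
      mul_unitT (by omega) hj ha]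
    exact ih (by omega) (by rw [mul_assoc]; exact congrArg (a * ·) (loopT_e (by omega) hj))

theorem mul_tDown_inv (k j : ℕ) (hj : j < k) {a : Aqt} (ha : a * gen (Gen.e k) = a) :
    a * toAqt (tDown Free.e Free.Tinv k j) = a * (((up (unitT k) j)⁻¹ : Aqtˣ) : Aqt) := by
  induction j generalizing a with
  | zero => rw [up, inv_one]; exact ha.trans (mul_one a).symm
  | succ j ih =>
    rw [tDown, up, map_mul, mul_inv_rev, Units.val_mul, ← mul_assoc, ← mul_assoc,
      mul_unitT_inv (by omega) hj ha]
    exact ih (by omega) (by rw [mul_assoc]; exact congrArg (a * ·) (loopTinv_e (by omega) hj))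

theorem toAqt_yl_one (k : ℕ) : toAqt (Free.yl (k + 1) 1) = ringY unitT dmA dpA k 1 := by
  rw [Free.yl, yLoop, map_smul, map_mul, toAqt_comm_dp, Nat.add_sub_cancel,
    mul_tDown _ _ (by omega) (ringComm_e dpA_e k)]
  rfl

theorem e_down (k j : ℕ) : gen (Gen.e k) * ((down (unitT k) j : Aqtˣ) : Aqt) =
    ((down (unitT k) j : Aqtˣ) : Aqt) * gen (Gen.e k) := by
  rw [coe_down]
  exact commute_down fun i _ _ => e_unitT

theorem toAqt_yl {k i : ℕ} (h1 : 1 ≤ i) (h2 : i ≤ k + 1) :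
    toAqt (Free.yl (k + 1) i) = ringY unitT dmA dpA k i ∧
      gen (Gen.e (k + 1)) * ringY unitT dmA dpA k i = ringY unitT dmA dpA k i ∧
      ringY unitT dmA dpA k i * gen (Gen.e (k + 1)) = ringY unitT dmA dpA k i := by
  induction i, h1 using Nat.le_induction with
  | base =>
    refine ⟨toAqt_yl_one k, ?_, ?_⟩
    · rw [DyckRing.Y_one, mul_smul_comm, ← mul_assoc, e_ringComm e_dpA]
    · rw [DyckRing.Y_one, smul_mul_assoc, mul_assoc, ← e_down, ← mul_assoc, ringComm_e dpA_e]
  | succ i hi ih =>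
    obtain ⟨i, rfl⟩ : ∃ i', i = i' + 1 := ⟨i - 1, by omega⟩
    obtain ⟨ih1, ih2, ih3⟩ := ih (by omega)
    have e : ringY unitT dmA dpA k (i + 2) = q • (loopTinv (k + 1) (i + 1) *
        ringY unitT dmA dpA k (i + 1) * loopTinv (k + 1) (i + 1)) := by
      rw [DyckRing.Y_succ, unitT_inv_mul (by omega) (by omega) ih2,
        mul_unitT_inv (by omega) (by omega) (by rw [mul_assoc, ih3])]
    refine ⟨?_, ?_, ?_⟩
    · rw [e, ← ih1, Free.yl, yLoop, map_smul, map_mul, map_mul]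
      rfl
    · rw [e, mul_smul_comm, ← mul_assoc, ← mul_assoc, e_loopTinv (by omega) (by omega)]
    · rw [e, smul_mul_assoc, mul_assoc, loopTinv_e (by omega) (by omega)]

theorem doubleDyckRing : DoubleDyckRing unitT dmA dpA dsA where
  toDyckRing := dyckRing
  ds_T k i h1 h2 := by
    have h := toAqt_rel (QuiverRel.dyckStar (DyckRel.dp_T k i h1 h2))
    rw [map_mul, map_mul] at h
    rw [← SemiconjBy.units_inv_right_iff, SemiconjBy, mul_unitT_inv h1 h2 (dsA_e k),
      unitT_inv_mul (by omega) (by omega) (e_dsA k)]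
    exact h
  T_ds_ds k := by
    have h := toAqt_rel (QuiverRel.dyckStar (DyckRel.T_dp_dp k))
    rw [map_mul, map_mul, map_mul, mul_assoc] at h
    rw [← Units.eq_inv_mul_iff_mul_eq,
      unitT_inv_mul le_rfl (by omega) (by rw [← mul_assoc, e_dsA])]
    exact h.symm
  ds_Y k i h1 h2 := by
    have h := toAqt_rel (QuiverRel.ds_y (k + 1) i h1 h2)
    rw [map_mul, map_mul, (toAqt_yl h1 h2).1, (toAqt_yl (k := k + 1) (i := i + 1) (by omega)
      (by omega)).1] at h
    exact h
  comm_dm k := by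
    have h := toAqt_rel (QuiverRel.dyckStar (DyckRel.dm_comm (k + 2) (by omega)))
    rw [map_mul, map_mul, map_smul, map_mul, toAqt_comm_ds] at h
    rw [← mul_assoc, mul_unitT_inv (by omega) (by omega) (by rw [mul_assoc, ringComm_e dsA_e])]
    refine (inv_smul_eq_iff₀ q_ne_zero).1 (Eq.trans ?_ h.symm)
    rw [← toAqt_comm_ds]
    rfl
  comm_S k := by
    have h := toAqt_rel (QuiverRel.z_dp k)
    rw [map_mul, map_smul, map_mul, toAqt_yl_one, Free.zl, yLoop, map_smul, map_mul,
      toAqt_comm_ds, Nat.add_sub_cancel, mul_tDown_inv _ _ (by omega) (ringComm_e dsA_e k),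
      smul_mul_assoc, mul_assoc] at h
    have hc : (q⁻¹ ^ k * (q⁻¹ - 1)) ≠ 0 := by
      refine mul_ne_zero (pow_ne_zero _ (inv_ne_zero q_ne_zero)) (sub_ne_zero.2 fun h0 => ?_)
      rw [inv_eq_one] at h0
      exact q_sub_one_ne_zero (sub_eq_zero.2 h0)
    rw [ringS, mul_neg, neg_eq_iff_eq_neg]
    refine ((inv_smul_eq_iff₀ hc).1 h).trans ?_
    rw [smul_smul, ← neg_smul]
    congr 1
    have := q_ne_zero
    rw [inv_pow]
    field_simp
    ring

/-! ### The action of the loops on `V_k` -/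

/-- The embedding of `V_k` in `V_*`. -/
def inV (k : ℕ) (F : V k) : VStar := DirectSum.lof K ℕ V k F

theorem action_neg_apply (a : Aqt) (w : VStar) : action (-a) w = -action a w := by
  apply eq_neg_of_add_eq_zero_left
  rw [← LinearMap.add_apply, ← map_add, neg_add_cancel, map_zero]
  rfl

theorem action_sub_apply (a b : Aqt) (w : VStar) : action (a - b) w = action a w - action b w := by
  rw [sub_eq_add_neg, map_add, LinearMap.add_apply, action_neg_apply, ← sub_eq_add_neg]

theorem action_inv_apply (u : Aqtˣ) (w : VStar) :
    action ((u⁻¹ : Aqtˣ) : Aqt) (action (u : Aqt) w) = w := by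
  rw [← Module.End.mul_apply, ← map_mul, Units.inv_mul, map_one]
  rfl

theorem action_apply_inv (u : Aqtˣ) (w : VStar) :
    action (u : Aqt) (action ((u⁻¹ : Aqtˣ) : Aqt) w) = w := by
  rw [← Module.End.mul_apply, ← map_mul, Units.mul_inv, map_one]
  rfl

theorem action_dmA (k : ℕ) (F : V (k + 1)) :
    action (dmA k) (inV (k + 1) F) = inV k (opDMinus k F) := by
  rw [dmA, action_gen]
  exact extendOp_lof _ _

theorem action_dpA (k : ℕ) (F : V k) :
    action (dpA k) (inV k F) = inV (k + 1) (opDPlus k F) := by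
  rw [dpA, action_gen]
  exact extendOp_lof _ _

theorem action_dsA (k : ℕ) (F : V k) :
    action (dsA k) (inV k F) = inV (k + 1) (dStar k F) := by
  rw [dsA, action_gen]
  exact extendOp_lof _ _

theorem action_e (k : ℕ) (F : V k) : action (gen (Gen.e k)) (inV k F) = inV k F := by
  rw [action_gen]
  exact extendOp_lof _ _

theorem action_unitT {k i : ℕ} (h1 : 1 ≤ i) (h2 : i < k) (F : V k) :
    action (unitT k i : Aqt) (inV k F) = inV k (opT k i F) := by
  have e : loopT k i = gen (Gen.T k i ⟨h1, h2⟩) := by rw [loopT, Free.T, dif_pos ⟨h1, h2⟩]; rfl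
  rw [← action_e k F, ← Module.End.mul_apply, ← map_mul,
    unitT_mul h1 h2 (gen_e_mul_self k), map_mul, Module.End.mul_apply, action_e, e, action_gen]
  exact extendOp_lof _ _

theorem action_up {k j : ℕ} (hj : j < k) (F : V k) :
    action ((up (unitT k) j : Aqtˣ) : Aqt) (inV k F) = inV k (opTUp k j F) := by
  induction j generalizing F with
  | zero => rw [up, Units.val_one, map_one]; rfl
  | succ j ih =>
    rw [up, Units.val_mul, map_mul, Module.End.mul_apply, action_unitT (by omega) hj,
      ih (by omega)]
    rfl

theorem action_ringY {k i : ℕ} (hi : i < k + 1) (F : V (k + 1)) :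
    action (ringY unitT dmA dpA k (i + 1)) (inV (k + 1) F) = inV (k + 1) (y ⟨i, hi⟩ * F) := by
  rw [← (toAqt_yl (k := k) (i := i + 1) (by omega) (by omega)).1, action_toAqt, freeAction_yl]
  refine (extendOp_lof _ _).trans ?_
  rw [opY_apply hi]
  rfl

theorem action_ringS (k : ℕ) (F : V k) :
    action (ringS unitT dpA k) (inV k F) = inV (k + 1) (y (Fin.last k) * addAlphabet k F) := by
  have e : -dpA k = (up (unitT (k + 1)) k : Aqtˣ) * ringS unitT dpA k := by
    rw [ringS, mul_neg, Units.mul_inv_cancel_left]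
  have e2 : action (-dpA k) (inV k F) = action ((up (unitT (k + 1)) k : Aqtˣ) : Aqt)
      (inV (k + 1) (y (Fin.last k) * addAlphabet k F)) := by
    rw [action_up (by omega), action_neg_apply, action_dpA, opDPlus_apply, inV, inV,
      map_neg]
    exact neg_neg (G := VStar) _
  rw [e, map_mul, Module.End.mul_apply] at e2
  have e3 := congrArg (action (((up (unitT (k + 1)) k)⁻¹ : Aqtˣ) : Aqt)) e2
  rwa [action_inv_apply, action_inv_apply] at e3

theorem action_ringY_pow (k n : ℕ) (F : V (k + 1)) :
    action (ringY unitT dmA dpA k (k + 1) ^ n) (inV (k + 1) F) =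
      inV (k + 1) (y (Fin.last k) ^ n * F) := by
  induction n with
  | zero => rw [pow_zero, map_one, pow_zero, one_mul]; rfl
  | succ n ih =>
    rw [pow_succ', map_mul, Module.End.mul_apply, ih, action_ringY (Nat.lt_succ_self k), pow_succ',
      mul_assoc]
    rfl

/-- The elements `E_n` act as multiplication by the signed elementary symmetric functions. -/
theorem action_ringE (k n : ℕ) (F : V k) :
    action (ringE unitT dmA dpA k n) (inV k F) = inV k (pExpCoeff k n * F) := by
  cases n with
  | zero => rw [DyckRing.ringE_zero, map_one, pExpCoeff_zero, one_mul]; rfl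
  | succ n =>
    rw [DyckRing.ringE_succ, map_mul, map_mul, Module.End.mul_apply, Module.End.mul_apply,
      action_ringS, action_ringY_pow, action_dmA, ← mul_assoc, ← pow_succ, mul_comm,
      opDMinus_addAlphabet_mul, opDMinus_y_last_pow, mul_comm]

/-! ### The quotient module -/

/-- The homomorphism from `V_k` to the algebra with `E_n ↦ E_n` and `y_i ↦ y_i`. -/
def symHom (k : ℕ) : V k →ₐ[K] Aqt := (dyckRing.exists_algHom k).choose

theorem symHom_pExpCoeff (k n : ℕ) : symHom k (pExpCoeff k n) = ringE unitT dmA dpA k n :=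
  (dyckRing.exists_algHom k).choose_spec.1 n

theorem symHom_y (k : ℕ) (i : Fin k) :
    symHom k (y i) = ringY unitT dmA dpA (k - 1) (i + 1) :=
  (dyckRing.exists_algHom k).choose_spec.2 i

theorem action_symHom (k : ℕ) (F G : V k) :
    action (symHom k F) (inV k G) = inV k (F * G) := by
  have hF : F ∈ Algebra.adjoin K (Set.range (pExpCoeff k) ∪ Set.range y) := by
    rw [adjoin_pExpCoeff_y]; trivial
  induction hF using Algebra.adjoin_induction generalizing G with
  | mem F hF =>
    rcases hF with ⟨n, rfl⟩ | ⟨i, rfl⟩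
    · rw [symHom_pExpCoeff, action_ringE]
    · obtain ⟨k, rfl⟩ : ∃ k', k = k' + 1 := ⟨k - 1, by have := i.2; omega⟩
      rw [symHom_y, Nat.add_sub_cancel, action_ringY i.2]
  | algebraMap c =>
    rw [AlgHom.commutes, AlgHom.commutes, Module.algebraMap_end_apply, ← Algebra.smul_def, inV, inV,
      map_smul]
  | add F F' _ _ ih ih' =>
    rw [map_add, map_add, LinearMap.add_apply, ih, ih', add_mul, inV, inV, inV, map_add]
  | mul F F' _ _ ih ih' =>
    rw [map_mul (symHom k), map_mul, Module.End.mul_apply, ih', ih, mul_assoc]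

theorem naturalMap_dsPow (k : ℕ) : naturalMap action (dsPow k) = inV k 1 := by
  induction k with
  | zero => exact action_e 0 1
  | succ k ih =>
    rw [dsPow, map_smul, ih]
    exact (action_dsA k 1).trans (by rw [map_one])

theorem naturalMap_smul_dsPow (a : Aqt) (k : ℕ) :
    naturalMap action (a • dsPow k) = action a (inV k 1) := by
  rw [map_smul, naturalMap_dsPow]
  rfl

theorem opT_one_eq {k i : ℕ} (h1 : 1 ≤ i) (h2 : i < k) : opT k i 1 = 1 := by
  rw [opT_eq h1 h2 (by intro e; have := congrArg Fin.val e; simp at this; omega)]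
  exact hecke_of_swapY_eq _ (map_one _)

theorem action_down_inv {k j : ℕ} (hj : j < k) :
    action (((down (unitT k) j)⁻¹ : Aqtˣ) : Aqt) (inV k 1) = inV k 1 := by
  have h : action ((down (unitT k) j : Aqtˣ) : Aqt) (inV k 1) = inV k 1 := by
    induction j with
    | zero => rw [down, Units.val_one, map_one]; rfl
    | succ j ih =>
      rw [down, Units.val_mul, map_mul, Module.End.mul_apply, ih (by omega),
        action_unitT (by omega) hj, opT_one_eq (by omega) hj]
  nth_rw 1 [← h]
  rw [action_inv_apply]

/-- The vanishing of `(d_+ + q^k y_1 d_+^*) 1`: as the `T_i` fix `1`, both terms are multiples of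
`(T_1 ⋯ T_k) y_{k+1}`. -/
theorem action_dpA_one (k : ℕ) : action (dpA k) (inV k 1) =
    -(q ^ k • action (ringY unitT dmA dpA k 1) (inV (k + 1) 1)) := by
  have e : dpA k = -((up (unitT (k + 1)) k : Aqtˣ) * ringS unitT dpA k) := by
    rw [ringS, mul_neg, Units.mul_inv_cancel_left, neg_neg]
  have e2 : action (ringS unitT dpA k) (inV k 1) =
      action (ringY unitT dmA dpA k (k + 1)) (inV (k + 1) 1) := by
    rw [action_ringS, action_ringY (Nat.lt_succ_self k), map_one]
    rfl
  rw [e, action_neg_apply, map_mul, Module.End.mul_apply, e2,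
    DyckRing.Y_eq_conj k k, map_smul, LinearMap.smul_apply, map_mul, Module.End.mul_apply,
    action_down_inv (by omega), map_mul, Module.End.mul_apply, map_smul, action_apply_inv]

theorem I_le_ker : I ≤ LinearMap.ker (naturalMap action) := by
  rw [I, Submodule.span_le]
  rintro _ (⟨k, rfl⟩ | ⟨k, rfl⟩)
  · refine (naturalMap_smul_dsPow _ k).trans ?_
    change action (dmA k * dsA k - 1) _ = 0
    rw [action_sub_apply, map_mul, map_one action, Module.End.mul_apply, action_dsA, action_dmA,
      map_one, ← pow_zero (y (Fin.last k)), opDMinus_y_last_pow, pExpCoeff_zero]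
    exact sub_self _
  · refine (naturalMap_smul_dsPow _ k).trans ?_
    change action (dpA k + q ^ k • (toAqt (Free.yl (k + 1) 1) * dsA k)) _ = 0
    rw [map_add, map_smul, map_mul, LinearMap.add_apply, LinearMap.smul_apply,
      Module.End.mul_apply, action_dsA, map_one, toAqt_yl_one, action_dpA_one]
    exact neg_add_cancel _

/-- The class of `d_+^{*k} e_0` in the quotient module. -/
def vacVec (k : ℕ) : Ae0 ⧸ I := Submodule.Quotient.mk (dsPow k)

theorem vacuum : Vacuum unitT dmA dpA dsA vacVec where
  ds_v k := rfl
  dm_v k := by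
    have h : (dmA k * dsA k - 1) • dsPow k ∈ I := Submodule.subset_span (Or.inl ⟨k, rfl⟩)
    have h2 := (Submodule.Quotient.mk_eq_zero I).2 h
    rw [sub_smul, one_smul, mul_smul, Submodule.Quotient.mk_sub, sub_eq_zero] at h2
    exact h2
  dp_v k := by
    have h : (dpA k + q ^ k • (toAqt (Free.yl (k + 1) 1) * dsA k)) • dsPow k ∈ I :=
      Submodule.subset_span (Or.inr ⟨k, rfl⟩)
    have h2 := (Submodule.Quotient.mk_eq_zero I).2 h
    rw [add_smul, ← smul_mul_assoc, mul_smul, Submodule.Quotient.mk_add, toAqt_yl_one,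
      ← eq_neg_iff_add_eq_zero] at h2
    exact h2

local notation "Ws" => Vacuum.WordSum unitT dmA dpA vacVec

theorem e_smul_vacVec (k : ℕ) : gen (Gen.e k) • vacVec k = vacVec k := by
  cases k with
  | zero =>
    refine congrArg (Submodule.Quotient.mk (p := I)) (Subtype.ext ?_)
    exact gen_e_mul_self 0
  | succ k => rw [← vacuum.ds_v, ← mul_smul, e_dsA]

theorem e_smul_wordSum {k : ℕ} {x : Ae0 ⧸ I} (hx : Ws k x) : gen (Gen.e k) • x = x := by
  induction hx with
  | word hw =>
    cases hw with
    | zero hx =>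
      induction hx with
      | vec => exact e_smul_vacVec k
      | add _ _ ih ih' => rw [smul_add, ih, ih']
      | smul c _ ih => rw [smul_algebraMap_smul, ih]
      | loop h1 h2 hx ih =>
        obtain ⟨k, rfl⟩ : ∃ k', k = k' + 1 := ⟨k - 1, by omega⟩
        rw [← mul_smul, Nat.add_sub_cancel, (toAqt_yl h1 h2).2.1]
    | succ hw => rw [← mul_smul, e_dmA]
  | add _ _ ih ih' => rw [smul_add, ih, ih']

theorem smul_wordSum_eq_zero {k l : ℕ} (hkl : l ≠ k) {a : Aqt} (ha : a * gen (Gen.e l) = a)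
    {x : Ae0 ⧸ I} (hx : Ws k x) : a • x = 0 := by
  have h := toAqt_rel (QuiverRel.e_e_ne l k hkl)
  rw [map_mul, map_zero] at h
  rw [← e_smul_wordSum hx, ← ha, mul_smul, ← mul_smul (gen (Gen.e l))]
  change a • (toAqt (Free.e l) * toAqt (Free.e k)) • x = 0
  rw [h, zero_smul, smul_zero]

theorem up_smul_wordSum {k j : ℕ} (hj : j < k) {x : Ae0 ⧸ I} (hx : Ws k x) :
    Ws k (((up (unitT k) j : Aqtˣ) : Aqt) • x) := by
  induction j generalizing x with
  | zero => rwa [up, Units.val_one, one_smul]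
  | succ j ih =>
    rw [up, Units.val_mul, mul_smul]
    exact ih (by omega) (hx.T_smul doubleDyckRing vacuum (by omega) hj)

/-- The sums of words, over all vertices. -/
def wordSpan : AddSubgroup (Ae0 ⧸ I) := AddSubgroup.closure {x | ∃ k, Ws k x}

theorem wordSum_mem {k : ℕ} {x : Ae0 ⧸ I} (hx : Ws k x) : x ∈ wordSpan :=
  AddSubgroup.subset_closure ⟨k, hx⟩

theorem gen_smul_wordSum_mem (g : Gen) {k : ℕ} {x : Ae0 ⧸ I} (hx : Ws k x) :
    gen g • x ∈ wordSpan := by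
  have hz : ∀ l, l ≠ k → gen g * gen (Gen.e l) = gen g → gen g • x ∈ wordSpan := by
    intro l hl ha
    rw [smul_wordSum_eq_zero hl ha hx]
    exact wordSpan.zero_mem
  cases g with
  | e l =>
    by_cases hl : l = k
    · subst hl
      rw [e_smul_wordSum hx]
      exact wordSum_mem hx
    · exact hz l hl (gen_e_mul_self l)
  | dPlus l =>
    by_cases hl : l = k
    · subst hl
      have e : gen (Gen.dPlus l) =
          algebraMap K Aqt (-1) * ((up (unitT (l + 1)) l : Aqtˣ) * ringS unitT dpA l) := by
        rw [ringS, mul_neg, Units.mul_inv_cancel_left, map_neg, map_one, neg_mul_neg, one_mul]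
        rfl
      rw [e, mul_smul, mul_smul]
      exact wordSum_mem
        ((up_smul_wordSum (by omega) (hx.S_smul doubleDyckRing vacuum)).smul _)
    · exact hz l hl (dpA_e l)
  | dPlusStar l =>
    by_cases hl : l = k
    · subst hl
      exact wordSum_mem (hx.ds_smul doubleDyckRing vacuum)
    · exact hz l hl (dsA_e l)
  | dMinus l =>
    by_cases hl : l + 1 = k
    · subst hl
      exact wordSum_mem hx.dm_smul
    · exact hz (l + 1) hl (dmA_e l)
  | T l i h =>
    have e : gen (Gen.T l i h) = loopT l i := by rw [loopT, Free.T, dif_pos h]; rfl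
    by_cases hl : l = k
    · subst hl
      rw [← e_smul_wordSum hx, e, ← mul_smul, ← unitT_mul h.1 h.2 (gen_e_mul_self l), mul_smul,
        e_smul_wordSum hx]
      exact wordSum_mem (hx.T_smul doubleDyckRing vacuum h.1 h.2)
    · exact hz l hl (by rw [e, loopT_e h.1 h.2])

theorem smul_mem_wordSpan (a : Aqt) {x : Ae0 ⧸ I} (hx : x ∈ wordSpan) : a • x ∈ wordSpan := by
  obtain ⟨f, rfl⟩ := toAqt_surjective a
  induction f using FreeAlgebra.induction generalizing x with
  | grade0 c =>
    rw [AlgHom.commutes]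
    induction hx using AddSubgroup.closure_induction with
    | mem x hx =>
      obtain ⟨k, hx⟩ := hx
      exact wordSum_mem (hx.smul c)
    | zero => rw [smul_zero]; exact wordSpan.zero_mem
    | add x x' _ _ ih ih' => rw [smul_add]; exact wordSpan.add_mem ih ih'
    | neg x _ ih => rw [smul_neg]; exact wordSpan.neg_mem ih
  | grade1 g =>
    induction hx using AddSubgroup.closure_induction with
    | mem x hx =>
      obtain ⟨k, hx⟩ := hx
      exact gen_smul_wordSum_mem g hx
    | zero => rw [smul_zero]; exact wordSpan.zero_mem
    | add x x' _ _ ih ih' => rw [smul_add]; exact wordSpan.add_mem ih ih'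
    | neg x _ ih => rw [smul_neg]; exact wordSpan.neg_mem ih
  | mul f g hf hg => rw [map_mul, mul_smul]; exact hf (hg hx)
  | add f g hf hg => rw [map_add, add_smul]; exact wordSpan.add_mem (hf hx) (hg hx)

theorem wordSpan_eq_top : wordSpan = ⊤ := by
  rw [eq_top_iff]
  rintro x -
  obtain ⟨⟨a, ha⟩, rfl⟩ := Submodule.Quotient.mk_surjective I x
  obtain ⟨b, rfl⟩ := Submodule.mem_span_singleton.1 ha
  exact smul_mem_wordSpan b (wordSum_mem (.of_poly .vec) : vacVec 0 ∈ wordSpan)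

/-! ### The isomorphism -/

/-- The map `F ↦ ψ_k(F) v_k`, with `ψ_k = symHom k`, from `V_*` to the quotient module. -/
def symMap : VStar →+ Ae0 ⧸ I :=
  DirectSum.toAddMonoid fun k =>
    { toFun := fun F => symHom k F • vacVec k
      map_zero' := by rw [map_zero, zero_smul]
      map_add' := fun F G => by rw [map_add, add_smul] }

theorem symMap_inV (k : ℕ) (F : V k) : symMap (inV k F) = symHom k F • vacVec k :=
  DirectSum.toAddMonoid_of _ _ _

theorem exists_of_symVec {k : ℕ} {x : Ae0 ⧸ I}
    (hx : Vacuum.SymVec unitT dmA dpA vacVec k x) : ∃ F : V k, symHom k F • vacVec k = x := by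
  induction hx with
  | vec => exact ⟨1, by rw [map_one, one_smul]⟩
  | add _ _ ih ih' =>
    obtain ⟨F, rfl⟩ := ih
    obtain ⟨G, rfl⟩ := ih'
    exact ⟨F + G, by rw [map_add, add_smul]⟩
  | smul c _ ih =>
    obtain ⟨F, rfl⟩ := ih
    exact ⟨c • F, by rw [map_smul, smul_smul_algebraMap]⟩
  | @loop i h1 h2 x _ ih =>
    obtain ⟨F, rfl⟩ := ih
    obtain ⟨i, rfl⟩ : ∃ i', i = i' + 1 := ⟨i - 1, by omega⟩
    exact ⟨y ⟨i, h2⟩ * F, by rw [map_mul (symHom k), symHom_y, mul_smul]⟩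
  | elem n _ ih =>
    obtain ⟨F, rfl⟩ := ih
    exact ⟨pExpCoeff k n * F, by rw [map_mul (symHom k), symHom_pExpCoeff, mul_smul]⟩

theorem symMap_surjective : Function.Surjective symMap := by
  rw [← AddMonoidHom.range_eq_top, eq_top_iff, ← wordSpan_eq_top, wordSpan,
    AddSubgroup.closure_le]
  rintro x ⟨k, hx⟩
  obtain ⟨F, rfl⟩ := exists_of_symVec (hx.symVec doubleDyckRing vacuum)
  exact ⟨inV k F, symMap_inV k F⟩

/-- The map from the quotient module to `V_*` induced by the natural map. -/
def quotientMap : (Ae0 ⧸ I) →ₗ[Aqt] ActionModule action := I.liftQ (naturalMap action) I_le_ker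

theorem quotientMap_mk (a : Ae0) :
    quotientMap (Submodule.Quotient.mk a) = naturalMap action a := rfl

theorem quotientMap_symMap (w : VStar) : quotientMap (symMap w) = w := by
  induction w using DirectSum.induction_on with
  | zero => rw [map_zero, map_zero]; rfl
  | of k F =>
    refine (congrArg quotientMap (symMap_inV k F)).trans ?_
    rw [map_smul]
    refine (congrArg (action (symHom k F)) (naturalMap_dsPow k)).trans ?_
    rw [action_symHom, mul_one]
    rfl
  | add w w' ih ih' =>
    rw [map_add, map_add, ih, ih']
    rfl

theorem quotientMap_bijective : Function.Bijective quotientMap := by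
  refine ⟨(injective_iff_map_eq_zero _).2 fun x hx => ?_, fun w => ⟨symMap w, quotientMap_symMap w⟩⟩
  obtain ⟨w, rfl⟩ := symMap_surjective x
  rw [quotientMap_symMap] at hx
  rw [show w = 0 from hx, map_zero]

theorem ker_naturalMap : LinearMap.ker (naturalMap action) = I := by
  refine le_antisymm (fun a ha => ?_) I_le_ker
  rw [← Submodule.Quotient.mk_eq_zero I]
  apply quotientMap_bijective.1
  rw [quotientMap_mk, map_zero]
  exact ha

end

end DoubleDyck

theorem mainTheorem3 :
    ∃ ρ : DoubleDyck.Aqt →ₐ[DoubleDyck.K] Module.End DoubleDyck.K DoubleDyck.VStar,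
      (∀ g : DoubleDyck.Gen, ρ (DoubleDyck.gen g) = DoubleDyck.op g) ∧
      LinearMap.ker (DoubleDyck.naturalMap ρ) = DoubleDyck.I ∧
      ∃ φ : (DoubleDyck.Ae0 ⧸ DoubleDyck.I) ≃ₗ[DoubleDyck.Aqt] DoubleDyck.ActionModule ρ,
        ∀ a : DoubleDyck.Ae0, φ (Submodule.Quotient.mk a) = DoubleDyck.naturalMap ρ a :=
  ⟨DoubleDyck.action, DoubleDyck.action_gen, DoubleDyck.ker_naturalMap,
    LinearEquiv.ofBijective DoubleDyck.quotientMap DoubleDyck.quotientMap_bijective,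
    fun a => DoubleDyck.quotientMap_mk a⟩
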